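/- Infinite chess is played on the board $\mathbb Z\times\mathbb Z$ with the usual pieces and moves; white pawns move upward and black pawns downward, one square at a time, and there is no promotion, castling or en passant, and no repetition or 50-move rule. A game is won by checkmate; infinite play and stalemate are draws. A position consists of an assignment of pieces to squares and an indication of whose turn it is; it is computable if the assignment is a Turing computable function. A strategy for a player from a given position is a function that assigns to each finite sequence of prior moves the next move, and that gives the player a legal move whenever one exists; it is computable if this function is Turing computable. **Theorem.** There is a position in infinite chess, in which each side has exactly one king and the side not to move is not in check, such that: 1. The position is computable. 2. In the category of computable play, the position is a win for white: white has a computable strategy defeating every computable strategy for black. 3. Furthermore, white has a computable strategy defeating every computable strategy for black in which every move of white gives check. 4. White also has a computable strategy defeating every computable strategy for black in which white simply moves his king back and forth between two squares until his last four moves, which force checkmate; that is, whenever he makes a different move, he from then on (including this move) forces checkmate in at most four moves, whatever black replies. 5. In the category of arbitrary play, the position is drawn: neither player has a winning strategy, and each player has a strategy forcing a draw. White has a computable drawing strategy that does not depend on the moves of black (its moves form a fixed sequence). Black has a drawing strategy of low Turing degree (its Turing jump is Turing equivalent to the halting problem $0'$) that does not depend on the moves of white (its moves form a fixed sequence). 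-/

import Mathlib

namespace InfChess

/-! ### Pieces, boards, positions -/

/-- The two players. -/
inductive Color
  | white
  | black
  deriving DecidableEq

/-- The opponent of a player. -/
def Color.other : Color → Color
  | .white => .black
  | .black => .white

/-- The direction in which the pawns of a player advance: white pawns move upward. -/
def Color.forward : Color → ℤ
  | .white => 1
  | .black => -1

/-- The six kinds of chess pieces. -/
inductive PieceKind
  | king
  | queen
  | rook
  | bishop
  | knight
  | pawn
  deriving DecidableEq

/-- Colours as booleans (used only to encode them by natural numbers). -/
def Color.equivBool : Color ≃ Bool where
  toFun c := match c with
    | .white => true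
    | .black => false
  invFun b := match b with
    | true => .white
    | false => .black
  left_inv c := by cases c <;> rfl
  right_inv b := by cases b <;> rfl

/-- Piece kinds as numbers below six (used only to encode them by natural numbers). -/
def PieceKind.equivFin : PieceKind ≃ Fin 6 where
  toFun k := match k with
    | .king => 0
    | .queen => 1
    | .rook => 2
    | .bishop => 3
    | .knight => 4
    | .pawn => 5
  invFun i := match i with
    | 0 => .king
    | 1 => .queen
    | 2 => .rook
    | 3 => .bishop
    | 4 => .knight
    | 5 => .pawn
  left_inv k := by cases k <;> rfl
  right_inv i := by fin_cases i <;> rfl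

instance : Primcodable Color := Primcodable.ofEquiv Bool Color.equivBool

instance : Primcodable PieceKind := Primcodable.ofEquiv (Fin 6) PieceKind.equivFin

/-- A square `(x, y)` of the infinite board: `x` is the file, `y` is the rank. -/
abbrev Square : Type := ℤ × ℤ

/-- A piece, with the player it belongs to. -/
abbrev Piece : Type := Color × PieceKind

/-- A board position: each square is empty or holds one piece. -/
abbrev Board : Type := Square → Option Piece

/-- A move takes the piece on the first square to the second square (capturing what stands there).
There is no castling, no promotion and no capture en passant, so this determines the move. -/
abbrev Move : Type := Square × Square

/-- A position: a board position together with the player whose turn it is. -/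
structure Position where
  board : Board
  turn : Color

/-! ### The rules -/

/-- From `s` one reaches `t` by one or more steps in the direction `d`, and all squares strictly
between them are empty. -/
def Slides (b : Board) (s t d : Square) : Prop :=
  ∃ n : ℕ, 0 < n ∧ t = s + n • d ∧ ∀ i : ℕ, 0 < i → i < n → b (s + i • d) = none

/-- The four directions along files and ranks. -/
def IsOrthogonal (d : Square) : Prop :=
  d.1.natAbs + d.2.natAbs = 1

/-- The four diagonal directions. -/
def IsDiagonal (d : Square) : Prop :=
  d.1.natAbs = 1 ∧ d.2.natAbs = 1

/-- The piece standing on `s` (if any) attacks the square `t`. -/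
def Attacks (b : Board) (s t : Square) : Prop :=
  match b s with
  | none => False
  | some (_, .king) => s ≠ t ∧ (t.1 - s.1).natAbs ≤ 1 ∧ (t.2 - s.2).natAbs ≤ 1
  | some (_, .queen) => ∃ d, (IsOrthogonal d ∨ IsDiagonal d) ∧ Slides b s t d
  | some (_, .rook) => ∃ d, IsOrthogonal d ∧ Slides b s t d
  | some (_, .bishop) => ∃ d, IsDiagonal d ∧ Slides b s t d
  | some (_, .knight) =>
      ((t.1 - s.1).natAbs = 1 ∧ (t.2 - s.2).natAbs = 2) ∨
        ((t.1 - s.1).natAbs = 2 ∧ (t.2 - s.2).natAbs = 1)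
  | some (c, .pawn) => (t.1 - s.1).natAbs = 1 ∧ t.2 = s.2 + c.forward

/-- Player `c` is in check: some king of `c` is attacked by a piece of the opponent. -/
def InCheck (b : Board) (c : Color) : Prop :=
  ∃ t, b t = some (c, .king) ∧ ∃ s k, b s = some (c.other, k) ∧ Attacks b s t

/-- The position after a move. -/
def Position.play (p : Position) (m : Move) : Position where
  board := Function.update (Function.update p.board m.1 none) m.2 (p.board m.1)
  turn := p.turn.other

/-- The move is made with a piece of the player to move, in the way this piece moves, and does not
capture a piece of the same player. A pawn advances by one square to an empty square, or captures
diagonally; every other piece moves to a square that it attacks. -/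
def PseudoLegal (p : Position) (m : Move) : Prop :=
  ∃ k, p.board m.1 = some (p.turn, k) ∧ (∀ k', p.board m.2 ≠ some (p.turn, k')) ∧
    if k = .pawn then
      (m.2 = m.1 + (0, p.turn.forward) ∧ p.board m.2 = none) ∨
        (Attacks p.board m.1 m.2 ∧ p.board m.2 ≠ none)
    else Attacks p.board m.1 m.2

/-- A legal move: it does not leave the own king in check. -/
def Legal (p : Position) (m : Move) : Prop :=
  PseudoLegal p m ∧ ¬ InCheck (p.play m).board p.turn

/-- The player to move is checkmated. -/
def Checkmate (p : Position) : Prop :=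
  InCheck p.board p.turn ∧ ∀ m, ¬ Legal p m

/-- Each player has exactly one king, and the player who is not to move is not in check. -/
def Position.Proper (p : Position) : Prop :=
  (∀ c, ∃! s, p.board s = some (c, .king)) ∧ ¬ InCheck p.board p.turn.other

/-! ### Plays and strategies

A finite sequence of moves is a list, the earliest move first. -/

/-- The position reached from `p` by a finite sequence of moves. -/
def after (p : Position) (h : List Move) : Position :=
  h.foldl Position.play p

/-- The sequence of moves `h` is a legal (partial) play from `p`. -/
def IsPlay (p : Position) (h : List Move) : Prop :=
  ∀ h' m, h' ++ [m] <+: h → Legal (after p h') m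

/-- A strategy says what to play next, given the prior sequence of moves. -/
abbrev Strategy : Type := List Move → Move

/-- In the play `h` from `p`, player `c` made all his moves as told by `τ`. -/
def Follows (p : Position) (c : Color) (τ : Strategy) (h : List Move) : Prop :=
  ∀ h' m, h' ++ [m] <+: h → (after p h').turn = c → m = τ h'

/-- The legal plays from `p` that can arise when player `c` uses `τ`. -/
def Arises (p : Position) (c : Color) (τ : Strategy) (h : List Move) : Prop :=
  IsPlay p h ∧ Follows p c τ h

/-- `τ` is a strategy for player `c` from `p`: whatever the opponent does, it tells `c` a legal move
whenever it is his turn and he has a legal move. -/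
def IsStrategy (p : Position) (c : Color) (τ : Strategy) : Prop :=
  ∀ h, Arises p c τ h → (after p h).turn = c → (∃ m, Legal (after p h) m) → Legal (after p h) (τ h)

/-- The sequence of the first `n` moves when white uses `τ` and black uses `σ`. -/
def playSeq (p : Position) (τ σ : Strategy) : ℕ → List Move
  | 0 => []
  | n + 1 =>
      playSeq p τ σ n ++
        [if (after p (playSeq p τ σ n)).turn = .white then τ (playSeq p τ σ n)
          else σ (playSeq p τ σ n)]

/-- When white uses `τ` and black uses `σ`, the play is won by player `c`: after finitely many
legal moves the opponent of `c` is checkmated. -/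
def Wins (p : Position) (τ σ : Strategy) (c : Color) : Prop :=
  ∃ n, IsPlay p (playSeq p τ σ n) ∧ (after p (playSeq p τ σ n)).turn = c.other ∧
    Checkmate (after p (playSeq p τ σ n))

/-- Black, using `σ` against the strategy `τ` of white, never plays an illegal move when he has a
legal one. Every `σ` with `IsStrategy p .black σ` has this property against every `τ`. -/
def BlackMovesLegally (p : Position) (τ σ : Strategy) : Prop :=
  ∀ n, IsPlay p (playSeq p τ σ n) → (after p (playSeq p τ σ n)).turn = .black →
    (∃ m, Legal (after p (playSeq p τ σ n)) m) →
      Legal (after p (playSeq p τ σ n)) (σ (playSeq p τ σ n))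

/-- White's strategy `τ` defeats every computable strategy of black. -/
def DefeatsAllComputable (p : Position) (τ : Strategy) : Prop :=
  ∀ σ : Strategy, Computable σ → BlackMovesLegally p τ σ → Wins p τ σ .white

/-- Every move that white makes with `τ` gives check. -/
def AlwaysChecks (p : Position) (τ : Strategy) : Prop :=
  ∀ h, Arises p .white τ h → (after p h).turn = .white → (∃ m, Legal (after p h) m) →
    InCheck (after p (h ++ [τ h])).board .black

/-- After the prior moves `h`, with white to move, the strategy `τ` of white forces checkmate in at
most `n` white moves, whatever black replies. -/
def MatesWithin (p : Position) (τ : Strategy) : ℕ → List Move → Prop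
  | 0, _ => False
  | n + 1, h =>
      Legal (after p h) (τ h) ∧
        (Checkmate (after p (h ++ [τ h])) ∨
          ((∃ m, Legal (after p (h ++ [τ h])) m) ∧
            ∀ m, Legal (after p (h ++ [τ h])) m → MatesWithin p τ n (h ++ [τ h] ++ [m])))

/-- With `τ`, white moves his king back and forth between two squares until he forces checkmate in
at most `n` further moves of his own. -/
def ShufflesUntilMateIn (p : Position) (τ : Strategy) (n : ℕ) : Prop :=
  ∃ a b : Square, ∀ h, Arises p .white τ h → (after p h).turn = .white →
    (∃ m, Legal (after p h) m) →
      ((τ h = (a, b) ∨ τ h = (b, a)) ∧ (after p h).board (τ h).1 = some (.white, .king)) ∨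
        MatesWithin p τ n h

/-- The moves told by `τ` depend only on how many moves have been made: they form one sequence
fixed in advance, independent of the moves of the opponent. -/
def Oblivious (τ : Strategy) : Prop :=
  ∀ h h' : List Move, h.length = h'.length → τ h = τ h'

/-- `τ` forces a draw for player `c`: no play with `τ` ever reaches a checkmate. -/
def IsDrawingStrategy (p : Position) (c : Color) (τ : Strategy) : Prop :=
  IsStrategy p c τ ∧ ∀ h, Arises p c τ h → ¬ Checkmate (after p h)

/-- Player `c` has a winning strategy: one that defeats all strategies of the opponent. -/
def HasWinningStrategy (p : Position) : Color → Prop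
  | .white => ∃ τ, IsStrategy p .white τ ∧ ∀ σ, IsStrategy p .black σ → Wins p τ σ .white
  | .black => ∃ σ, IsStrategy p .black σ ∧ ∀ τ, IsStrategy p .white τ → Wins p τ σ .black

/-! ### Low Turing degree -/

/-- Programs for the partial functions that are computable with an oracle. -/
inductive OracleCode
  | zero
  | succ
  | left
  | right
  | oracle
  | pair (c d : OracleCode)
  | comp (c d : OracleCode)
  | prec (c d : OracleCode)
  | rfind (c : OracleCode)

/-- The partial function computed by a program with oracle `g`; the clauses are those of
`Nat.RecursiveIn`. -/
def OracleCode.eval (g : ℕ → ℕ) : OracleCode → ℕ →. ℕ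
  | .zero => fun _ => Part.some 0
  | .succ => fun n => Part.some (n + 1)
  | .left => fun n => Part.some n.unpair.1
  | .right => fun n => Part.some n.unpair.2
  | .oracle => fun n => Part.some (g n)
  | .pair c d => fun n => Nat.pair <$> c.eval g n <*> d.eval g n
  | .comp c d => fun n => d.eval g n >>= c.eval g
  | .prec c d => fun p =>
      p.unpair.2.rec (c.eval g p.unpair.1) fun y IH =>
        IH >>= fun i => d.eval g (Nat.pair p.unpair.1 (Nat.pair y i))
  | .rfind c => fun a =>
      Nat.rfind fun n => (fun m => decide (m = 0)) <$> c.eval g (Nat.pair a n)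

/-- The program with a given number. Numbers `0` to `4` are the basic programs; a larger number
`4 * m + r + 5` with `r < 4` is one of the four ways `r` to build a program from `m`. -/
def OracleCode.ofNat (n : ℕ) : OracleCode :=
  if n = 0 then .zero
  else if n = 1 then .succ
  else if n = 2 then .left
  else if n = 3 then .right
  else if n = 4 then .oracle
  else if (n - 5) % 4 = 0 then
    .pair (OracleCode.ofNat ((n - 5) / 4).unpair.1) (OracleCode.ofNat ((n - 5) / 4).unpair.2)
  else if (n - 5) % 4 = 1 then
    .comp (OracleCode.ofNat ((n - 5) / 4).unpair.1) (OracleCode.ofNat ((n - 5) / 4).unpair.2)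
  else if (n - 5) % 4 = 2 then
    .prec (OracleCode.ofNat ((n - 5) / 4).unpair.1) (OracleCode.ofNat ((n - 5) / 4).unpair.2)
  else .rfind (OracleCode.ofNat ((n - 5) / 4))
termination_by n
decreasing_by
  all_goals
    have h1 := Nat.unpair_left_le ((n - 5) / 4)
    have h2 := Nat.unpair_right_le ((n - 5) / 4)
    omega

open Classical in
/-- The Turing jump of `g`: (the characteristic function of) the set of all `e` such that the `e`-th
program with oracle `g` halts on input `e`. -/
noncomputable def jump (g : ℕ → ℕ) : ℕ → ℕ :=
  fun e => if ((OracleCode.ofNat e).eval g e).Dom then 1 else 0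

/-- `g` has low Turing degree: its jump is Turing equivalent to the halting problem. -/
def IsLow (g : ℕ → ℕ) : Prop :=
  TuringEquivalent (fun n => Part.some (jump g n)) (fun n => Part.some (jump (fun _ => 0) n))

/-- A strategy as a function on natural numbers, through the standard encodings of finite sequences
of moves and of moves by numbers. -/
def Strategy.toNat (τ : Strategy) : ℕ → ℕ :=
  fun n => Encodable.encode ((Encodable.decode n : Option (List Move)).map τ)

end InfChess

/-!
The black king stands at the root of a tree of squares that goes up the board, in the middle of an
otherwise full board of white pieces, nearly all of them pawns (`cellOf`, `start`). Every square
next to the tree is guarded, so the king can only move from node to node. Climbing means capturing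
the pawns on the nodes, and the pieces near the tree are placed such that the king is never in
danger while it climbs, but a step back, and every move at a leaf, allows white to mate within four
moves. The white king has two squares of its own far below, between which it moves while nothing
happens.

The tree of squares (`nodes`) is a drawing of a computable infinite binary tree `alive`. Its
infinite paths are the functions with values in `{0, 1}` that differ at each `i` from the output of
the `i`-th program on `i`, so that none of them is computable (`no_computable_path`), while the
tree has vertices on all levels.

* *Computable play.* A black king that survives against a computable strategy of white has to climb
  forever, and if its strategy is computable, too, then so is its path (`Guide.defeats`). Hence
  white wins by waiting until a local mate appears (`hunter`). Alternatively, white closes the way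
  back by pushing, after each step of the king, the pawn below the square that the king has just
  left (`push`); this pawn gives check, and it mates a king that is on a leaf.
* *Arbitrary play.* White draws by moving the king back and forth (`shuffle_draws`). Black draws by
  walking along an infinite path of the tree (`walk_draws`): on its way the king leaves empty nodes
  behind, through which white pieces from below may follow, but they are never faster than the
  king, and around the tree all pieces lock each other. What white can achieve is described by the
  invariant `Sealed`. By the low basis theorem (`low_basis`), the path, and with it the strategy
  `walk`, can be chosen of low degree.

The geometry is reduced to finitely many checks as follows. Near each of its nodes the tree looks
like one of finitely many pictures (`Kind`, `places`, `exists_place`), and what is claimed about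
play near a node concerns only pieces at a distance of at most ten; so the claims are decided by
evaluation in the kernel for each picture (`places_chk`, `places_chkMate`). Mates are found there
by following scripts, for boards of which only the part near the king is known (`Know`, `LMate`),
and they are lifted to the actual position by `LStep.sound`.
-/


namespace InfChess

/-! ### Attacks, from local information -/

/-- The eight directions of king steps. -/
def dirs : List Square :=
  [(1, 0), (-1, 0), (0, 1), (0, -1), (1, 1), (1, -1), (-1, 1), (-1, -1)]

/-- The eight knight's moves. -/
def kdirs : List Square :=
  [(1, 2), (2, 1), (2, -1), (1, -2), (-1, -2), (-2, -1), (-2, 1), (-1, 2)]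

/-- Whether a piece of the given kind slides along the direction `d` (one of `dirs`). -/
def hits (d : Square) : PieceKind → Bool
  | .queen => true
  | .rook => d.1 == 0 || d.2 == 0
  | .bishop => !(d.1 == 0 || d.2 == 0)
  | _ => false

/-- Partial knowledge of a board relative to some origin: a square may be unknown (`none`),
known to be empty (`some none`), or known to hold a white piece of the given kind. -/
abbrev Know : Type := Square → Option (Option PieceKind)

/-- The board `b`, seen from `x`, agrees with the partial knowledge `f`. -/
def Realizes (b : Board) (x : Square) (f : Know) : Prop :=
  ∀ q c, f q = some c → b (x + q) = c.map (Prod.mk .white)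

/-- Looking from `t` in direction `d` over at most `n` squares, the first piece is known and is a
white piece that attacks `t` along this line. -/
def scan (f : Know) (d : Square) : ℕ → Square → Bool
  | 0, _ => false
  | n + 1, t =>
    match f (t + d) with
    | some none => scan f d n (t + d)
    | some (some k) => hits d k
    | none => false

/-- The square `t` is known to be attacked by white. -/
def attacked (f : Know) (t : Square) : Bool :=
  f (t + (-1, -1)) == some (some .pawn) || f (t + (1, -1)) == some (some .pawn) ||
    (kdirs.any fun d => f (t + d) == some (some .knight)) || dirs.any fun d => scan f d 12 t

/-- White attacks the square `t`. -/
def WhiteAttacks (b : Board) (t : Square) : Prop :=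
  ∃ s k, b s = some (.white, k) ∧ Attacks b s t

theorem scan_sound {b : Board} {x : Square} {f : Know} (hf : Realizes b x f) {d : Square} :
    ∀ {n : ℕ} {t : Square}, scan f d n t = true →
      ∃ (m : ℕ) (k : PieceKind), 0 < m ∧ hits d k = true ∧ b (x + t + m • d) = some (.white, k) ∧
        ∀ i : ℕ, 0 < i → i < m → b (x + t + i • d) = none
  | 0, _, h => by simp [scan] at h
  | n + 1, t, h => by
    unfold scan at h
    split at h
    · next h1 =>
      obtain ⟨m, k, h0, hk, hb, hi⟩ := scan_sound hf h
      refine ⟨m + 1, k, by omega, hk, ?_, fun i h1' h2 => ?_⟩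
      · rw [← hb]; congr 1; rw [succ_nsmul]; abel
      · rcases Nat.lt_or_ge 1 i with h3 | h3
        · have := hi (i - 1) (by omega) (by omega)
          rw [← this]; congr 1
          obtain ⟨j, rfl⟩ : ∃ j, i = j + 1 := ⟨i - 1, by omega⟩
          rw [Nat.add_sub_cancel, succ_nsmul]; abel
        · obtain rfl : i = 1 := by omega
          have := hf _ _ h1
          rw [one_nsmul, add_assoc, this]; rfl
    · next k h1 =>
      refine ⟨1, k, by omega, h, ?_, fun i h1' h2 => by omega⟩
      have := hf _ _ h1
      rw [one_nsmul, add_assoc, this]; rfl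
    · simp at h

theorem attacks_of_ray {b : Board} {t d : Square} {m : ℕ} {k : PieceKind} {c : Color}
    (hd : d ∈ dirs) (hm : 0 < m) (hk : hits d k = true) (hb : b (t + m • d) = some (c, k))
    (hi : ∀ i : ℕ, 0 < i → i < m → b (t + i • d) = none) : Attacks b (t + m • d) t := by
  have hs : Slides b (t + m • d) t (-d) := by
    refine ⟨m, hm, by rw [smul_neg]; abel, fun i h1 h2 => ?_⟩
    rw [← hi (m - i) (by omega) (by omega)]
    congr 1
    obtain ⟨j, rfl⟩ : ∃ j, m = i + j := ⟨m - i, by omega⟩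
    rw [Nat.add_sub_cancel_left, add_nsmul, smul_neg]; abel
  unfold Attacks
  rw [hb]
  have hdd : (hits d .rook = true → IsOrthogonal (-d)) ∧ (hits d .bishop = true → IsDiagonal (-d)) ∧
      (IsOrthogonal (-d) ∨ IsDiagonal (-d)) := by
    simp only [dirs, List.mem_cons, List.not_mem_nil, or_false] at hd
    rcases hd with rfl | rfl | rfl | rfl | rfl | rfl | rfl | rfl <;>
      simp [hits, IsOrthogonal, IsDiagonal]
  cases k <;> simp only [hits, Bool.false_eq_true] at hk
  · exact ⟨-d, hdd.2.2, hs⟩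
  · exact ⟨-d, hdd.1 hk, hs⟩
  · exact ⟨-d, hdd.2.1 hk, hs⟩

theorem mem_kdirs {d : Square} : d ∈ kdirs ↔
    (d.1.natAbs = 1 ∧ d.2.natAbs = 2) ∨ (d.1.natAbs = 2 ∧ d.2.natAbs = 1) := by
  obtain ⟨x, y⟩ := d
  simp only [kdirs, List.mem_cons, List.not_mem_nil, or_false, Prod.mk.injEq]
  omega

theorem attacked_sound {b : Board} {x : Square} {f : Know} (hf : Realizes b x f) {t : Square}
    (h : attacked f t = true) : WhiteAttacks b (x + t) := by
  simp only [attacked, Bool.or_eq_true, beq_iff_eq, List.any_eq_true] at h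
  rcases h with ((h | h) | ⟨d, hd, h⟩) | ⟨d, hd, h⟩
  · have hb : b (x + (t + (-1, -1))) = some (.white, .pawn) := hf _ _ h
    refine ⟨_, _, hb, ?_⟩
    unfold Attacks; rw [hb]; simp [Color.forward]; ring
  · have hb : b (x + (t + (1, -1))) = some (.white, .pawn) := hf _ _ h
    refine ⟨_, _, hb, ?_⟩
    unfold Attacks; rw [hb]; simp [Color.forward]; ring
  · have hb : b (x + (t + d)) = some (.white, .knight) := hf _ _ h
    refine ⟨_, _, hb, ?_⟩
    rw [mem_kdirs] at hd
    unfold Attacks; rw [hb]; simp only [Prod.fst_add, Prod.snd_add]; omega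
  · obtain ⟨m, k, hm, hk, hb, hi⟩ := scan_sound hf h
    exact ⟨_, _, hb, attacks_of_ray hd hm hk hb hi⟩

/-- In direction `d` from `t`, the first piece is one that does not attack `t` along this line. -/
def Blocked (b : Board) (t d : Square) : Prop :=
  ∃ m : ℕ, 0 < m ∧ (∀ i : ℕ, 0 < i → i < m → b (t + i • d) = none) ∧
    ∃ k, b (t + m • d) = some (.white, k) ∧ hits d k = false ∧
      ¬ (k = .pawn ∧ m = 1 ∧ d.2 = -1 ∧ d.1 ≠ 0)

theorem mem_dirs {d : Square} : d ∈ dirs ↔ d ≠ 0 ∧ d.1.natAbs ≤ 1 ∧ d.2.natAbs ≤ 1 := by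
  obtain ⟨x, y⟩ := d
  simp only [dirs, List.mem_cons, List.not_mem_nil, or_false, Prod.mk.injEq, ne_eq,
    Prod.mk_eq_zero]
  omega

theorem mem_dirs_of_line {d : Square} (h : IsOrthogonal d ∨ IsDiagonal d) : -d ∈ dirs := by
  obtain ⟨x, y⟩ := d
  simp only [IsOrthogonal, IsDiagonal] at h
  rw [mem_dirs]
  simp only [Prod.neg_mk, ne_eq, Prod.mk_eq_zero]
  omega

theorem hits_of_line {d : Square} :
    (IsOrthogonal d → hits (-d) .rook = true) ∧ (IsDiagonal d → hits (-d) .bishop = true) := by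
  obtain ⟨x, y⟩ := d
  simp only [IsOrthogonal, IsDiagonal, hits, Prod.neg_mk, Bool.or_eq_true, beq_iff_eq,
    Bool.not_eq_true', Bool.or_eq_false_iff, beq_eq_false_iff_ne]
  omega

theorem slides_blocked {b : Board} {s t d : Square} {k : PieceKind} (hb : b s = some (.white, k))
    (hs : Slides b s t d) (hk : hits (-d) k = true) (h : Blocked b t (-d)) : False := by
  obtain ⟨n, hn, rfl, hi⟩ := hs
  obtain ⟨m, hm, hmi, k', hk', hh, -⟩ := h
  have key : ∀ i ≤ n, s + n • d + i • (-d) = s + (n - i) • d := by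
    intro i hin
    obtain ⟨j, rfl⟩ : ∃ j, n = i + j := ⟨n - i, by omega⟩
    rw [Nat.add_sub_cancel_left, add_nsmul, smul_neg]; abel
  rcases lt_trichotomy m n with h | h | h
  · rw [key m h.le, hi _ (by omega) (by omega)] at hk'
    simp at hk'
  · subst h
    rw [key m le_rfl] at hk'
    simp [hb] at hk'
    rw [hk', hh] at hk; simp at hk
  · have := hmi n hn h
    rw [key n le_rfl] at this
    simp [hb] at this

/-- A square is safe if in each direction the first piece does not attack it along this line, no knight
attacks it, and the white king is far below. -/
theorem not_whiteAttacks {b : Board} {t : Square} (hbl : ∀ d ∈ dirs, Blocked b t d)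
    (hkn : ∀ d ∈ kdirs, b (t + d) ≠ some (.white, .knight))
    (hkg : ∀ s, b s = some (.white, .king) → s.2 + 1 < t.2) : ¬ WhiteAttacks b t := by
  rintro ⟨s, k, hs, ha⟩
  unfold Attacks at ha
  rw [hs] at ha
  cases k with
  | king =>
    have := hkg s hs
    simp only at ha
    omega
  | queen =>
    obtain ⟨d, hd, h⟩ := ha
    exact slides_blocked hs h rfl (hbl _ (mem_dirs_of_line hd))
  | rook =>
    obtain ⟨d, hd, h⟩ := ha
    exact slides_blocked hs h (hits_of_line.1 hd) (hbl _ (mem_dirs_of_line (.inl hd)))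
  | bishop =>
    obtain ⟨d, hd, h⟩ := ha
    exact slides_blocked hs h (hits_of_line.2 hd) (hbl _ (mem_dirs_of_line (.inr hd)))
  | knight =>
    refine hkn (s - t) ?_ (by rwa [add_sub_cancel])
    simp only at ha
    rw [mem_kdirs, Prod.fst_sub, Prod.snd_sub]
    omega
  | pawn =>
    simp only [Color.forward] at ha
    have hd : s - t ∈ dirs := by
      rw [mem_dirs]; simp only [Prod.fst_sub, Prod.snd_sub, ne_eq, sub_eq_zero]
      refine ⟨?_, by omega, by omega⟩
      rintro rfl; omega
    obtain ⟨m, hm, hmi, k', hk', -, hp⟩ := hbl _ hd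
    rcases Nat.lt_or_ge 1 m with h1 | h1
    · have := hmi 1 (by omega) h1
      simp [hs] at this
    · obtain rfl : m = 1 := by omega
      simp [hs] at hk'
      apply hp
      refine ⟨hk'.symm, rfl, ?_, ?_⟩ <;> simp only [Prod.fst_sub, Prod.snd_sub] <;> omega

/-- Looking from `t` in direction `d` over at most `n` squares, the first piece is known and does
not attack `t`; in the two downward diagonal directions it is also enough to see only empty squares down to
the rank `r`. -/
def scanSafe (f : Know) (r : ℤ) (d : Square) : ℕ → Bool → Square → Bool
  | 0, _, _ => false
  | n + 1, first, t =>
    match f (t + d) with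
    | some none =>
      (decide (d.2 = -1 ∧ d.1 ≠ 0) && decide ((t + d).2 ≤ r)) || scanSafe f r d n false (t + d)
    | some (some k) => !hits d k && !(first && k == .pawn && d.2 == -1 && d.1 != 0)
    | none => false

/-- The square `t` is known not to be attacked by white, provided that no long diagonal below the
rank `r` carries an attack. -/
def safe (f : Know) (r : ℤ) (t : Square) : Bool :=
  (kdirs.all fun d => f (t + d) != none && f (t + d) != some (some .knight)) &&
    dirs.all fun d => scanSafe f r d 20 true t

/-- In direction `d` from `t`, the first piece is white and does not slide along this line. -/
def Shielded (b : Board) (t d : Square) : Prop :=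
  ∃ m : ℕ, 0 < m ∧ (∀ i : ℕ, 0 < i → i < m → b (t + i • d) = none) ∧
    ∃ k, b (t + m • d) = some (.white, k) ∧ hits d k = false

/-- From every empty square of rank at most `r`, the two downward diagonals are shielded. -/
def RayOK (b : Board) (r : ℤ) : Prop :=
  ∀ q : Square, q.2 ≤ r → b q = none → ∀ d ∈ dirs, d.2 = -1 → d.1 ≠ 0 → Shielded b q d

theorem scanSafe_sound {b : Board} {x : Square} {f : Know} (hf : Realizes b x f) {r : ℤ}
    (hr : RayOK b (x.2 + r)) {d : Square} (hd : d ∈ dirs) :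
    ∀ {n : ℕ} {first : Bool} {t : Square}, scanSafe f r d n first t = true →
      ∃ m : ℕ, 0 < m ∧ (∀ i : ℕ, 0 < i → i < m → b (x + t + i • d) = none) ∧
        ∃ k, b (x + t + m • d) = some (.white, k) ∧ hits d k = false ∧
          ¬ (k = .pawn ∧ (m = 1 ∧ first = true) ∧ d.2 = -1 ∧ d.1 ≠ 0)
  | 0, _, _, h => by simp [scanSafe] at h
  | n + 1, first, t, h => by
    unfold scanSafe at h
    split at h
    · next h1 =>
      have h1' : b (x + t + d) = none := by
        have := hf _ _ h1
        rw [add_assoc, this]; rfl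
      have step : (∃ m : ℕ, 0 < m ∧ (∀ i : ℕ, 0 < i → i < m → b (x + t + d + i • d) = none) ∧
          ∃ k, b (x + t + d + m • d) = some (.white, k) ∧ hits d k = false) →
          ∃ m : ℕ, 0 < m ∧ (∀ i : ℕ, 0 < i → i < m → b (x + t + i • d) = none) ∧
          ∃ k, b (x + t + m • d) = some (.white, k) ∧ hits d k = false ∧
          ¬ (k = .pawn ∧ (m = 1 ∧ first = true) ∧ d.2 = -1 ∧ d.1 ≠ 0) := by
        rintro ⟨m, hm, hi, k, hk, hh⟩
        refine ⟨m + 1, by omega, fun i h2 h3 => ?_, k, ?_, hh, by omega⟩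
        · rcases Nat.lt_or_ge 1 i with h4 | h4
          · have := hi (i - 1) (by omega) (by omega)
            rw [← this]; congr 1
            obtain ⟨j, rfl⟩ : ∃ j, i = j + 1 := ⟨i - 1, by omega⟩
            rw [Nat.add_sub_cancel, succ_nsmul]; abel
          · obtain rfl : i = 1 := by omega
            rw [one_nsmul, h1']
        · rw [← hk]; congr 1; rw [succ_nsmul]; abel
      apply step
      simp only [Bool.or_eq_true, Bool.and_eq_true, decide_eq_true_eq] at h
      rcases h with ⟨hdd, h⟩ | h
      · obtain ⟨m, hm, hi, k, hk, hh⟩ := hr (x + t + d) (by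
          simp only [Prod.snd_add] at h ⊢; omega) h1' d hd hdd.1 hdd.2
        exact ⟨m, hm, hi, k, hk, hh⟩
      · obtain ⟨m, hm, hi, k, hk, hh, -⟩ := scanSafe_sound hf hr hd h
        rw [← add_assoc] at hi hk
        exact ⟨m, hm, hi, k, hk, hh⟩
    · next k h1 =>
      refine ⟨1, by omega, fun i h1' h2 => by omega, k, ?_, ?_, ?_⟩
      · have := hf _ _ h1
        rw [one_nsmul, add_assoc, this]; rfl
      · revert h; cases hits d k <;> simp
      · rintro ⟨rfl, ⟨-, rfl⟩, h3, h4⟩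
        simp [h3, h4] at h
    · simp at h

theorem safe_sound {b : Board} {x : Square} {f : Know} (hf : Realizes b x f) {r : ℤ}
    (hr : RayOK b (x.2 + r)) {t : Square} (h : safe f r t = true)
    (hkg : ∀ s, b s = some (.white, .king) → s.2 + 1 < (x + t).2) : ¬ WhiteAttacks b (x + t) := by
  simp only [safe, List.all_eq_true, Bool.and_eq_true, bne_iff_ne] at h
  refine not_whiteAttacks (fun d hd => ?_) (fun d hd hb => ?_) hkg
  swap
  · obtain ⟨h1, h2⟩ := h.1 d hd
    obtain ⟨c, hc⟩ := Option.ne_none_iff_exists'.1 h1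
    have := hf _ _ hc
    rw [add_assoc, this] at hb
    rw [hc] at h2
    rcases c with - | c
    · simp at hb
    · simp at hb h2; exact h2 hb
  obtain ⟨m, hm, hi, k, hk, hh, hp⟩ := scanSafe_sound hf hr hd (h.2 d hd)
  exact ⟨m, hm, hi, k, hk, hh, by tauto⟩

/-! ### A lone black king -/

/-- The only black piece is a king on `x`. -/
structure Arena (b : Board) (x : Square) : Prop where
  king : b x = some (.black, .king)
  only : ∀ s k, b s = some (.black, k) → s = x

/-- The board after the black king moves from `x` to `t`. -/
def kplay (b : Board) (x t : Square) : Board :=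
  Function.update (Function.update b x none) t (some (.black, .king))

theorem Arena.inCheck_iff {b : Board} {x : Square} (h : Arena b x) :
    InCheck b .black ↔ WhiteAttacks b x := by
  constructor
  · rintro ⟨t, ht, s, k, hs, ha⟩
    obtain rfl := h.only t _ ht
    exact ⟨s, k, hs, ha⟩
  · rintro ⟨s, k, hs, ha⟩
    exact ⟨x, h.king, s, k, hs, ha⟩

theorem Arena.kplay {b : Board} {x t : Square} (h : Arena b x) : Arena (kplay b x t) t where
  king := by simp [InfChess.kplay]
  only s k hs := by
    by_contra hst
    rw [InfChess.kplay, Function.update_of_ne hst] at hs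
    by_cases hsx : s = x
    · subst hsx; simp at hs
    · rw [Function.update_of_ne hsx] at hs
      exact hsx (h.only s k hs)

theorem Arena.play_eq {b : Board} {x t : Square} (h : Arena b x) {c : Color} :
    (Position.play ⟨b, c⟩ (x, t)).board = InfChess.kplay b x t := by
  simp [Position.play, InfChess.kplay, h.king]

theorem Arena.legal_black {b : Board} {x : Square} (h : Arena b x) {m : Move}
    (hm : Legal ⟨b, .black⟩ m) :
    ∃ d ∈ dirs, m = (x, x + d) ∧ ¬ WhiteAttacks (InfChess.kplay b x (x + d)) (x + d) := by
  obtain ⟨⟨k, hk, -, hp⟩, hc⟩ := hm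
  obtain ⟨s, t⟩ := m
  obtain rfl := h.only _ _ hk
  simp only at hk hp hc
  rw [h.king] at hk
  obtain rfl : PieceKind.king = k := by simpa using hk
  simp only [reduceCtorEq, if_false] at hp
  unfold Attacks at hp
  simp only [h.king] at hp
  refine ⟨t - s, ?_, by simp, ?_⟩
  · rw [mem_dirs]; simp only [Prod.fst_sub, Prod.snd_sub, ne_eq, sub_eq_zero]
    exact ⟨fun e => hp.1 e.symm, hp.2⟩
  · rw [h.play_eq] at hc
    simp only [add_sub_cancel]
    rwa [← h.kplay.inCheck_iff]

theorem Arena.legal_kstep {b : Board} {x d : Square} (h : Arena b x) (hd : d ∈ dirs)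
    (ha : ¬ WhiteAttacks (InfChess.kplay b x (x + d)) (x + d)) :
    Legal ⟨b, .black⟩ (x, x + d) := by
  rw [mem_dirs] at hd
  refine ⟨⟨.king, h.king, fun k' hk' => ?_, ?_⟩, ?_⟩
  · have := h.only _ _ hk'
    simp at this
    exact hd.1 this
  · simp only [reduceCtorEq, if_false]
    unfold Attacks
    simp only [h.king]
    refine ⟨?_, by simpa using hd.2.1, by simpa using hd.2.2⟩
    intro e
    have : x + 0 = x + d := by simpa using e
    exact hd.1 (add_left_cancel this).symm
  · rw [h.play_eq]
    rwa [h.kplay.inCheck_iff]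

theorem Arena.not_inCheck_white {b : Board} {x : Square} (h : Arena b x)
    (hk : ∀ s, b s = some (.white, .king) → s.2 + 1 < x.2) : ¬ InCheck b .white := by
  rintro ⟨t, ht, s, k, hs, ha⟩
  obtain rfl := h.only _ _ hs
  have := hk t ht
  unfold Attacks at ha
  simp only [h.king] at ha
  omega


/-! ### Forced mates from local information -/

/-- A white move relative to some origin: the starting square, a direction, and the number of
steps. -/
abbrev LMove : Type := Square × Square × ℕ

/-- The target square of a relative move. -/
def LMove.tgt (mv : LMove) : Square := mv.1 + mv.2.2 • mv.2.1

/-- Replace the knowledge about one square. -/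
def upd (f : Know) (q : Square) (c : Option (Option PieceKind)) : Know :=
  fun p => if p = q then c else f p

/-- The next `n` squares from `u` in direction `d` are known to be empty. -/
def clearPath (f : Know) (d : Square) : ℕ → Square → Bool
  | 0, _ => true
  | n + 1, u => f (u + d) == some none && clearPath f d n (u + d)

/-- With the black king on the origin, the relative move is known to be a legal move of white (of a
piece other than the king), and it touches only squares above the rank `r`. -/
def moveOK (f : Know) (r : ℤ) (mv : LMove) : Bool :=
  (match f mv.1 with
    | some (some k) =>
      if k = .pawn then mv.2.1 == (0, 1) && mv.2.2 == 1
      else if k = .knight then decide (mv.2.1 ∈ kdirs) && mv.2.2 == 1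
      else hits mv.2.1 k && decide (mv.2.1 ∈ dirs)
    | _ => false) &&
  decide (0 < mv.2.2) && clearPath f mv.2.1 mv.2.2 mv.1 &&
  f 0 == none && decide (r < mv.1.2) && decide (r < mv.tgt.2)

/-- What is known after a white move. -/
def knowAfter (f : Know) (mv : LMove) : Know := upd (upd f mv.1 (some none)) mv.tgt (f mv.1)

/-- What is known after a white move and the reply of the black king to the square `d`. -/
def reply (f : Know) (mv : LMove) (d : Square) : Know :=
  upd (upd (knowAfter f mv) 0 (some none)) d none

/-- Knowledge relative to a shifted origin. -/
def shift (d : Square) (f : Know) : Know := fun q => f (d + q)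

/-- The move `mv` is legal, does not stalemate black, and each reply of the black king to it leads
to knowledge that satisfies `P`. -/
def LStep (P : Know → Prop) (r : ℤ) (f : Know) (mv : LMove) : Prop :=
  moveOK f r mv = true ∧
    (attacked (knowAfter f mv) 0 = true ∨ ∃ d ∈ dirs, safe (reply f mv d) r d = true) ∧
    ∀ d ∈ dirs, attacked (reply f mv d) d = true ∨ P (shift d (reply f mv d))

/-- With the black king on the origin and white to move, the local knowledge suffices for white to
force mate in at most `k` moves. The rank below which nothing is touched depends on `k` in such a
way that a step of the king keeps it available for the next move. -/
def LMate : ℕ → Know → Prop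
  | 0, _ => False
  | k + 1, f => ∃ mv, LStep (LMate k) ((k : ℤ) - 11) f mv

/-- The knowledge concerns only squares at distance at most `n` from the origin. -/
def Supp (f : Know) (n : ℕ) : Prop :=
  ∀ q, f q ≠ none → q.1.natAbs ≤ n ∧ q.2.natAbs ≤ n

theorem Realizes.upd {b : Board} {x : Square} {f : Know} (hf : Realizes b x f) (q : Square)
    (c : Option PieceKind) :
    Realizes (Function.update b (x + q) (c.map (Prod.mk .white))) x (upd f q (some c)) := by
  intro p c' h
  unfold InfChess.upd at h
  split at h
  · next e => subst e; simp at h; subst h; simp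
  · next e => rw [Function.update_of_ne (by simpa using e)]; exact hf _ _ h

theorem Realizes.upd_none {b : Board} {x : Square} {f : Know} (hf : Realizes b x f) (q : Square)
    (c : Option Piece) : Realizes (Function.update b (x + q) c) x (InfChess.upd f q none) := by
  intro p c' h
  unfold InfChess.upd at h
  split at h
  · simp at h
  · next e => rw [Function.update_of_ne (by simpa using e)]; exact hf _ _ h

theorem Realizes.shift {b : Board} {x d : Square} {f : Know} (hf : Realizes b x f) :
    Realizes b (x + d) (shift d f) := by
  intro p c h
  rw [add_assoc]; exact hf _ _ h

theorem clearPath_sound {b : Board} {x : Square} {f : Know} (hf : Realizes b x f) {d : Square} :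
    ∀ {n : ℕ} {u : Square}, clearPath f d n u = true →
      ∀ i : ℕ, 0 < i → i ≤ n → b (x + u + i • d) = none
  | 0, _, _, i, h1, h2 => by omega
  | n + 1, u, h, i, h1, h2 => by
    simp only [clearPath, Bool.and_eq_true, beq_iff_eq] at h
    rcases Nat.lt_or_ge 1 i with h3 | h3
    · have := clearPath_sound hf h.2 (i - 1) (by omega) (by omega)
      rw [← this]; congr 1
      obtain ⟨j, rfl⟩ : ∃ j, i = j + 1 := ⟨i - 1, by omega⟩
      rw [Nat.add_sub_cancel, succ_nsmul]; abel
    · obtain rfl : i = 1 := by omega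
      have := hf _ _ h.1
      rw [one_nsmul, add_assoc, this]; rfl

theorem RayOK.update {b : Board} {r : ℤ} (h : RayOK b r) {s : Square} (hs : r < s.2)
    (c : Option Piece) : RayOK (Function.update b s c) r := by
  have key : ∀ q : Square, q.2 ≤ r → Function.update b s c q = b q := fun q hq =>
    Function.update_of_ne (by rintro rfl; omega) _ _
  intro q hq hb
  rw [key q hq] at hb
  intro d hdd hd2 hd1
  obtain ⟨m, hm, hi, k, hk, hh⟩ := h q hq hb d hdd hd2 hd1
  have hle : ∀ i : ℕ, (q + i • d).2 ≤ r := by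
    intro i
    obtain ⟨d1, d2⟩ := d
    simp only at hd2; subst hd2
    simp only [Prod.snd_add, Prod.smul_mk, smul_neg, nsmul_eq_mul, mul_one]; omega
  exact ⟨m, hm, fun i h1 h2 => by rw [key _ (hle i)]; exact hi i h1 h2, k,
    by rw [key _ (hle m)]; exact hk, hh⟩

theorem Arena.playWhite {b : Board} {x s t : Square} {k : PieceKind} (h : Arena b x)
    (hs : b s = some (.white, k)) (ht : b t = none) :
    Arena (Function.update (Function.update b s none) t (b s)) x where
  king := by
    rw [Function.update_of_ne (by rintro rfl; simp [h.king] at ht),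
      Function.update_of_ne (by rintro rfl; simp [h.king] at hs), h.king]
  only q k' hq := by
    by_cases h1 : q = t
    · subst h1; simp [hs] at hq
    · rw [Function.update_of_ne h1] at hq
      by_cases h2 : q = s
      · subst h2; simp at hq
      · rw [Function.update_of_ne h2] at hq
        exact h.only _ _ hq

/-- Soundness of one step of a local mate. -/
theorem LStep.sound {P : Know → Prop} {r : ℤ} {f : Know} {mv : LMove} {b : Board} {x : Square}
    (hL : LStep P r f mv) (hr1 : r ≤ -2) (hf : Realizes b x f) (ha : Arena b x)
    (hk : ∀ s, b s = some (.white, .king) → s.2 + 3 ≤ x.2) (hr : RayOK b (x.2 + r)) :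
    let m : Move := (x + mv.1, x + mv.tgt)
    let q : Position := Position.play ⟨b, .white⟩ m
    Legal ⟨b, .white⟩ m ∧ (Checkmate q ∨ ∃ m', Legal q m') ∧
      ∀ m', Legal q m' → ∃ d ∈ dirs, m' = (x, x + d) ∧
        Arena (q.play m').board (x + d) ∧ P (shift d (reply f mv d)) ∧
        Realizes (q.play m').board (x + d) (shift d (reply f mv d)) ∧
        RayOK (q.play m').board (x.2 + r) ∧
        ∀ s, (q.play m').board s = some (.white, .king) → b s = some (.white, .king) := by
  intro m q
  obtain ⟨hm, hns, hrep⟩ := hL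
  simp only [moveOK, Bool.and_eq_true, decide_eq_true_eq, beq_iff_eq] at hm
  obtain ⟨⟨⟨⟨⟨hkind, hn⟩, hcl⟩, hf0⟩, hu⟩, hv⟩ := hm
  have hcl' := clearPath_sound hf hcl
  have htgt : x + mv.tgt = x + mv.1 + mv.2.2 • mv.2.1 := by rw [LMove.tgt, add_assoc]
  have hvn : b (x + mv.tgt) = none := by rw [htgt]; exact hcl' _ hn le_rfl
  obtain ⟨k, hfk, hkk⟩ : ∃ k, f mv.1 = some (some k) ∧
      (if k = .pawn then mv.2.1 = (0, 1) ∧ mv.2.2 = 1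
        else if k = .knight then mv.2.1 ∈ kdirs ∧ mv.2.2 = 1
        else hits mv.2.1 k = true ∧ mv.2.1 ∈ dirs) := by
    split at hkind
    · next k h => exact ⟨k, h, by split_ifs at hkind ⊢ <;> simpa using hkind⟩
    · simp at hkind
  have hbu : b (x + mv.1) = some (.white, k) := hf _ _ hfk
  have hqb : q.board = Function.update (Function.update b (x + mv.1) none) (x + mv.tgt)
      (b (x + mv.1)) := rfl
  have ha1 : Arena q.board x := by rw [hqb]; exact ha.playWhite hbu hvn
  have hf1 : Realizes q.board x (knowAfter f mv) := by
    have h1 := hf.upd mv.1 none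
    have h2 := h1.upd mv.tgt (some k)
    rw [hqb, hbu, knowAfter, hfk]; exact h2
  have hr1' : RayOK q.board (x.2 + r) := by
    rw [hqb]
    exact (hr.update (by simpa using hu) _).update (by simpa using hv) _
  have hnk : k ≠ .king := by
    rintro rfl; simp [hits] at hkk
  have hk1 : ∀ s, q.board s = some (.white, .king) → b s = some (.white, .king) := by
    intro s hs
    rw [hqb] at hs
    by_cases h1 : s = x + mv.tgt
    · subst h1; simp [hbu] at hs; exact absurd hs hnk
    · rw [Function.update_of_ne h1] at hs
      by_cases h2 : s = x + mv.1
      · subst h2; simp at hs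
      · rwa [Function.update_of_ne h2] at hs
  have hleg : Legal ⟨b, .white⟩ m := by
    refine ⟨⟨k, hbu, fun k' => by simp [m, hvn], ?_⟩, ha1.not_inCheck_white fun s hs => ?_⟩
    · split_ifs with hp
      · rw [if_pos hp] at hkk
        left
        refine ⟨?_, hvn⟩
        simp only [m, LMove.tgt, hkk, Color.forward]
        rw [one_nsmul, add_assoc]
      · rw [if_neg hp] at hkk
        split_ifs at hkk with hp2
        · subst hp2
          simp only [m, Attacks, hbu, htgt, hkk.2, one_nsmul]
          have := mem_kdirs.1 hkk.1
          simp only [Prod.fst_add, Prod.snd_add]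
          omega
        obtain ⟨hkk, hd⟩ := hkk
        have hs : Slides b (x + mv.1) (x + mv.tgt) mv.2.1 :=
          ⟨mv.2.2, hn, htgt, fun i h1 h2 => hcl' i h1 h2.le⟩
        have hdd : (hits mv.2.1 .rook = true → IsOrthogonal mv.2.1) ∧
            (hits mv.2.1 .bishop = true → IsDiagonal mv.2.1) ∧
            (IsOrthogonal mv.2.1 ∨ IsDiagonal mv.2.1) := by
          revert hd
          generalize mv.2.1 = d
          intro hd
          simp only [dirs, List.mem_cons, List.not_mem_nil, or_false] at hd
          rcases hd with rfl | rfl | rfl | rfl | rfl | rfl | rfl | rfl <;>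
            simp [hits, IsOrthogonal, IsDiagonal]
        simp only [m, Attacks, hbu]
        cases k <;> simp only [hits, Bool.false_eq_true] at hkk
        · exact ⟨_, hdd.2.2, hs⟩
        · exact ⟨_, hdd.1 hkk, hs⟩
        · exact ⟨_, hdd.2.1 hkk, hs⟩
    · have := hk s (hk1 s hs); omega
  have hreal : ∀ d, Realizes (InfChess.kplay q.board x (x + d)) x (reply f mv d) := by
    intro d
    have h1 := hf1.upd 0 none
    rw [add_zero] at h1
    exact h1.upd_none d (some (.black, .king))
  have hrayk : ∀ d ∈ dirs, RayOK (InfChess.kplay q.board x (x + d)) (x.2 + r) := by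
    intro d hd
    rw [mem_dirs] at hd
    refine (hr1'.update (by omega) _).update ?_ _
    simp only [Prod.snd_add]; omega
  have hkk2 : ∀ d s, InfChess.kplay q.board x (x + d) s = some (.white, .king) →
      b s = some (.white, .king) := by
    intro d s hs
    apply hk1
    by_cases h1 : s = x + d
    · subst h1; simp [InfChess.kplay] at hs
    · rw [InfChess.kplay, Function.update_of_ne h1] at hs
      by_cases h2 : s = x
      · subst h2; simp at hs
      · rwa [Function.update_of_ne h2] at hs
  have hq : q = ⟨q.board, .black⟩ := rfl
  refine ⟨hleg, ?_, fun m' hm' => ?_⟩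
  · rcases hns with hc | ⟨d, hd, hsafe⟩
    · by_cases hex : ∃ m', Legal q m'
      · exact .inr hex
      · left
        push Not at hex
        refine ⟨?_, hex⟩
        have := attacked_sound hf1 hc
        rw [add_zero] at this
        exact ha1.inCheck_iff.2 this
    · right
      refine ⟨_, ha1.legal_kstep hd ?_⟩
      refine safe_sound (hreal d) (hrayk d hd) hsafe fun s hs => ?_
      have := hk s (hkk2 d s hs)
      rw [mem_dirs] at hd
      simp only [Prod.snd_add]; omega
  · rw [hq] at hm'
    obtain ⟨d, hd, rfl, hna⟩ := ha1.legal_black hm'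
    have hpb : (q.play (x, x + d)).board = InfChess.kplay q.board x (x + d) := ha1.play_eq
    refine ⟨d, hd, rfl, ?_⟩
    rw [hpb]
    refine ⟨ha1.kplay, ?_, (hreal d).shift, hrayk d hd, hkk2 d⟩
    rcases hrep d hd with h | h
    · exact absurd (attacked_sound (hreal d) h) hna
    · exact h

/-- Knowledge after a reply extends one square less beyond what is used. -/
theorem Supp.reply {f : Know} {r : ℤ} {mv : LMove} {n : ℕ} (h : Supp f n)
    (hm : moveOK f r mv = true) {d : Square} (hd : d ∈ dirs) :
    Supp (shift d (reply f mv d)) (n + 1) := by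
  intro q hq
  simp only [moveOK, Bool.and_eq_true, decide_eq_true_eq, beq_iff_eq] at hm
  obtain ⟨⟨⟨⟨⟨hkind, hn⟩, hcl⟩, hf0⟩, hu⟩, hv⟩ := hm
  rw [mem_dirs] at hd
  have clr : ∀ {m : ℕ} {u : Square}, clearPath f mv.2.1 m u = true → 0 < m →
      f (u + m • mv.2.1) ≠ none := by
    intro m
    induction m with
    | zero => omega
    | succ m ih =>
      intro u hc _
      simp only [clearPath, Bool.and_eq_true, beq_iff_eq] at hc
      rcases Nat.eq_zero_or_pos m with rfl | hm
      · simp [hc.1]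
      · have := ih hc.2 hm
        rwa [add_assoc, ← succ_nsmul'] at this
  have hin : d + q = 0 ∨ f (d + q) ≠ none := by
    by_contra hcon
    push Not at hcon
    obtain ⟨h0, hn'⟩ := hcon
    apply hq
    simp only [shift, InfChess.reply, knowAfter, upd]
    split_ifs with h1 h2 h3
    · rfl
    · exact absurd hn' (by rw [h2]; exact clr hcl hn)
    · rw [h3] at hn'
      rw [hn'] at hkind; simp at hkind
    · exact hn'
  rcases hin with h1 | h1
  · have h2 : d.1 + q.1 = 0 ∧ d.2 + q.2 = 0 := by
      rw [Prod.ext_iff] at h1; exact h1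
    omega
  · have := h _ h1
    simp only [Prod.fst_add, Prod.snd_add] at this
    omega

/-- The squares of a board near `x`, relative to `x`. -/
def window (b : Board) (x : Square) : Board :=
  fun q => if q.1.natAbs ≤ 13 ∧ q.2.natAbs ≤ 13 then b (x + q) else none

theorem realizes_window {b : Board} {x : Square} {f : Know} {n : ℕ} (hs : Supp f n) (hn : n ≤ 13) :
    Realizes (window b x) 0 f ↔ Realizes b x f := by
  refine forall_congr' fun q => forall_congr' fun c => imp_congr_right fun h => ?_
  have := hs q (by simp [h])
  rw [zero_add, window, if_pos (by omega)]

/-- `mv` is a first move of a local mate in at most `j + 1` moves. -/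
def GoodMove (j : ℕ) (b : Board) (x : Square) (mv : LMove) : Prop :=
  ∃ f, Supp f (13 - j) ∧ Realizes b x f ∧ LStep (LMate j) ((j : ℤ) - 11) f mv

open Classical in
/-- A first move of a shortest local mate in at most four moves, if there is one. -/
noncomputable def pick (b : Board) : Option LMove :=
  if h : ∃ j, j < 4 ∧ ∃ mv, GoodMove j b 0 mv then some (Nat.find_spec h).2.choose else none

/-- If some local mate exists on the actual board, then a local mate that is at least as fast is found
by looking at the window only. -/
theorem pick_spec {b : Board} {x : Square} {j : ℕ} (hj : j < 4)
    (h : ∃ mv, GoodMove j b x mv) :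
    ∃ j' ≤ j, ∃ mv, pick (window b x) = some mv ∧ GoodMove j' b x mv := by
  classical
  have hw : ∀ j mv, GoodMove j (window b x) 0 mv ↔ GoodMove j b x mv := fun j mv =>
    exists_congr fun f => and_congr_right fun hs => by
      rw [realizes_window hs (by omega)]
  have hex : ∃ j, j < 4 ∧ ∃ mv, GoodMove j (window b x) 0 mv := ⟨j, hj, by simpa only [hw] using h⟩
  refine ⟨Nat.find hex, Nat.find_min' hex ⟨hj, by simpa only [hw] using h⟩, _, ?_,
    (hw _ _).1 (Nat.find_spec hex).2.choose_spec⟩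
  rw [pick, dif_pos hex]

/-- The strategy that plays a local mate around the black king (assumed to have just moved) as soon
as there is one, and follows `sh` otherwise. -/
noncomputable def hunter (p : Position) (sh : Strategy) : Strategy := fun h =>
  match h.getLast? with
  | none => sh h
  | some m =>
    match pick (window (after p h).board m.2) with
    | none => sh h
    | some mv => (m.2 + mv.1, m.2 + mv.tgt)

theorem after_concat (p : Position) (h : List Move) (m : Move) :
    after p (h ++ [m]) = (after p h).play m := by
  simp [after]

theorem lmate_succ {k : ℕ} {f : Know} (h : LMate (k + 1) f) :
    ∃ mv, LStep (LMate k) ((k : ℤ) - 11) f mv := h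

theorem MatesWithin.mono {p : Position} {τ : Strategy} : ∀ {n m : ℕ} {h : List Move}, n ≤ m →
    MatesWithin p τ n h → MatesWithin p τ m h
  | 0, _, _, _, hm => hm.elim
  | n + 1, m, h, hnm, hm => by
    obtain ⟨m, rfl⟩ : ∃ m', m = m' + 1 := ⟨m - 1, by omega⟩
    exact ⟨hm.1, hm.2.imp id fun hx => ⟨hx.1, fun m' hm' => (hx.2 m' hm').mono (by omega)⟩⟩

/-- The hunter mates within the number of moves that the local information promises. -/
theorem matesWithin_hunter (p : Position) (sh : Strategy) : ∀ (k : ℕ) (h : List Move) (m : Move),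
    h.getLast? = some m → (after p h).turn = .white → Arena (after p h).board m.2 →
    k < 4 → (∀ s, (after p h).board s = some (.white, .king) → s.2 + 3 + k ≤ m.2.2) →
    RayOK (after p h).board (m.2.2 + ((k : ℤ) - 11)) →
    (∃ mv, GoodMove k (after p h).board m.2 mv) →
    ∃ j ≤ k, MatesWithin p (hunter p sh) (j + 1) h := by
  intro k
  induction k using Nat.strong_induction_on with
  | _ k ih =>
  intro h m hlast hturn ha hk4 hwk hray hgood
  obtain ⟨j, hjk, mv, hpick, f, hs, hf, hL⟩ := pick_spec hk4 hgood
  have hτ : hunter p sh h = (m.2 + mv.1, m.2 + mv.tgt) := by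
    simp only [hunter, hlast, hpick]
  have hpos : after p h = ⟨(after p h).board, .white⟩ := by
    rw [← hturn]
  have hray' : RayOK (after p h).board (m.2.2 + ((j : ℤ) - 11)) :=
    fun q hq hb => hray q (by omega) hb
  obtain ⟨hleg, hns, hrep⟩ := hL.sound (by omega) hf ha
    (fun s hs => by have := hwk s hs; omega) hray'
  rw [← hpos, ← hτ] at hleg hns hrep
  refine ⟨j, hjk, ?_⟩
  rw [MatesWithin, after_concat]
  refine ⟨hleg, hns.imp id fun hex => ⟨hex, fun m' hm' => ?_⟩⟩
  obtain ⟨d, hd, rfl, ha2, hP, hf2, hray2, hk2⟩ := hrep m' hm'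
  rw [mem_dirs] at hd
  obtain _ | j := j
  · exact hP.elim
  have hsupp := hs.reply hL.1 (mem_dirs.2 hd)
  set h2 := h ++ [hunter p sh h] ++ [(m.2, m.2 + d)] with hh2
  have hafter : after p h2 = ((after p h).play (hunter p sh h)).play (m.2, m.2 + d) := by
    rw [hh2, after_concat, after_concat]
  rw [← hafter] at ha2 hf2 hray2 hk2
  obtain ⟨i, hi, hmw⟩ := ih j (by omega) h2 (m.2, m.2 + d) (by simp [hh2])
    (by rw [hafter]; simp [Position.play, hturn, Color.other]) ha2 (by omega)
    (fun s hs => by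
      have := hwk s (hk2 s hs)
      simp only [Prod.snd_add]; omega)
    (fun q hq hb => hray2 q (by simp only [Prod.snd_add] at hq; push_cast; omega) hb)
    (by
      obtain ⟨mv', hmv'⟩ := lmate_succ hP
      refine ⟨mv', _, ?_, hf2, hmv'⟩
      intro q hq
      have := hsupp q hq
      omega)
  exact hmw.mono (by omega)

/-! ### Scripts for local mates -/

/-- A script: for each sequence of replies of the black king, a relative move of white. -/
abbrev Script : Type := List (List Square × LMove)

/-- The script mates in at most `k` further moves after the replies `hist`. -/
def solve (S : Script) : ℕ → List Square → Know → Bool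
  | 0, _, _ => false
  | k + 1, hist, f =>
    match S.find? fun e => e.1 == hist with
    | none => false
    | some e =>
      moveOK f ((k : ℤ) - 11) e.2 &&
        (attacked (knowAfter f e.2) 0 || dirs.any fun d => safe (reply f e.2 d) ((k : ℤ) - 11) d) &&
        dirs.all fun d => attacked (reply f e.2 d) d || solve S k (hist ++ [d]) (shift d (reply f e.2 d))

theorem solve_sound {S : Script} : ∀ {k : ℕ} {hist : List Square} {f : Know},
    solve S k hist f = true → LMate k f
  | 0, _, _, h => by simp [solve] at h
  | k + 1, hist, f, h => by
    unfold solve at h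
    split at h
    · simp at h
    · next e he =>
      simp only [Bool.and_eq_true, Bool.or_eq_true, List.any_eq_true, List.all_eq_true] at h
      exact ⟨e.2, h.1.1, h.1.2, fun d hd => (h.2 d hd).imp id solve_sound⟩


/-! ### The position near a node of a tree of squares -/

/-- Whether a square is at distance at most `n` from the origin. -/
def near (n : ℕ) (q : Square) : Bool := q.1.natAbs ≤ n && q.2.natAbs ≤ n

/-- The node `q` is a branching node: both squares diagonally above it are nodes. -/
def isVertex (N : Square → Bool) (q : Square) : Bool :=
  N q && N (q + (1, 1)) && N (q + (-1, 1))

/-- The white piece on the square `q`, where `N` tells the nodes of the tree and `R` the root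
(the black king stands there, so the root carries no white piece).
* Rooks stand next to the root, and on the square `v` beside the predecessor of a node (so that the
  node can be entered: a pawn on `v` would guard it).
* A branching node is surrounded by a bishop, a queen and two rooks.
* Knights stand on branching nodes and on the second node after a turn.
* Everything else, including the other nodes, carries pawns. -/
def cellOf (N R : Square → Bool) (q : Square) : Option PieceKind :=
  if R q then none
  else if R (q + (-1, 1)) || R (q + (1, 1)) || R (q + (0, 2)) then some .rook
  else if (N (q + (-1, 1)) && N (q + (-2, 0))) || (N (q + (1, 1)) && N (q + (2, 0))) then some .rook
  else if isVertex N (q + (-2, 2)) then some .bishop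
  else if isVertex N (q + (3, 1)) then some .queen
  else if isVertex N (q + (4, 1)) || isVertex N (q + (0, -3)) then some .rook
  else if isVertex N q || (N q && N (q + (-1, -1)) && N (q + (-2, -2)) && N (q + (-1, -3)) &&
    N (q + (0, -4))) || (N q && N (q + (1, -1)) && N (q + (2, -2)) && N (q + (1, -3))) then
    some .knight
  else some .pawn

/-- The square carries a piece that can leave it as soon as all lower squares are disturbed. -/
def loose (N R : Square → Bool) (q : Square) : Bool :=
  cellOf N R q == some .bishop || cellOf N R q == some .queen || cellOf N R q == some .knight ||
    (cellOf N R q == some .rook && isVertex N (q + (4, 1)))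

/-- The node below `q` from which `q` is reached (if there is one). -/
def par (N : Square → Bool) (q : Square) : Square :=
  if N (q + (-1, -1)) then q + (-1, -1) else q + (1, -1)

/-- The node from which `q` is reached in `n` steps. -/
def anc (N : Square → Bool) : ℕ → Square → Square
  | 0, q => q
  | n + 1, q => anc N n (par N q)

/-- The node `q` lies on the way to `t`. -/
def eaten (N : Square → Bool) (t q : Square) : Bool :=
  N q && decide (q.2 ≤ t.2) && q == anc N (t.2 - q.2).toNat t

/-- Knowledge when the king stands on the origin and the nodes on the way to `t` are empty. -/
def eatenK (N R : Square → Bool) (t : Square) : Know := fun q =>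
  if q == 0 || !near 10 q then none
  else if eaten N t q then some none else some (cellOf N R q)

/-- Knowledge when the king stands on the origin, and the nodes on the way to it carry the pawns
from the squares below them. -/
def pluggedK (N R : Square → Bool) : Know := fun q =>
  if q == 0 || !near 4 q then none
  else if eaten N 0 q then some (some .pawn)
  else if q + (0, 1) != 0 && eaten N 0 (q + (0, 1)) then some none
  else some (cellOf N R q)

/-- Knowledge when nothing is known about nodes. -/
def openK (N R : Square → Bool) : Know := fun q =>
  if N q || !near 4 q then none else some (cellOf N R q)

/-! ### Local pictures of the tree -/

/-- The ways the tree can look near one of its nodes: on a straight segment that goes up to the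
right (`ur`) or to the left (`ul`), near the root, near a turn from left to right (`sz`) or from
right to left (`zs`), near a leaf, and near a branching node (which is reached by a step to the left
and a step to the right after a straight segment that goes up to the right). -/
inductive Kind
  | ur | ul | root | sz | leaf | branch | zs
  deriving DecidableEq

/-- The nodes of the tree in the respective picture, relative to its centre. -/
def pic : Kind → Square → Bool
  | .ur, q => q.1 == q.2
  | .ul, q => q.1 == -q.2
  | .root, q => q.1 == q.2 && decide (0 ≤ q.2)
  | .sz, q => (q.1 == q.2 && decide (0 ≤ q.2)) || (q.1 == -q.2 && decide (q.2 ≤ 0))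
  | .leaf, q => q.1 == -q.2 && decide (q.2 ≤ 0)
  | .branch, q => ((q.1 == q.2 || q.1 == -q.2) && decide (0 ≤ q.2)) ||
      (q.1 == -1 && q.2 == -1) || (q.1 == q.2 + 2 && decide (q.2 ≤ -2))
  | .zs, q => (q.1 == q.2 && decide (q.2 ≤ 0)) || (q.1 == -q.2 && decide (0 ≤ q.2))

/-- A place in a picture. -/
abbrev Place : Type := Kind × Square

/-- The nodes near a place. -/
def Place.node (st : Place) (q : Square) : Bool := pic st.1 (st.2 + q)

/-- The root, seen from a place. -/
def Place.root (st : Place) (q : Square) : Bool := st.1 == .root && st.2 + q == 0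

/-- The pieces near a place. -/
def Place.cell (st : Place) : Square → Option PieceKind := cellOf st.node st.root

/-- The places at height `n` or `-n` in the pictures with a distinguished centre. -/
def placesAt (n : ℤ) : List Place :=
  [(.root, (n, n)), (.sz, (n, n)), (.sz, (n, -n)), (.leaf, (n, -n)), (.branch, (n, n)),
    (.branch, (-n, n)), (.branch, if n ≤ 1 then (-n, -n) else (2 - n, -n)), (.zs, (-n, n)),
    (.zs, (-n, -n))]

/-- All places that have to be looked at. -/
def places : List Place :=
  [(.ur, (0, 0)), (.ul, (0, 0))] ++ (List.range 17).flatMap fun (n : ℕ) => placesAt n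

/-- Whether the node `d` is one of the two squares above the origin. -/
def Place.child (st : Place) (d : Square) : Bool := d.2 == 1 && st.node d

/-- The node on the origin is reached from one node only, and nodes only touch each other along
the tree. -/
def Place.chkPred (st : Place) : Bool :=
  st.node 0 && !(st.node (-1, -1) && st.node (1, -1)) &&
    !st.node (1, 0) && !st.node (-1, 0) && !st.node (0, 1) && !st.node (0, -1) &&
    (st.root 0 || st.node (-1, -1) || st.node (1, -1)) &&
    !(st.root 0 && (st.node (-1, -1) || st.node (1, -1))) &&
    (st.root 0 || st.cell 0 == some .pawn || st.cell 0 == some .knight)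

/-- With plugged nodes behind it, the king can only move on. -/
def Place.chkPlugged (st : Place) : Bool :=
  st.root 0 || dirs.all fun d => st.child d ||
    attacked (upd (upd (pluggedK st.node st.root) 0 (some none)) d none) d

/-- Without any white move, the king can only move to nodes. -/
def Place.chkOpen (st : Place) : Bool :=
  dirs.all fun d => st.node d ||
    attacked (upd (upd (openK st.node st.root) 0 (some none)) d none) d

/-- The pieces next to the node on the origin do not attack it. -/
def Place.chkStep (st : Place) : Bool :=
  dirs.all fun d => st.node d || st.root d || match st.cell d with
    | none => false
    | some k => !hits d k && !(k == .pawn && d.2 == -1 && d.1 != 0)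

/-- The squares near a node on which other pieces than pawns may stand because of it. -/
def specials : List Square :=
  [0, (1, -1), (-1, -1), (0, -2), (2, -2), (-3, -1), (-4, -1), (0, 3)]

/-- The possible steps of a piece. -/
def steps : PieceKind → List Square
  | .knight => kdirs
  | k => dirs.filter fun d => hits d k

/-- The pieces near the node on the origin cannot leave their squares, as long as the squares above
and beside them, and the pawns below them, stay. -/
def Place.chkRigid (st : Place) : Bool :=
  specials.all fun q =>
    let l := loose st.node st.root
    match st.cell q with
    | none => st.root q
    | some .pawn => true
    | some k => (steps k).all (fun d => !st.node (q + d) && !(l (q + d) && (d.2 == -1 || !l q)) &&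
        (!(d.2 == -2 || (d.2 == -1 && !l q)) || (st.cell (q + d) == some .pawn &&
          !l (q + d + (0, 1)) && (!st.node (q + d + (0, 1)) || (st.node q && par st.node q == q + d + (0, 1)))))) &&
      (!l q || (!st.node (q + (1, 2)) && !st.node (q + (-1, 2))))

/-- The squares beside and below the node on the origin are not loose. -/
def Place.chkLoose (st : Place) : Bool :=
  [(0, -1), (1, -1), (-1, -1)].all fun d => st.node d || (!loose st.node st.root d &&
    (d != (0, -1) || st.cell d == some .pawn))

/-- The scripts for all local mates. -/
def scripts : List Script :=
  [[([], ((1, 0), (0, 1), 1)),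
   ([(-1, -1)], ((-1, -2), (0, 1), 1))],
  [([], ((-1, 0), (0, 1), 1)),
   ([(1, -1)], ((-1, -2), (0, 1), 1))],
  [([], ((-1, 0), (0, 1), 1)),
   ([(-1, -1)], ((1, -2), (0, 1), 1)),
   ([(-1, 1)], ((-1, -1), (1, 0), 1)),
   ([(1, -1)], ((-2, 0), (0, 1), 1)),
   ([(1, 1)], ((-3, -1), (1, 0), 1)),
   ([(-1, 1), (-1, 1)], ((-1, -3), (1, 1), 2)),
   ([(1, -1), (-1, -1)], ((-1, 0), (0, 1), 1)),
   ([(1, -1), (1, 1)], ((-3, -2), (0, 1), 1)),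
   ([(1, 1), (1, 1)], ((-4, -3), (0, 1), 1)),
   ([(1, -1), (-1, -1), (1, -1)], ((-1, -2), (0, 1), 1)),
   ([(1, -1), (-1, -1), (1, 1)], ((-3, -1), (1, 0), 2)),
   ([(1, -1), (1, 1), (-1, -1)], ((1, 0), (0, 1), 1)),
   ([(1, -1), (1, 1), (1, 1)], ((-5, -3), (1, 0), 2)),
   ([(1, 1), (1, 1), (-1, -1)], ((1, 0), (0, 1), 1)),
   ([(1, 1), (1, 1), (1, 1)], ((-6, -4), (1, 0), 2))],
  [([], ((1, 0), (0, 1), 1)),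
   ([(-1, -1)], ((1, 0), (0, 1), 1)),
   ([(1, -1)], ((1, -2), (0, 1), 1)),
   ([(1, 1)], ((1, 1), (-1, -2), 1)),
   ([(-1, -1), (-1, -1)], ((1, 0), (0, 1), 1)),
   ([(1, 1), (-1, -1)], ((1, -2), (0, 1), 1)),
   ([(-1, -1), (-1, -1), (-1, -1)], ((1, -2), (0, 1), 1)),
   ([(-1, -1), (-1, -1), (-1, 1)], ((2, -2), (0, 1), 1)),
   ([(1, 1), (-1, -1), (1, 1)], ((1, 0), (0, 1), 1))],
  [([], ((-1, 0), (0, 1), 1)),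
   ([(-1, -1)], ((-1, -2), (0, 1), 1)),
   ([(-1, 1)], ((1, 1), (-1, -2), 1)),
   ([(1, -1)], ((1, -2), (0, 1), 1)),
   ([(-1, 1), (1, -1)], ((-1, -2), (0, 1), 1)),
   ([(1, -1), (1, -1)], ((1, -1), (-1, 0), 1)),
   ([(-1, 1), (1, -1), (-1, 1)], ((1, 0), (0, 1), 1)),
   ([(1, -1), (1, -1), (1, 1)], ((1, -3), (-1, 1), 2))],
  [([], ((-1, 0), (0, 1), 1)),
   ([(-1, -1)], ((-1, -2), (0, 1), 1)),
   ([(-1, 1)], ((-1, 1), (1, -2), 1)),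
   ([(1, -1)], ((1, -2), (0, 1), 1)),
   ([(-1, 1), (1, -1)], ((-1, -2), (0, 1), 1)),
   ([(1, -1), (1, -1)], ((-1, 0), (0, 1), 1)),
   ([(-1, 1), (1, -1), (-1, 1)], ((-1, 0), (0, 1), 1))],
  [([], ((1, 0), (0, 1), 1)),
   ([(-1, -1)], ((1, 0), (0, 1), 1)),
   ([(1, -1)], ((-1, -2), (0, 1), 1)),
   ([(1, 1)], ((1, -1), (-1, 0), 1)),
   ([(-1, -1), (-1, -1)], ((1, -2), (0, 1), 1)),
   ([(-1, -1), (-1, 1)], ((2, -2), (0, 1), 1)),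
   ([(1, 1), (1, 1)], ((1, -3), (-1, 1), 2))],
  [([], ((1, 0), (0, 1), 1)),
   ([(-1, -1)], ((1, 0), (0, 1), 1)),
   ([(-1, -1), (-1, -1)], ((-1, -2), (0, 1), 1))],
  [([], ((1, 0), (0, 1), 1)),
   ([(-1, -1)], ((1, -2), (0, 1), 1)),
   ([(-1, 1)], ((2, -2), (0, 1), 1))],
  [([], ((-1, 0), (0, 1), 1)),
   ([(1, -1)], ((-1, 0), (0, 1), 1)),
   ([(1, -1), (1, -1)], ((1, -2), (0, 1), 1))],
  [([], ((1, -2), (0, 1), 1))]]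

/-- White mates locally if the king stands on a leaf or has made a step back. -/
def Place.chkMate (st : Place) : Bool :=
  if dirs.all fun d => !st.child d then
    scripts.any fun S => solve S 1 [] (eatenK st.node st.root 0)
  else dirs.all fun d => !st.child d || scripts.any fun S => solve S 4 [] (eatenK st.node st.root d)


theorem places_chk : (places.all fun st => st.chkPred && st.chkOpen && st.chkStep &&
    st.chkPlugged && st.chkLoose && st.chkRigid) = true := by decide +kernel

theorem places_chkMate : (places.all fun st => st.chkMate) = true := by decide +kernel


/-! ### From pictures to the tree -/

/-- A tree of squares with root `o`, such that near each node it looks like one of the pictures. -/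
structure Tree (N R : Square → Bool) (o : Square) : Prop where
  near_eq : ∀ p, N p = true → ∃ st ∈ places, ∀ q, near 15 q = true →
    N (p + q) = st.node q ∧ R (p + q) = st.root q
  root_iff : ∀ q, R q = true ↔ q = o
  node_root : N o = true
  le : ∀ p, N p = true → o.2 ≤ p.2
  high : 100 ≤ o.2
  even : ∀ p, N p = true → Even (p.1 + p.2)

theorem near_iff {n : ℕ} {q : Square} :
    near n q = true ↔ q.1.natAbs ≤ n ∧ q.2.natAbs ≤ n := by
  simp [near]

/-- Agreement near the origin. -/
def Agree (n : ℕ) (N N' : Square → Bool) : Prop := ∀ q, near n q = true → N q = N' q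

section congruence
variable {N N' R R' : Square → Bool}

theorem isVertex_congr (h : Agree 15 N N') {q : Square} (hq : near 14 q = true) :
    isVertex N q = isVertex N' q := by
  rw [near_iff] at hq
  have key : ∀ d : Square, near 1 d = true → N (q + d) = N' (q + d) := fun d hd => h _ (by
    rw [near_iff] at hd ⊢; simp only [Prod.fst_add, Prod.snd_add]; omega)
  have h0 := key 0 (by decide)
  rw [add_zero] at h0
  simp only [isVertex, h0, key (1, 1) (by decide), key (-1, 1) (by decide)]

theorem cellOf_congr (h : Agree 15 N N') (hR : Agree 15 R R') {q : Square}
    (hq : near 10 q = true) : cellOf N R q = cellOf N' R' q := by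
  rw [near_iff] at hq
  have key : ∀ d : Square, near 4 d = true → near 14 (q + d) = true := fun d hd => by
    rw [near_iff] at hd ⊢; simp only [Prod.fst_add, Prod.snd_add]; omega
  have key' : ∀ d : Square, near 4 d = true → near 15 (q + d) = true := fun d hd => by
    rw [near_iff] at hd ⊢; simp only [Prod.fst_add, Prod.snd_add]; omega
  have h0 : near 15 q = true := by rw [near_iff]; omega
  have h1 : near 14 q = true := by rw [near_iff]; omega
  have hn := fun d hd => h (q + d) (key' d hd)
  have hr := fun d hd => hR (q + d) (key' d hd)
  have hv := fun d hd => isVertex_congr h (key d hd)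
  unfold cellOf
  rw [hR q h0, h q h0, isVertex_congr h h1, hr (-1, 1) (by decide), hr (1, 1) (by decide),
    hr (0, 2) (by decide), hn (-1, 1) (by decide), hn (-2, 0) (by decide), hn (1, 1) (by decide),
    hn (2, 0) (by decide), hv (-2, 2) (by decide), hv (3, 1) (by decide), hv (4, 1) (by decide),
    hv (0, -3) (by decide), hn (-1, -1) (by decide), hn (-2, -2) (by decide),
    hn (-1, -3) (by decide), hn (0, -4) (by decide), hn (1, -1) (by decide),
    hn (2, -2) (by decide), hn (1, -3) (by decide)]

theorem loose_congr (h : Agree 15 N N') (hR : Agree 15 R R') {q : Square}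
    (hq : near 10 q = true) : loose N R q = loose N' R' q := by
  have : near 14 (q + (4, 1)) = true := by
    rw [near_iff] at hq ⊢; simp only [Prod.fst_add, Prod.snd_add]; omega
  simp only [loose, cellOf_congr h hR hq, isVertex_congr h this]

theorem par_congr (h : Agree 15 N N') {q : Square} (hq : near 14 q = true) :
    par N q = par N' q := by
  have : near 15 (q + (-1, -1)) = true := by
    rw [near_iff] at hq ⊢; simp only [Prod.fst_add, Prod.snd_add]; omega
  simp only [par, h _ this]

theorem par_snd (N : Square → Bool) (q : Square) : (par N q).2 = q.2 - 1 := by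
  unfold par; split_ifs <;> simp <;> ring

theorem par_fst (N : Square → Bool) (q : Square) :
    (par N q).1 = q.1 - 1 ∨ (par N q).1 = q.1 + 1 := by
  unfold par
  split_ifs
  · left; simp only [Prod.fst_add]; ring
  · right; simp only [Prod.fst_add]

theorem anc_congr (h : Agree 15 N N') : ∀ (n m : ℕ) (t : Square), near m t = true → m + n ≤ 14 →
    anc N n t = anc N' n t
  | 0, _, _, _, _ => rfl
  | n + 1, m, t, ht, hm => by
    have ht' : near 14 t = true := by rw [near_iff] at ht ⊢; omega
    rw [anc, anc, ← par_congr h ht']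
    refine anc_congr h n (m + 1) _ ?_ (by omega)
    have h1 := par_snd N t
    have h2 := par_fst N t
    rw [near_iff] at ht ⊢; omega

theorem eaten_congr (h : Agree 15 N N') {t q : Square} (ht : near 1 t = true)
    (hq : near 10 q = true) : eaten N t q = eaten N' t q := by
  have h15 : near 15 q = true := by rw [near_iff] at hq ⊢; omega
  rw [eaten, eaten, h q h15, anc_congr h _ 1 t ht]
  rw [near_iff] at ht hq; omega

theorem eatenK_congr (h : Agree 15 N N') (hR : Agree 15 R R') {t : Square} (ht : near 1 t = true) :
    eatenK N R t = eatenK N' R' t := by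
  funext q
  unfold eatenK
  by_cases hq : near 10 q = true
  · rw [eaten_congr h ht hq, cellOf_congr h hR hq]
  · simp [hq]

theorem pluggedK_congr (h : Agree 15 N N') (hR : Agree 15 R R') :
    pluggedK N R = pluggedK N' R' := by
  funext q
  unfold pluggedK
  by_cases hq : near 4 q = true
  · have h1 : near 10 q = true := by rw [near_iff] at hq ⊢; omega
    have h2 : near 10 (q + (0, 1)) = true := by
      rw [near_iff] at hq ⊢; simp only [Prod.fst_add, Prod.snd_add]; omega
    rw [eaten_congr h (by decide) h1, eaten_congr h (by decide) h2, cellOf_congr h hR h1]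
  · simp [hq]

theorem openK_congr (h : Agree 15 N N') (hR : Agree 15 R R') :
    openK N R = openK N' R' := by
  funext q
  unfold openK
  by_cases hq : near 4 q = true
  · have h1 : near 10 q = true := by rw [near_iff] at hq ⊢; omega
    have h2 : near 15 q = true := by rw [near_iff] at hq ⊢; omega
    rw [h q h2, cellOf_congr h hR h1]
  · simp [hq]

end congruence

section shift
variable (N R : Square → Bool) (p : Square)

theorem isVertex_shift (q : Square) : isVertex (fun q => N (p + q)) q = isVertex N (p + q) := by
  simp only [isVertex, add_assoc]

theorem cellOf_shift (q : Square) :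
    cellOf (fun q => N (p + q)) (fun q => R (p + q)) q = cellOf N R (p + q) := by
  simp only [cellOf, isVertex_shift, add_assoc]

theorem loose_shift (q : Square) :
    loose (fun q => N (p + q)) (fun q => R (p + q)) q = loose N R (p + q) := by
  simp only [loose, cellOf_shift, isVertex_shift, add_assoc]

theorem par_shift (q : Square) : p + par (fun q => N (p + q)) q = par N (p + q) := by
  simp only [par, add_assoc]; split_ifs <;> rfl

theorem anc_shift : ∀ (n : ℕ) (q : Square),
    p + anc (fun q => N (p + q)) n q = anc N n (p + q)
  | 0, _ => rfl
  | n + 1, q => by rw [anc, anc, anc_shift n, par_shift]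

theorem eaten_shift (t q : Square) :
    eaten (fun q => N (p + q)) t q = eaten N (p + t) (p + q) := by
  have h1 : (p + t).2 - (p + q).2 = t.2 - q.2 := by simp only [Prod.snd_add]; ring
  have h2 : (decide ((p + q).2 ≤ (p + t).2)) = decide (q.2 ≤ t.2) := by
    simp only [Prod.snd_add, add_le_add_iff_left]
  have h3 : (p + q == p + anc (fun q => N (p + q)) (t.2 - q.2).toNat t) =
      (q == anc (fun q => N (p + q)) (t.2 - q.2).toNat t) := by
    rw [Bool.eq_iff_iff, beq_iff_eq, beq_iff_eq, add_right_inj]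
  rw [eaten, eaten, h1, h2, ← anc_shift, h3]

end shift


/-! ### Local facts about trees -/

namespace Tree
variable {N R : Square → Bool} {o : Square} (T : Tree N R o)
include T

/-- Near each node the tree looks like one of the pictures. -/
theorem place {p : Square} (hp : N p = true) : ∃ st ∈ places,
    Agree 15 (fun q => N (p + q)) st.node ∧ Agree 15 (fun q => R (p + q)) st.root := by
  obtain ⟨st, h1, h2⟩ := T.near_eq p hp
  exact ⟨st, h1, fun q hq => (h2 q hq).1, fun q hq => (h2 q hq).2⟩

omit T in
theorem chk_of_mem {st : Place} (h : st ∈ places) : st.chkPred = true ∧ st.chkOpen = true ∧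
    st.chkStep = true ∧ st.chkPlugged = true ∧ st.chkLoose = true ∧ st.chkRigid = true := by
  have := List.all_eq_true.1 places_chk st h
  simp only [Bool.and_eq_true] at this
  tauto

theorem root_eq {q : Square} : R q = decide (q = o) := by
  rw [Bool.eq_iff_iff, T.root_iff, decide_eq_true_iff]

/-- A node other than the root is reached from exactly one of the two squares diagonally below it, and
no other node is orthogonally next to it. -/
theorem pred_facts {p : Square} (hp : N p = true) :
    ¬ (N (p + (-1, -1)) = true ∧ N (p + (1, -1)) = true) ∧
    N (p + (1, 0)) = false ∧ N (p + (-1, 0)) = false ∧ N (p + (0, 1)) = false ∧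
    N (p + (0, -1)) = false ∧
    (p = o ∨ N (p + (-1, -1)) = true ∨ N (p + (1, -1)) = true) ∧
    ¬ (p = o ∧ (N (p + (-1, -1)) = true ∨ N (p + (1, -1)) = true)) ∧
    (p = o ∨ cellOf N R p = some .pawn ∨ cellOf N R p = some .knight) := by
  obtain ⟨st, hst, hN, hR⟩ := T.place hp
  have h := (chk_of_mem hst).1
  have hc : cellOf N R p = st.cell 0 := by
    rw [Place.cell, ← cellOf_congr hN hR (by decide), cellOf_shift, add_zero]
  simp only [Place.chkPred, Bool.and_eq_true, Bool.not_eq_true', Bool.and_eq_false_iff,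
    Bool.or_eq_true, Bool.or_eq_false_iff, beq_iff_eq, ← hN _ (show near 15 (-1, -1) = true by decide),
    ← hN _ (show near 15 (1, -1) = true by decide), ← hN _ (show near 15 (1, 0) = true by decide),
    ← hN _ (show near 15 (-1, 0) = true by decide), ← hN _ (show near 15 (0, 1) = true by decide),
    ← hN _ (show near 15 (0, -1) = true by decide), ← hN _ (show near 15 0 = true by decide),
    ← hR _ (show near 15 0 = true by decide), ← hc, T.root_eq, add_zero,
    decide_eq_true_eq, decide_eq_false_iff_not] at h
  obtain ⟨⟨⟨⟨⟨⟨⟨⟨-, h1⟩, h2⟩, h3⟩, h4⟩, h5⟩, h6⟩, h7⟩, h8⟩ := h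
  refine ⟨?_, h2, h3, h4, h5, by tauto, ?_, by tauto⟩
  · rintro ⟨e1, e2⟩; rw [e1, e2] at h1; simp at h1
  · rintro ⟨e1, e2 | e2⟩ <;> rw [e1] at h7 <;> rw [e1] at e2 <;> simp [e2] at h7

theorem node_par {p : Square} (hp : N p = true) (ho : p ≠ o) : N (par N p) = true := by
  obtain ⟨-, -, -, -, -, h, -⟩ := T.pred_facts hp
  unfold par
  split_ifs with h1
  · exact h1
  · tauto

theorem no_pred : N (o + (-1, -1)) = false ∧ N (o + (1, -1)) = false := by
  obtain ⟨-, -, -, -, -, -, h, -⟩ := T.pred_facts T.node_root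
  constructor <;> by_contra hc <;> rw [Bool.not_eq_false] at hc <;> exact h ⟨rfl, by tauto⟩

theorem par_eq {p d : Square} (hp : N p = true) (hq : N (p + d) = true) (hd : d ∈ dirs)
    (h2 : d.2 = 1) : par N (p + d) = p := by
  have h := (T.pred_facts hq).1
  have h0 := T.pred_facts hp
  simp only [dirs, List.mem_cons, List.not_mem_nil, or_false] at hd
  unfold par
  rcases hd with rfl | rfl | rfl | rfl | rfl | rfl | rfl | rfl <;> simp at h2
  · rw [h0.2.2.2.1] at hq; simp at hq
  · have e : p + (1, 1) + (-1, -1) = p := by rw [add_assoc]; exact add_zero p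
    rw [e, if_pos hp]
  · have e : p + (-1, 1) + (1, -1) = p := by rw [add_assoc]; exact add_zero p
    rw [e] at h ⊢
    rw [if_neg (fun hc => h ⟨hc, hp⟩)]

/-- A node next to a node is a child or the parent. -/
theorem node_step {p d : Square} (hp : N p = true) (hq : N (p + d) = true) (hd : d ∈ dirs) :
    (d.2 = 1 ∧ par N (p + d) = p) ∨ (p ≠ o ∧ p + d = par N p) := by
  have h0 := T.pred_facts hp
  have hd' := hd
  simp only [dirs, List.mem_cons, List.not_mem_nil, or_false] at hd
  rcases hd with rfl | rfl | rfl | rfl | rfl | rfl | rfl | rfl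
  · rw [h0.2.1] at hq; simp at hq
  · rw [h0.2.2.1] at hq; simp at hq
  · rw [h0.2.2.2.1] at hq; simp at hq
  · rw [h0.2.2.2.2.1] at hq; simp at hq
  · exact .inl ⟨rfl, T.par_eq hp hq hd' rfl⟩
  · refine .inr ⟨?_, ?_⟩
    · rintro rfl; rw [T.no_pred.2] at hq; simp at hq
    · unfold par; rw [if_neg (fun hc => h0.1 ⟨hc, hq⟩)]
  · exact .inl ⟨rfl, T.par_eq hp hq hd' rfl⟩
  · refine .inr ⟨?_, ?_⟩
    · rintro rfl; rw [T.no_pred.1] at hq; simp at hq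
    · unfold par; rw [if_pos hq]

omit T in
theorem eaten_self {p : Square} (hp : N p = true) : eaten N p p = true := by
  simp [eaten, hp, anc]

omit T in
theorem eaten_le {t q : Square} (h : eaten N t q = true) : N q = true ∧ q.2 ≤ t.2 := by
  simp only [eaten, Bool.and_eq_true, decide_eq_true_eq] at h
  exact h.1

omit T in
theorem eaten_iff {t q : Square} (ht : N t = true) :
    eaten N t q = true ↔ q = t ∨ eaten N (par N t) q = true := by
  have hs := par_snd N t
  constructor
  · intro h
    have h' := h
    simp only [eaten, Bool.and_eq_true, decide_eq_true_eq, beq_iff_eq] at h ⊢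
    obtain ⟨⟨h1, h2⟩, h3⟩ := h
    rcases eq_or_lt_of_le h2 with e | e
    · left; rw [h3, e, sub_self]; rfl
    · right
      refine ⟨⟨h1, by omega⟩, ?_⟩
      have e2 : (t.2 - q.2).toNat = ((par N t).2 - q.2).toNat + 1 := by omega
      rwa [e2, anc] at h3
  · rintro (rfl | h)
    · exact eaten_self ht
    · simp only [eaten, Bool.and_eq_true, decide_eq_true_eq, beq_iff_eq] at h ⊢
      obtain ⟨⟨h1, h2⟩, h3⟩ := h
      refine ⟨⟨h1, by omega⟩, ?_⟩
      have e2 : (t.2 - q.2).toNat = ((par N t).2 - q.2).toNat + 1 := by omega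
      rwa [e2, anc]

theorem eaten_root {q : Square} (h : eaten N o q = true) : q = o := by
  have h' := eaten_le h
  have := T.le _ h'.1
  simp only [eaten, Bool.and_eq_true, decide_eq_true_eq, beq_iff_eq] at h
  rw [h.2, show o.2 - q.2 = 0 by omega]; rfl

theorem eaten_par {t q : Square} (h : eaten N t q = true) (hq : q ≠ o) :
    eaten N t (par N q) = true := by
  simp only [eaten, Bool.and_eq_true, decide_eq_true_eq, beq_iff_eq] at h ⊢
  obtain ⟨⟨h1, h2⟩, h3⟩ := h
  have hs := par_snd N q
  refine ⟨⟨T.node_par h1 hq, by omega⟩, ?_⟩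
  have e2 : (t.2 - (par N q).2).toNat = (t.2 - q.2).toNat + 1 := by omega
  rw [e2]
  have key : ∀ (n : ℕ) (p : Square), anc N (n + 1) p = par N (anc N n p) := by
    intro n
    induction n with
    | zero => intro p; rfl
    | succ n ih => intro p; rw [anc, ih]; rfl
  rw [key, ← h3]

omit T in
theorem cellOf_knight {q : Square} (h : cellOf N R q = some .knight) : N q = true := by
  unfold cellOf at h
  split_ifs at h with h1 h2 h3 h4 h5 h6 h7
  all_goals simp at h
  simp only [isVertex, Bool.or_eq_true, Bool.and_eq_true] at h7
  tauto

omit T in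
theorem cellOf_ne_none {q : Square} (h : R q = false) : ∃ k, cellOf N R q = some k ∧ k ≠ .king := by
  unfold cellOf
  rw [h]
  split_ifs <;> simp_all

theorem cell_ne_none {q : Square} (h : q ≠ o) : ∃ k, cellOf N R q = some k ∧ k ≠ .king :=
  cellOf_ne_none (by rw [T.root_eq]; simpa using h)

/-- The pieces next to a node that do not stand on nodes themselves do not attack it. -/
theorem step_facts {p d : Square} (hp : N p = true) (hd : d ∈ dirs) (hq : N (p + d) = false) :
    ∃ k, cellOf N R (p + d) = some k ∧ hits d k = false ∧
      ¬ (k = .pawn ∧ d.2 = -1 ∧ d.1 ≠ 0) := by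
  obtain ⟨st, hst, hN, hR⟩ := T.place hp
  have h := (chk_of_mem hst).2.2.1
  have hd1 : near 1 d = true := by rw [mem_dirs] at hd; rw [near_iff]; omega
  have hd15 : near 15 d = true := by rw [near_iff] at hd1 ⊢; omega
  have hd10 : near 10 d = true := by rw [near_iff] at hd1 ⊢; omega
  have hc : cellOf N R (p + d) = st.cell d := by
    rw [Place.cell, ← cellOf_congr hN hR hd10, cellOf_shift]
  rw [Place.chkStep, List.all_eq_true] at h
  have h := h d hd
  rw [show st.node d = N (p + d) from (hN d hd15).symm,
    show st.root d = R (p + d) from (hR d hd15).symm, hq, ← hc, T.root_eq] at h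
  have hpo : p + d ≠ o := by rintro e; rw [e, T.node_root] at hq; simp at hq
  rw [decide_eq_false hpo] at h
  obtain ⟨k, hk, -⟩ := T.cell_ne_none hpo
  rw [hk] at h
  simp only [Bool.or_self, Bool.false_or, Bool.and_eq_true, Bool.not_eq_true'] at h
  refine ⟨k, hk, h.1, ?_⟩
  rintro ⟨rfl, h1, h2⟩
  have := h.2
  simp [h1, h2] at this

/-- With nodes unknown, the squares next to a node that are not nodes are attacked. -/
theorem open_facts {p d : Square} (hp : N p = true) (hd : d ∈ dirs) (hq : N (p + d) = false) :
    attacked (upd (upd (openK (fun q => N (p + q)) (fun q => R (p + q))) 0 (some none)) d none) d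
      = true := by
  obtain ⟨st, hst, hN, hR⟩ := T.place hp
  have h := (chk_of_mem hst).2.1
  have hd15 : near 15 d = true := by rw [mem_dirs] at hd; rw [near_iff]; omega
  rw [Place.chkOpen, List.all_eq_true] at h
  have h := h d hd
  rw [show st.node d = N (p + d) from (hN d hd15).symm, hq, ← openK_congr hN hR] at h
  simpa using h

/-- When the nodes behind the king are plugged by pawns, it can only climb. -/
theorem plugged_facts {p d : Square} (hp : N p = true) (hpo : p ≠ o) (hd : d ∈ dirs)
    (hq : ¬ (d.2 = 1 ∧ N (p + d) = true)) :
    attacked (upd (upd (pluggedK (fun q => N (p + q)) (fun q => R (p + q))) 0 (some none)) d none) d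
      = true := by
  obtain ⟨st, hst, hN, hR⟩ := T.place hp
  have h := (chk_of_mem hst).2.2.2.1
  have hd15 : near 15 d = true := by rw [mem_dirs] at hd; rw [near_iff]; omega
  rw [Place.chkPlugged, Bool.or_eq_true, List.all_eq_true,
    show st.root 0 = R (p + 0) from (hR 0 (by decide)).symm, T.root_eq, add_zero, decide_eq_false hpo] at h
  rcases h with h | h
  · simp at h
  have h := h d hd
  rw [Place.child, ← hN d hd15, ← pluggedK_congr hN hR] at h
  simp only [Bool.or_eq_true, Bool.and_eq_true, beq_iff_eq] at h
  tauto

/-- A king that has just reached a leaf is mated by the next move. -/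
theorem mate_leaf {p : Square} (hp : N p = true)
    (hq : ∀ d ∈ dirs, ¬ (d.2 = 1 ∧ N (p + d) = true)) :
    LMate 1 (eatenK (fun q => N (p + q)) (fun q => R (p + q)) 0) := by
  obtain ⟨st, hst, hN, hR⟩ := T.place hp
  have h := List.all_eq_true.1 places_chkMate st hst
  have hc : ∀ d ∈ dirs, (!st.child d) = true := fun d hd => by
    have hd15 : near 15 d = true := by rw [mem_dirs] at hd; rw [near_iff]; omega
    have := hq d hd
    rw [Bool.not_eq_true', Place.child, ← hN d hd15, Bool.and_eq_false_iff]
    by_contra hcon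
    rw [not_or] at hcon
    simp only [Bool.not_eq_false, beq_iff_eq] at hcon
    exact this hcon
  rw [Place.chkMate, if_pos (List.all_eq_true.2 hc), List.any_eq_true] at h
  obtain ⟨S, -, hS⟩ := h
  rw [eatenK_congr hN hR (by decide)]
  exact solve_sound hS

/-- A king that has stepped back from the node `p + d` to `p` is mated in at most four moves. -/
theorem mate_back {p d : Square} (hp : N p = true) (hd : d ∈ dirs) (hd2 : d.2 = 1)
    (hq : N (p + d) = true) :
    LMate 4 (eatenK (fun q => N (p + q)) (fun q => R (p + q)) d) := by
  obtain ⟨st, hst, hN, hR⟩ := T.place hp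
  have h := List.all_eq_true.1 places_chkMate st hst
  have hd1 : near 1 d = true := by rw [mem_dirs] at hd; rw [near_iff]; omega
  have hd15 : near 15 d = true := by rw [near_iff] at hd1 ⊢; omega
  have hch : st.child d = true := by
    rw [Place.child, show st.node d = N (p + d) from (hN d hd15).symm, hq, hd2]; rfl
  rw [Place.chkMate, if_neg, List.all_eq_true] at h
  · have h := h d hd
    rw [hch, Bool.not_true, Bool.false_or, List.any_eq_true] at h
    obtain ⟨S, -, hS⟩ := h
    rw [eatenK_congr hN hR hd1]
    exact solve_sound hS
  · rw [List.all_eq_true]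
    intro hcon
    have := hcon d hd
    rw [hch] at this; simp at this

theorem below_pawn {p : Square} (hp : N p = true) : cellOf N R (p + (0, -1)) = some .pawn := by
  obtain ⟨st, hst, hN, hR⟩ := T.place hp
  have h := (chk_of_mem hst).2.2.2.2.1
  have hb := (T.pred_facts hp).2.2.2.2.1
  rw [Place.chkLoose, List.all_eq_true] at h
  have h := h (0, -1) (by simp)
  rw [show st.node (0, -1) = N (p + (0, -1)) from (hN _ (by decide)).symm, hb] at h
  simp only [Bool.false_or, Bool.and_eq_true, bne_self_eq_false, beq_iff_eq] at h
  rw [← h.2, Place.cell, ← cellOf_congr hN hR (by decide), cellOf_shift]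

end Tree

/-! ### A step up the tree -/

/-- A criterion for the king on `x` to be safe after a step to the node `c` above it. -/
theorem Tree.step_safe {N R : Square → Bool} {o : Square} (T : Tree N R o) {b : Board}
    {x d : Square} (hx : N x = true) (hd : d ∈ dirs) (hd2 : d.2 = 1) (hc : N (x + d) = true)
    (hxb : b x = none) (hs : Shielded b x (-d))
    (hcell : ∀ e ∈ dirs, x + d + e ≠ x →
      b (x + d + e) = (cellOf N R (x + d + e)).map (Prod.mk .white))
    (hkn : ∀ e ∈ kdirs, b (x + d + e) ≠ some (.white, .knight))
    (hkg : ∀ s, b s = some (.white, .king) → s.2 + 1 < (x + d).2) : ¬ WhiteAttacks b (x + d) := by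
  refine not_whiteAttacks (fun e he => ?_) hkn hkg
  by_cases hex : x + d + e = x
  · have hed : e = -d := by
      rw [add_assoc] at hex
      exact eq_neg_of_add_eq_zero_right (left_eq_add.1 hex.symm)
    obtain ⟨m, hm, hi, k, hk, hh⟩ := hs
    have key : ∀ i : ℕ, x + d + (i + 1) • (-d) = x + i • (-d) := by
      intro i; rw [succ_nsmul]; abel
    refine ⟨m + 1, by omega, fun i h1 h2 => ?_, k, ?_, ?_, by omega⟩
    · obtain ⟨j, rfl⟩ : ∃ j, i = j + 1 := ⟨i - 1, by omega⟩
      rw [hed, key]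
      rcases Nat.eq_zero_or_pos j with rfl | hj
      · simpa using hxb
      · exact hi j hj (by omega)
    · rw [hed, key, hk]
    · rw [hed]; exact hh
  have hb := hcell e he hex
  refine ⟨1, by omega, fun i h1 h2 => by omega, ?_⟩
  rw [one_nsmul]
  by_cases hn : N (x + d + e) = true
  · rcases T.node_step hc hn he with ⟨h1, h2⟩ | ⟨h1, h2⟩
    · have hne : x + d + e ≠ o := by
        intro e'
        have := T.le _ hc
        rw [← e'] at this
        simp only [Prod.snd_add] at this; omega
      have := (T.pred_facts hn).2.2.2.2.2.2.2
      rcases this with h | h | h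
      · exact absurd h hne
      · refine ⟨.pawn, by rw [hb, h]; rfl, rfl, ?_⟩
        rintro ⟨-, -, h3, -⟩; omega
      · refine ⟨.knight, by rw [hb, h]; rfl, rfl, by simp⟩
    · rw [T.par_eq hx hc hd hd2] at h2
      exact absurd h2 hex
  · rw [Bool.not_eq_true] at hn
    obtain ⟨k, h1, h2, h3⟩ := T.step_facts hc he hn
    exact ⟨k, by rw [hb, h1]; rfl, h2, by tauto⟩


/-! ### The board -/

/-- The board without the black king, when the white king stands on `w`: the pieces of `cellOf`,
except for the two squares between which the white king moves. -/
def sea (N R : Square → Bool) (w : Square) : Board := fun q =>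
  if q = w then some (.white, .king)
  else if q = (0, 0) ∨ q = (1, 0) then none
  else (cellOf N R q).map (Prod.mk .white)

/-- The board when the black king stands on `x`, the nodes on the way to `t` are empty, and nothing
else has changed. -/
def climb (N R : Square → Bool) (w t x : Square) : Board := fun q =>
  if q = x then some (.black, .king) else if eaten N t q then none else sea N R w q

/-- The square of the white king after `k` moves of it. -/
def kingAt (k : ℕ) : Square := if k % 2 = 0 then (0, 0) else (1, 0)

theorem smul_snd (n : ℕ) (d : Square) : (n • d).2 = n * d.2 := by
  obtain ⟨a, b⟩ := d; simp

/-- The white king moves back and forth. -/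
def shuffle : Strategy := fun h => (kingAt (h.length / 2), kingAt (h.length / 2 + 1))

theorem kingAt_cases (k : ℕ) : (kingAt k = (0, 0) ∧ kingAt (k + 1) = (1, 0)) ∨
    (kingAt k = (1, 0) ∧ kingAt (k + 1) = (0, 0)) := by
  unfold kingAt
  rcases Nat.mod_two_eq_zero_or_one k with h | h
  · left; rw [if_pos h, if_neg (by omega)]; exact ⟨rfl, rfl⟩
  · right; rw [if_neg (by omega), if_pos (by omega)]; exact ⟨rfl, rfl⟩

theorem kingAt_snd (k : ℕ) : (kingAt k).2 = 0 := by
  rcases kingAt_cases k with h | h <;> rw [h.1]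

section sea
variable {N R : Square → Bool} {o : Square}

theorem sea_high {w q : Square} (hw : w.2 = 0) (hq : 0 < q.2) :
    sea N R w q = (cellOf N R q).map (Prod.mk .white) := by
  unfold sea
  rw [if_neg (by rintro rfl; omega), if_neg (by rintro (rfl | rfl) <;> simp at hq)]

theorem sea_king {w s : Square} (T : Tree N R o) (h : sea N R w s = some (.white, .king)) :
    s = w := by
  unfold sea at h
  split_ifs at h with h1
  · exact h1
  · by_cases hs : s = o
    · rw [Option.map_eq_some_iff] at h
      obtain ⟨k, hk, hk2⟩ := h
      unfold cellOf at hk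
      rw [(T.root_iff s).2 hs] at hk
      simp at hk
    · obtain ⟨k, hk, hne⟩ := T.cell_ne_none hs
      rw [hk] at h
      simp at h; exact absurd h hne

theorem sea_white {w s : Square} {c : Color} {k : PieceKind} (h : sea N R w s = some (c, k)) :
    c = .white := by
  unfold sea at h
  split_ifs at h
  · simp at h; exact h.1.symm
  · rw [Option.map_eq_some_iff] at h
    obtain ⟨k, -, hk⟩ := h
    simp at hk; exact hk.1.symm

theorem sea_knight {w s : Square} (h : sea N R w s = some (.white, .knight)) : N s = true := by
  unfold sea at h
  split_ifs at h
  · simp at h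
  · rw [Option.map_eq_some_iff] at h
    obtain ⟨k, hk, hk2⟩ := h
    simp at hk2; subst hk2
    exact Tree.cellOf_knight hk

theorem sea_some (T : Tree N R o) {w s : Square} (hw : w.2 = 0) (hs : s.2 ≠ 0) (ho : s ≠ o) :
    ∃ k, sea N R w s = some (.white, k) := by
  unfold sea
  rw [if_neg (by rintro rfl; exact hs hw), if_neg (by rintro (rfl | rfl) <;> exact hs rfl)]
  obtain ⟨k, hk, -⟩ := T.cell_ne_none ho
  exact ⟨k, by rw [hk]; rfl⟩

end sea

/-- The black king stands on the node `x`, nodes may be empty, and nothing else has changed. -/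
structure Roam (N R : Square → Bool) (w : Square) (b : Board) (x : Square) : Prop where
  node : N x = true
  king : b x = some (.black, .king)
  off : ∀ q, N q = false → b q = sea N R w q
  on : ∀ q, q ≠ x → b q = none ∨ b q = sea N R w q

namespace Roam
variable {N R : Square → Bool} {o w x : Square} {b : Board} (T : Tree N R o)

theorem arena (h : Roam N R w b x) : Arena b x where
  king := h.king
  only s k hs := by
    by_contra hsx
    rcases h.on s hsx with h1 | h1
    · simp [h1] at hs
    · rw [h1] at hs; simpa using sea_white hs

include T in
theorem whiteKing (h : Roam N R w b x) {s : Square} (hs : b s = some (.white, .king)) : s = w := by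
  by_cases hsx : s = x
  · rw [hsx, h.king] at hs; simp at hs
  rcases h.on s hsx with h1 | h1
  · simp [h1] at hs
  · exact sea_king T (h1 ▸ hs)

include T in
theorem realizes_open (hw : w.2 = 0) (h : Roam N R w b x) :
    Realizes b x (openK (fun q => N (x + q)) (fun q => R (x + q))) := by
  intro q c hq
  unfold openK at hq
  split_ifs at hq with h1
  simp only [Bool.or_eq_true, Bool.not_eq_true', not_or, Bool.not_eq_false, Bool.not_eq_true] at h1
  rw [cellOf_shift] at hq
  simp only [Option.some.injEq] at hq
  have hx := T.le _ h.node
  have := T.high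
  rw [h.off _ h1.1, sea_high hw, hq]
  have := near_iff.1 h1.2
  simp only [Prod.snd_add]; omega

include T in
/-- The black king can only move from node to node. -/
theorem step (hw : w.2 = 0) (h : Roam N R w b x) {m : Move} (hm : Legal ⟨b, .black⟩ m) :
    ∃ d ∈ dirs, m = (x, x + d) ∧ N (x + d) = true ∧
      (Position.play ⟨b, .black⟩ m).board = kplay b x (x + d) ∧
      Roam N R w (kplay b x (x + d)) (x + d) ∧ ¬ WhiteAttacks (kplay b x (x + d)) (x + d) := by
  obtain ⟨d, hd, rfl, hna⟩ := h.arena.legal_black hm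
  have hN : N (x + d) = true := by
    by_contra hn
    rw [Bool.not_eq_true] at hn
    refine hna (attacked_sound (x := x) ?_ (T.open_facts h.node hd hn))
    have h1 := (h.realizes_open T hw).upd 0 none
    rw [add_zero] at h1
    exact h1.upd_none d (some (.black, .king))
  refine ⟨d, hd, rfl, hN, h.arena.play_eq, ⟨hN, h.arena.kplay.king, fun q hq => ?_, fun q hq => ?_⟩,
    hna⟩
  · rw [kplay, Function.update_of_ne, Function.update_of_ne, h.off q hq]
    · rintro rfl; rw [h.node] at hq; simp at hq
    · rintro rfl; rw [hN] at hq; simp at hq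
  · rw [kplay, Function.update_of_ne hq]
    by_cases hqx : q = x
    · subst hqx; left; simp
    · rw [Function.update_of_ne hqx]; exact h.on q hqx

include T in
theorem not_inCheck_white (hw : w.2 = 0) (h : Roam N R w b x) : ¬ InCheck b .white :=
  h.arena.not_inCheck_white fun s hs => by
    have := T.le _ h.node
    have := T.high
    rw [h.whiteKing T hs]; omega

include T in
/-- Up to the rank of the white king nothing has changed. -/
theorem chamber (h : Roam N R w b x) {q : Square} (hq : q.2 ≤ 0) :
    b q = sea N R w q := by
  refine h.off q ?_
  by_contra hn
  rw [Bool.not_eq_false] at hn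
  have := T.le _ hn
  have := T.high
  omega

include T in
/-- The white king can move back and forth. -/
theorem shuffle_legal {k : ℕ} (h : Roam N R (kingAt k) b x) :
    let m : Move := (kingAt k, kingAt (k + 1))
    Legal ⟨b, .white⟩ m ∧ b (kingAt k) = some (.white, .king) ∧
      Roam N R (kingAt (k + 1)) (Position.play ⟨b, .white⟩ m).board x ∧
      (¬ WhiteAttacks b x → ¬ WhiteAttacks (Position.play ⟨b, .white⟩ m).board x) := by
  intro m
  have hw := kingAt_snd k
  have hw' := kingAt_snd (k + 1)
  have hne : kingAt k ≠ kingAt (k + 1) := by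
    rcases kingAt_cases k with h | h <;> rw [h.1, h.2] <;> decide
  have hx := T.le _ h.node
  have hhi := T.high
  have hbw : b (kingAt k) = some (.white, .king) := by
    rw [h.chamber T hw.le, sea, if_pos rfl]
  have hbw' : b (kingAt (k + 1)) = none := by
    rw [h.chamber T hw'.le, sea, if_neg hne.symm, if_pos]
    rcases kingAt_cases k with h | h <;> rw [h.2] <;> simp
  have hpb : (Position.play ⟨b, .white⟩ m).board =
      Function.update (Function.update b (kingAt k) none) (kingAt (k + 1)) (some (.white, .king)) := by
    simp only [Position.play, m, hbw]
  have hsea : ∀ q, q ≠ kingAt k → q ≠ kingAt (k + 1) →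
      sea N R (kingAt k) q = sea N R (kingAt (k + 1)) q := by
    intro q h1 h2
    simp only [sea, if_neg h1, if_neg h2]
  have hoff : ∀ q, (q = kingAt k ∨ q = kingAt (k + 1)) →
      (Position.play ⟨b, .white⟩ m).board q = sea N R (kingAt (k + 1)) q := by
    rintro q (rfl | rfl)
    · rw [hpb, Function.update_of_ne hne, Function.update_self, sea, if_neg hne, if_pos]
      rcases kingAt_cases k with h | h <;> rw [h.1] <;> simp
    · rw [hpb, Function.update_self, sea, if_pos rfl]
  have hoth : ∀ q, q ≠ kingAt k → q ≠ kingAt (k + 1) →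
      (Position.play ⟨b, .white⟩ m).board q = b q := by
    intro q h1 h2
    rw [hpb, Function.update_of_ne h2, Function.update_of_ne h1]
  have hR : Roam N R (kingAt (k + 1)) (Position.play ⟨b, .white⟩ m).board x := by
    refine ⟨h.node, ?_, fun q hq => ?_, fun q hq => ?_⟩
    · rw [hoth x (by rintro rfl; omega) (by rintro rfl; omega), h.king]
    · by_cases h1 : q = kingAt k ∨ q = kingAt (k + 1)
      · exact hoff q h1
      · rw [not_or] at h1
        rw [hoth q h1.1 h1.2, h.off q hq, hsea q h1.1 h1.2]
    · by_cases h1 : q = kingAt k ∨ q = kingAt (k + 1)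
      · exact .inr (hoff q h1)
      · rw [not_or] at h1
        rw [hoth q h1.1 h1.2, ← hsea q h1.1 h1.2]
        exact h.on q hq
  refine ⟨⟨⟨.king, hbw, fun k' hk' => by
    have : b (kingAt (k + 1)) = some (.white, k') := hk'
    rw [hbw'] at this; simp at this, ?_⟩,
    hR.not_inCheck_white T hw'⟩, hbw, hR, fun hna => ?_⟩
  · simp only [reduceCtorEq, if_false, m, Attacks, hbw]
    refine ⟨hne, ?_, ?_⟩ <;> rcases kingAt_cases k with h | h <;> rw [h.1, h.2] <;> simp
  · rintro ⟨s, k', hs, ha⟩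
    by_cases hsk : s = kingAt k ∨ s = kingAt (k + 1)
    · rw [hoff s hsk] at hs
      have hk' : k' = .king := by
        rcases hsk with rfl | rfl
        · rw [sea, if_neg hne, if_pos] at hs
          · simp at hs
          · rcases kingAt_cases k with h | h <;> rw [h.1] <;> simp
        · rw [sea, if_pos rfl] at hs; simp at hs; exact hs.symm
      subst hk'
      rw [← hoff s hsk] at hs
      unfold Attacks at ha
      rw [hs] at ha
      simp only at ha
      have : s.2 = 0 := by rcases hsk with rfl | rfl <;> assumption
      omega
    rw [not_or] at hsk
    have hbs := hoth s hsk.1 hsk.2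
    have hslide : ∀ d : Square, d.2.natAbs ≤ 1 → Slides (Position.play ⟨b, .white⟩ m).board s x d → Slides b s x d := by
      rintro d hdd ⟨n, hn, hx', hi⟩
      refine ⟨n, hn, hx', fun i h1 h2 => ?_⟩
      have hbi := hi i h1 h2
      by_cases hc : s + i • d = kingAt k ∨ s + i • d = kingAt (k + 1)
      · exfalso
        have hr : (s + i • d).2 = 0 := by rcases hc with e | e <;> rw [e] <;> assumption
        have hx2 : x.2 = s.2 + n * d.2 := by rw [hx', Prod.snd_add, smul_snd]
        rw [Prod.snd_add, smul_snd] at hr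
        have hpos : 0 < d.2 := by
          have h3 : (0 : ℤ) < ((n : ℤ) - i) * d.2 := by
            rw [sub_mul]; omega
          exact pos_of_mul_pos_right h3 (by omega)
        have hlt : i + 1 < n ∨ i + 1 = n := by omega
        rcases hlt with h4 | h4
        · have hb1 := hi (i + 1) (by omega) h4
          set z := s + (i + 1) • d with hz
          have hz2 : z.2 = 1 := by
            rw [hz, succ_nsmul, Prod.snd_add, Prod.snd_add, smul_snd]; omega
          have h6 := hoth z (by intro e; rw [e] at hz2; omega) (by intro e; rw [e] at hz2; omega)
          have h7 : N z = false := by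
            by_contra hc; rw [Bool.not_eq_false] at hc
            have := T.le z hc; omega
          obtain ⟨k2, hk2⟩ := sea_some T hw (s := z) (by omega) (by rintro rfl; omega)
          rw [h6, h.off z h7, hk2] at hb1
          simp at hb1
        · have : x.2 = d.2 := by
            rw [hx2, ← h4]; push_cast; rw [add_mul]; omega
          omega
      · rw [not_or] at hc
        rwa [hoth _ hc.1 hc.2] at hbi
    refine hna ⟨s, k', by rwa [hbs] at hs, ?_⟩
    unfold Attacks at ha ⊢
    rw [hs] at ha
    rw [hbs] at hs
    rw [hs]
    cases k' with
    | king => exact ha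
    | queen =>
      obtain ⟨d, hd, h⟩ := ha
      exact ⟨d, hd, hslide d (by simp only [IsOrthogonal, IsDiagonal] at hd; omega) h⟩
    | rook =>
      obtain ⟨d, hd, h⟩ := ha
      exact ⟨d, hd, hslide d (by simp only [IsOrthogonal] at hd; omega) h⟩
    | bishop =>
      obtain ⟨d, hd, h⟩ := ha
      exact ⟨d, hd, hslide d (by simp only [IsDiagonal] at hd; omega) h⟩
    | knight => exact ha
    | pawn => exact ha

end Roam

section climb
variable {N R : Square → Bool} {o w x : Square} (T : Tree N R o)
include T

omit T in
theorem climb_roam {t : Square} (hx : N x = true) : Roam N R w (climb N R w t x) x where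
  node := hx
  king := by simp [climb]
  off q hq := by
    unfold climb
    rw [if_neg (by rintro rfl; rw [hx] at hq; simp at hq), if_neg]
    intro h
    rw [(Tree.eaten_le h).1] at hq; simp at hq
  on q hq := by
    unfold climb
    rw [if_neg hq]
    split_ifs
    · exact .inl rfl
    · exact .inr rfl

/-- A step up leads from one of the boards `climb` to another one. -/
theorem climb_up (hx : N x = true) {d : Square} (hd : d ∈ dirs) (hd2 : d.2 = 1)
    (hc : N (x + d) = true) :
    kplay (climb N R w x x) x (x + d) = climb N R w (x + d) (x + d) := by
  have hp := T.par_eq hx hc hd hd2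
  funext q
  unfold kplay climb
  by_cases h1 : q = x + d
  · rw [h1, Function.update_self, if_pos rfl]
  rw [Function.update_of_ne h1, if_neg h1]
  have he := Tree.eaten_iff (q := q) hc
  rw [hp] at he
  by_cases h2 : q = x
  · rw [h2, Function.update_self, if_pos]
    rw [h2] at he
    exact he.2 (.inr (Tree.eaten_self hx))
  · rw [Function.update_of_ne h2, if_neg h2]
    congr 1
    rw [eq_iff_iff, he]
    tauto

omit T in
theorem climb_back (hx : N x = true) : kplay (climb N R w x x) x (par N x) =
    climb N R w x (par N x) := by
  funext q
  unfold kplay climb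
  by_cases h1 : q = par N x
  · rw [h1, Function.update_self, if_pos rfl]
  rw [Function.update_of_ne h1, if_neg h1]
  by_cases h2 : q = x
  · rw [h2, Function.update_self, if_pos (Tree.eaten_self hx)]
  · rw [Function.update_of_ne h2, if_neg h2]

theorem climb_realizes (hw : w.2 = 0) {d : Square} (hx : N x = true) :
    Realizes (climb N R w (x + d) x) x (eatenK (fun q => N (x + q)) (fun q => R (x + q)) d) := by
  intro q c hq
  unfold eatenK at hq
  split_ifs at hq with h1 h2
  · simp only [Option.some.injEq] at hq
    subst hq
    simp only [Bool.or_eq_true, beq_iff_eq, not_or] at h1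
    rw [eaten_shift] at h2
    unfold climb
    rw [if_neg (by simpa using h1.1), if_pos h2]; rfl
  · simp only [Bool.or_eq_true, beq_iff_eq, not_or, Bool.not_eq_true', Bool.not_eq_false] at h1
    rw [eaten_shift] at h2
    have h3 := near_iff.1 h1.2
    have := T.le _ hx
    have := T.high
    unfold climb
    rw [if_neg (by simpa using h1.1), if_neg h2,
      sea_high hw (by simp only [Prod.snd_add]; omega)]
    rw [cellOf_shift, Option.some.injEq] at hq
    rw [hq]

/-- Each downward diagonal from a node leads along nodes to a piece that does not slide along it. -/
theorem shielded_of_nodes {b : Board} {P : Square → Prop}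
    (hP : ∀ q, P q → N q = true ∧ ∀ d ∈ dirs, d.2 = -1 → d.1 ≠ 0 →
      (∃ k, b (q + d) = some (.white, k) ∧ hits d k = false) ∨ (b (q + d) = none ∧ P (q + d)))
    {q : Square} (hq : P q) {d : Square} (hd : d ∈ dirs) (hd2 : d.2 = -1) (hd1 : d.1 ≠ 0) :
    Shielded b q d := by
  have key : ∀ (n : ℕ) (q : Square), P q → q.2 < o.2 + n → Shielded b q d := by
    intro n
    induction n with
    | zero =>
      intro q hq hn
      have := T.le q (hP q hq).1
      push_cast at hn; omega
    | succ n ih =>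
      intro q hq hn
      rcases (hP q hq).2 d hd hd2 hd1 with ⟨k, h1, h2⟩ | ⟨h1, h2⟩
      · exact ⟨1, by omega, fun i h3 h4 => by omega, k, by rw [one_nsmul, h1], h2⟩
      · obtain ⟨m, hm, hi, k, hk, hh⟩ := ih _ h2 (by
          simp only [Prod.snd_add]; push_cast at hn; omega)
        have key : ∀ i : ℕ, q + (i + 1) • d = q + d + i • d := by
          intro i; rw [succ_nsmul]; abel
        refine ⟨m + 1, by omega, fun i h3 h4 => ?_, k, by rw [key, hk], hh⟩
        obtain ⟨j, rfl⟩ : ∃ j, i = j + 1 := ⟨i - 1, by omega⟩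
        rw [key]
        rcases Nat.eq_zero_or_pos j with rfl | hj
        · simpa using h1
        · exact hi j hj (by omega)
  exact key (q.2 - o.2 + 1).toNat q hq (by have := T.le q (hP q hq).1; omega)

theorem climb_shielded (hw : w.2 = 0) {t q d : Square} (hq : eaten N t q = true) (hqx : q.2 ≤ x.2)
    (hd : d ∈ dirs) (hd2 : d.2 = -1) (hd1 : d.1 ≠ 0) : Shielded (climb N R w t x) q d := by
  refine shielded_of_nodes T (P := fun q => eaten N t q = true ∧ q.2 ≤ x.2) ?_ ⟨hq, hqx⟩ hd hd2 hd1
  rintro q ⟨hq, hqx⟩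
  have hN := (Tree.eaten_le hq).1
  refine ⟨hN, fun d hd hd2 hd1 => ?_⟩
  have hne : q + d ≠ x := by rintro e; rw [← e] at hqx; simp only [Prod.snd_add] at hqx; omega
  by_cases hn : N (q + d) = true
  · right
    rcases T.node_step hN hn hd with h | h
    · omega
    · have h3 := T.eaten_par hq h.1
      rw [← h.2] at h3
      unfold climb
      rw [if_neg hne, if_pos h3]
      exact ⟨rfl, h3, by simp only [Prod.snd_add]; omega⟩
  · left
    rw [Bool.not_eq_true] at hn
    obtain ⟨k, h1, h2, -⟩ := T.step_facts hN hd hn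
    refine ⟨k, ?_, h2⟩
    have := T.le q hN
    have := T.high
    unfold climb
    rw [if_neg hne, if_neg, sea_high hw (by simp only [Prod.snd_add]; omega), h1]
    · rfl
    · intro h; rw [(Tree.eaten_le h).1] at hn; simp at hn

/-- The way to each node starts at the root. -/
theorem eaten_base {t : Square} (ht : N t = true) : eaten N t o = true := by
  have key : ∀ (n : ℕ) (t : Square), N t = true → t.2 < o.2 + n → eaten N t o = true := by
    intro n
    induction n with
    | zero => intro t ht hn; have := T.le t ht; push_cast at hn; omega
    | succ n ih =>
      intro t ht hn
      by_cases hto : t = o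
      · rw [hto]; exact Tree.eaten_self T.node_root
      · rw [Tree.eaten_iff ht]
        refine .inr (ih _ (T.node_par ht hto) ?_)
        rw [par_snd]; push_cast at hn; omega
  exact key (t.2 - o.2 + 1).toNat t ht (by have := T.le t ht; omega)

theorem sea_low (hw : w.2 = 0) {q : Square} (hq : q.2 < 0) :
    sea N R w q = some (.white, .pawn) := by
  have hi := T.high
  have hN : ∀ d : Square, d.2 ≤ 50 → N (q + d) = false := by
    intro d hd
    by_contra hc
    rw [Bool.not_eq_false] at hc
    have := T.le _ hc
    simp only [Prod.snd_add] at this; omega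
  have hR : ∀ d : Square, d.2 ≤ 50 → R (q + d) = false := by
    intro d hd
    rw [T.root_eq, decide_eq_false]
    intro hc
    have := congrArg Prod.snd hc
    simp only [Prod.snd_add] at this; omega
  have hN0 : N q = false := by simpa using hN 0 (by simp)
  have hR0 : R q = false := by simpa using hR 0 (by simp)
  have hc : cellOf N R q = some .pawn := by
    simp only [cellOf, isVertex, hN0, hR0, hN (-1, 1) (by simp), hN (1, 1) (by simp),
      hN (-2, 2) (by simp), hN (3, 1) (by simp), hN (4, 1) (by simp), hN (0, -3) (by simp),
      hR (-1, 1) (by simp), hR (1, 1) (by simp), hR (0, 2) (by simp)]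
    simp
  unfold sea
  rw [if_neg (by rintro rfl; omega), if_neg (by rintro (rfl | rfl) <;> simp at hq), hc]
  rfl

/-- From each empty square of rank at most `r` the downward diagonals are shielded, since the nodes
left empty lie on a single way through filled squares. -/
theorem climb_rayOK (hw : w.2 = 0) {t : Square} (ht : N t = true) {r : ℤ} (hr : r < x.2)
    (hx : N x = true) : RayOK (climb N R w t x) r := by
  intro q hq hb d hd hd2 hd1
  by_cases he : eaten N t q = true
  · exact climb_shielded T hw he (by omega) hd hd2 hd1
  · have hqx : q ≠ x := by rintro rfl; omega
    have hi := T.high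
    have hc : q.2 = 0 := by
      unfold climb at hb
      rw [if_neg hqx, if_neg he] at hb
      by_contra hc
      by_cases ho : q = o
      · rw [ho] at he; exact he (eaten_base T ht)
      · obtain ⟨k, hk⟩ := sea_some (R := R) T hw hc ho
        rw [hk] at hb; simp at hb
    refine ⟨1, by omega, fun i h1 h2 => by omega, .pawn, ?_, rfl⟩
    have hlow : (q + d).2 < 0 := by simp only [Prod.snd_add]; omega
    rw [one_nsmul]
    unfold climb
    rw [if_neg, if_neg, sea_low T hw hlow]
    · intro h
      have := T.le _ (Tree.eaten_le h).1
      omega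
    · rintro e
      have := T.le _ hx
      rw [e] at hlow; omega

/-- The king can always climb further while white waits. -/
theorem climb_step_safe (hw : w.2 = 0) (hx : N x = true) {d : Square} (hd : d ∈ dirs)
    (hd2 : d.2 = 1) (hc : N (x + d) = true) :
    Legal ⟨climb N R w x x, .black⟩ (x, x + d) := by
  refine (climb_roam hx).arena.legal_kstep hd ?_
  rw [climb_up T hx hd hd2 hc]
  have hxe : eaten N (x + d) x = true := by
    rw [Tree.eaten_iff hc, T.par_eq hx hc hd hd2]; exact .inr (Tree.eaten_self hx)
  have hx0 := T.le _ hx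
  have hhi := T.high
  have hx2 : (x + d).2 = x.2 + 1 := by rw [Prod.snd_add, hd2]
  have hd1 : d.1 ≠ 0 := by
    intro h0
    have : d = (0, 1) := Prod.ext h0 hd2
    rw [this, (T.pred_facts hx).2.2.2.1] at hc; simp at hc
  have hnx : x ≠ x + d := by intro e; rw [← e] at hx2; omega
  refine T.step_safe hx hd hd2 hc ?_ ?_ ?_ ?_ ?_
  · unfold climb; rw [if_neg hnx, if_pos hxe]
  · refine climb_shielded T hw hxe (by omega) ?_ ?_ ?_
    · rw [mem_dirs] at hd ⊢
      simp only [ne_eq, neg_eq_zero, Prod.fst_neg, Prod.snd_neg]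
      exact ⟨hd.1, by omega, by omega⟩
    · simp [hd2]
    · simpa using hd1
  · intro e he hne
    have hde := (mem_dirs.1 he)
    have hpos : 0 < (x + d + e).2 := by
      have : (x + d + e).2 = (x + d).2 + e.2 := rfl
      omega
    have h1 : x + d + e ≠ x + d := by intro h; exact hde.1 (by simpa using h)
    have h2 : ¬ eaten N (x + d) (x + d + e) = true := by
      intro h
      rcases T.node_step hc (Tree.eaten_le h).1 he with h1 | h1
      · have := (Tree.eaten_le h).2
        simp only [Prod.snd_add] at this; omega
      · rw [T.par_eq hx hc hd hd2] at h1
        exact hne h1.2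
    unfold climb
    rw [if_neg h1, if_neg h2, sea_high hw hpos]
  · intro e he hk
    unfold climb at hk
    split_ifs at hk
    · simp at hk
    · have h1 := T.even _ (sea_knight hk)
      have h2 := T.even _ hc
      rw [mem_kdirs] at he
      simp only [Prod.fst_add, Prod.snd_add, Int.even_iff] at h1 h2
      omega
  · intro s hs
    unfold climb at hs
    split_ifs at hs
    · simp at hs
    · rw [sea_king T hs]; omega

end climb

/-! ### Plays and strategies -/

theorem isPlay_nil (p : Position) : IsPlay p [] := fun h' m hp => by simp at hp

theorem isPlay_concat {p : Position} {h : List Move} {m : Move} :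
    IsPlay p (h ++ [m]) ↔ IsPlay p h ∧ Legal (after p h) m := by
  constructor
  · intro H
    exact ⟨fun h' m' hp => H h' m' (hp.trans (List.prefix_append _ _)), H h m (List.prefix_refl _)⟩
  · rintro ⟨H, hl⟩ h' m' hp
    rcases List.prefix_concat_iff.1 hp with e | e
    · obtain ⟨rfl, e⟩ := List.append_inj' e rfl
      obtain rfl : m' = m := by simpa using e
      exact hl
    · exact H h' m' e

theorem follows_concat {p : Position} {c : Color} {τ : Strategy} {h : List Move} {m : Move} :
    Follows p c τ (h ++ [m]) ↔ Follows p c τ h ∧ ((after p h).turn = c → m = τ h) := by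
  constructor
  · intro H
    exact ⟨fun h' m' hp => H h' m' (hp.trans (List.prefix_append _ _)), H h m (List.prefix_refl _)⟩
  · rintro ⟨H, hl⟩ h' m' hp
    rcases List.prefix_concat_iff.1 hp with e | e
    · obtain ⟨rfl, e⟩ := List.append_inj' e rfl
      obtain rfl : m' = m := by simpa using e
      exact hl
    · exact H h' m' e

theorem arises_nil (p : Position) (c : Color) (τ : Strategy) : Arises p c τ [] :=
  ⟨isPlay_nil p, fun h' m hp => by simp at hp⟩

theorem arises_concat {p : Position} {c : Color} {τ : Strategy} {h : List Move} {m : Move} :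
    Arises p c τ (h ++ [m]) ↔
      Arises p c τ h ∧ Legal (after p h) m ∧ ((after p h).turn = c → m = τ h) := by
  rw [Arises, isPlay_concat, follows_concat, Arises]; tauto

theorem turn_concat (p : Position) (h : List Move) (m : Move) :
    (after p (h ++ [m])).turn = (after p h).turn.other := by
  rw [after_concat]; rfl

theorem turn_eq_black {p : Position} (hp : p.turn = .black) (h : List Move) :
    (after p h).turn = if h.length % 2 = 0 then .black else .white := by
  induction h using List.reverseRecOn with
  | nil => simpa [after] using hp
  | append_singleton h m ih =>
    rw [turn_concat, ih, List.length_append, List.length_singleton]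
    split_ifs <;> first | rfl | omega

/-- A strategy `τ` of white that keeps the histories with black to move in the family `B`, where
`B h x` means that the black king has been driven to the node `x`, until white mates within `n`
moves. -/
structure Guide (N : Square → Bool) (o : Square) (p : Position) (τ : Strategy) (n : ℕ)
    (B : List Move → Square → Prop) : Prop where
  turn : p.turn = .black
  init : B [] o
  live : ∀ h x, B h x → (after p h).turn = .black → ∃ m, Legal (after p h) m
  next : ∀ h x m, B h x → (after p h).turn = .black → Legal (after p h) m →
    MatesWithin p τ n (h ++ [m]) ∨
      (N m.2 = true ∧ par N m.2 = x ∧ Legal (after p (h ++ [m])) (τ (h ++ [m])) ∧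
        B (h ++ [m] ++ [τ (h ++ [m])]) m.2)

namespace Guide
variable {N : Square → Bool} {o : Square} {p : Position} {τ : Strategy} {n : ℕ}
  {B : List Move → Square → Prop} (G : Guide N o p τ n B)
include G

/-- With a guide, the play is always in the family `B` or a mate within `n` moves has begun. -/
theorem invariant (h : List Move) (ha : Arises p .white τ h) :
    ((after p h).turn = .black → (∃ x, B h x) ∨ Checkmate (after p h) ∨
      ((∃ m, Legal (after p h) m) ∧ ∀ m, Legal (after p h) m → MatesWithin p τ n (h ++ [m]))) ∧
    ((after p h).turn = .white → MatesWithin p τ n h ∨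
      (Legal (after p h) (τ h) ∧ ∃ x, B (h ++ [τ h]) x)) := by
  induction h using List.reverseRecOn with
  | nil => exact ⟨fun _ => .inl ⟨o, G.init⟩, fun h => by simp [after, G.turn] at h⟩
  | append_singleton h m ih =>
    rw [arises_concat] at ha
    obtain ⟨ha, hl, hf⟩ := ha
    obtain ⟨ih1, ih2⟩ := ih ha
    rw [turn_concat]
    rcases ht : (after p h).turn with - | -
    · refine ⟨fun _ => ?_, fun h => by simp [Color.other] at h⟩
      obtain rfl := hf ht
      rcases ih2 ht with h1 | ⟨-, x, h1⟩
      · obtain _ | n' := n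
        · exact h1.elim
        · rcases h1.2 with h2 | h2
          · exact .inr (.inl h2)
          · exact .inr (.inr ⟨h2.1, fun m hm => (h2.2 m hm).mono (by omega)⟩)
      · exact .inl ⟨x, h1⟩
    · refine ⟨fun h => by simp [Color.other] at h, fun _ => ?_⟩
      rcases ih1 ht with ⟨x, h1⟩ | h1 | h1
      · exact (G.next h x m h1 ht hl).imp id fun h2 => ⟨h2.2.2.1, _, h2.2.2.2⟩
      · exact absurd hl (h1.2 m)
      · exact .inl (h1.2 m hl)

theorem isStrategy : IsStrategy p .white τ := by
  intro h ha ht _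
  rcases (G.invariant h ha).2 ht with h1 | h1
  · obtain _ | n := n
    · exact h1.elim
    · exact h1.1
  · exact h1.1

/-- If the tree has no computable infinite branch, then no computable strategy survives. -/
theorem defeats (hτ : Computable τ) (hno : ¬ ∃ f : ℕ → Square, Computable f ∧ f 0 = o ∧
    ∀ n, N (f (n + 1)) = true ∧ par N (f (n + 1)) = f n) : DefeatsAllComputable p τ := by
  intro σ hσ hlegal
  by_contra hwin
  have hmate : ∀ k, IsPlay p (playSeq p τ σ k) → (after p (playSeq p τ σ k)).turn = .black →
      ¬ Checkmate (after p (playSeq p τ σ k)) := fun k h1 h2 h3 => hwin ⟨k, h1, h2, h3⟩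
  have harise : ∀ k, Arises p .white τ (playSeq p τ σ k) := by
    intro k
    induction k with
    | zero => exact arises_nil _ _ _
    | succ k ih =>
      rw [playSeq, arises_concat]
      rcases ht : (after p (playSeq p τ σ k)).turn with - | -
      · simp only [if_true, forall_const, and_true]
        refine ⟨ih, ?_⟩
        rcases (G.invariant _ ih).2 ht with h1 | h1
        · obtain _ | n := n
          · exact h1.elim
          · exact h1.1
        · exact h1.1
      · simp only [reduceCtorEq, if_false, false_imp_iff, and_true]
        refine ⟨ih, hlegal k ih.1 ht ?_⟩
        rcases (G.invariant _ ih).1 ht with ⟨x, h1⟩ | h1 | h1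
        · exact G.live _ x h1 ht
        · exact absurd h1 (hmate k ih.1 ht)
        · exact h1.1
  have hno_mate : ∀ j k, (after p (playSeq p τ σ k)).turn = .white →
      ¬ MatesWithin p τ j (playSeq p τ σ k) := by
    intro j
    induction j with
    | zero => exact fun k _ h => h
    | succ j ih =>
      rintro k ht ⟨-, h⟩
      have e : playSeq p τ σ (k + 1) = playSeq p τ σ k ++ [τ (playSeq p τ σ k)] := by
        rw [playSeq, if_pos ht]
      have ht1 : (after p (playSeq p τ σ (k + 1))).turn = .black := by
        rw [e, turn_concat, ht]; rfl
      rw [← e] at h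
      rcases h with h | h
      · exact hmate _ (harise _).1 ht1 h
      · have e2 : playSeq p τ σ (k + 2) = playSeq p τ σ (k + 1) ++ [σ (playSeq p τ σ (k + 1))] := by
          rw [playSeq, if_neg (by rw [ht1]; simp)]
        refine ih (k + 2) (by rw [e2, turn_concat, ht1]; rfl) ?_
        rw [e2]
        refine h.2 _ ?_
        have := harise (k + 2)
        rw [e2, arises_concat] at this
        exact this.2.1
  have hlen : ∀ k, (playSeq p τ σ k).length = k := by
    intro k
    induction k with
    | zero => rfl
    | succ k ih => rw [playSeq, List.length_append, ih]; rfl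
  have hturn : ∀ k, (after p (playSeq p τ σ k)).turn = if k % 2 = 0 then .black else .white := by
    intro k; rw [turn_eq_black G.turn, hlen]
  set f : ℕ → Square := fun k =>
    ((playSeq p τ σ (2 * k - 1)).getLast?.map Prod.snd).getD o with hf
  have hB : ∀ k, B (playSeq p τ σ (2 * k)) (f k) ∧ N (f (k + 1)) = true ∧
      par N (f (k + 1)) = f k := by
    have step : ∀ k, B (playSeq p τ σ (2 * k)) (f k) → N (f (k + 1)) = true ∧
        par N (f (k + 1)) = f k ∧ B (playSeq p τ σ (2 * (k + 1))) (f (k + 1)) := by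
      intro k hk
      have ht : (after p (playSeq p τ σ (2 * k))).turn = .black := by
        rw [hturn, if_pos (by omega)]
      have e1 : playSeq p τ σ (2 * k + 1) = playSeq p τ σ (2 * k) ++ [σ (playSeq p τ σ (2 * k))] := by
        rw [playSeq, if_neg (by rw [ht]; simp)]
      have ht1 : (after p (playSeq p τ σ (2 * k + 1))).turn = .white := by
        rw [hturn, if_neg (by omega)]
      have e2 : playSeq p τ σ (2 * (k + 1)) = playSeq p τ σ (2 * k + 1) ++
          [τ (playSeq p τ σ (2 * k + 1))] := by
        rw [show 2 * (k + 1) = 2 * k + 1 + 1 by ring, playSeq, if_pos ht1]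
      have hleg := (arises_concat.1 (e1 ▸ harise (2 * k + 1))).2.1
      have hfk : f (k + 1) = (σ (playSeq p τ σ (2 * k))).2 := by
        rw [hf]; simp only [show 2 * (k + 1) - 1 = 2 * k + 1 by omega]; rw [e1]; simp
      rcases G.next _ _ _ hk ht hleg with h | h
      · rw [← e1] at h; exact absurd h (hno_mate _ _ ht1)
      · rw [← e1, ← e2, ← hfk] at h; exact ⟨h.1, h.2.1, h.2.2.2⟩
    have h0 : ∀ k, B (playSeq p τ σ (2 * k)) (f k) := by
      intro k
      induction k with
      | zero => exact G.init
      | succ k ih => exact (step k ih).2.2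
    exact fun k => ⟨h0 k, (step k (h0 k)).1, (step k (h0 k)).2.1⟩
  refine hno ⟨f, ?_, rfl, fun k => (hB k).2⟩
  have hc : Computable fun k => playSeq p τ σ k := by
    have h1 : Computable₂ fun (_ : ℕ) (l : ℕ × List Move) =>
        l.2 ++ [bif l.1 % 2 == 0 then σ l.2 else τ l.2] := by
      have hl : Computable fun (q : ℕ × ℕ × List Move) => q.2.2 := Computable.snd.comp Computable.snd
      have hn : Computable fun (q : ℕ × ℕ × List Move) => q.2.1 % 2 :=
        (Primrec.nat_mod.comp (Primrec.fst.comp Primrec.snd) (Primrec.const 2)).to_comp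
      have hb : Computable fun (q : ℕ × ℕ × List Move) => q.2.1 % 2 == 0 :=
        (Primrec.beq.to_comp).comp hn (Computable.const 0)
      exact Computable.list_append.comp hl (Computable.list_cons.comp
        (Computable.cond hb (hσ.comp hl) (hτ.comp hl)) (Computable.const []))
    have h2 := Computable.nat_rec Computable.id (Computable.const ([] : List Move)) h1
    refine h2.of_eq fun k => ?_
    simp only [id]
    induction k with
    | zero => rfl
    | succ k ih =>
      rw [playSeq, hturn, ← ih]
      simp only [List.append_cancel_left_eq, List.cons.injEq, and_true]
      rcases Nat.mod_two_eq_zero_or_one k with h | h <;> rw [h] <;> rfl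
  have hg : Primrec fun l : List Move => (l.getLast?.map Prod.snd).getD o := by
    have h1 : Primrec fun l : List Move => l.reverse.head? := Primrec.list_head?.comp Primrec.list_reverse
    have h2 : Primrec fun l : List Move => l.reverse.head?.map Prod.snd :=
      Primrec.option_map h1 (Primrec.snd.comp Primrec.snd).to₂
    exact (Primrec.option_getD.comp h2 (Primrec.const o)).of_eq fun l => by
      rw [List.head?_reverse]
  refine hg.to_comp.comp (hc.comp (Primrec.to_comp ?_))
  exact Primrec.nat_sub.comp (Primrec.nat_mul.comp (Primrec.const 2) Primrec.id) (Primrec.const 1)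

theorem shufflesUntilMate {a b : Square} (hB : ∀ h x, B h x → (after p h).turn = .black →
    ∀ m, Legal (after p h) m → MatesWithin p τ n (h ++ [m]) ∨
      ((τ (h ++ [m]) = (a, b) ∨ τ (h ++ [m]) = (b, a)) ∧
        (after p (h ++ [m])).board (τ (h ++ [m])).1 = some (.white, .king))) :
    ShufflesUntilMateIn p τ n := by
  refine ⟨a, b, fun h ha ht _ => ?_⟩
  induction h using List.reverseRecOn with
  | nil => simp [after, G.turn] at ht
  | append_singleton h m _ =>
    obtain ⟨ha, hl, -⟩ := arises_concat.1 ha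
    have ht0 : (after p h).turn = .black := by
      rw [turn_concat] at ht
      rcases ht2 : (after p h).turn with - | -
      · rw [ht2] at ht; simp [Color.other] at ht
      · rfl
    rcases (G.invariant h ha).1 ht0 with ⟨x, h1⟩ | h1 | h1
    · exact (hB h x h1 ht0 m hl).symm
    · exact absurd hl (h1.2 m)
    · exact .inr (h1.2 m hl)

end Guide

theorem alwaysChecks_of_guide {N : Square → Bool} {o : Square} {p : Position} {τ : Strategy}
    {B : List Move → Square → Prop} (G : Guide N o p τ 1 B)
    (hB : ∀ h x, B h x → h ≠ [] → (after p h).turn = .black → InCheck (after p h).board .black) :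
    AlwaysChecks p τ := by
  intro h ha ht _
  have htb : (after p (h ++ [τ h])).turn = .black := by rw [turn_concat, ht]; rfl
  rcases (G.invariant h ha).2 ht with h1 | ⟨-, x, h1⟩
  · rcases h1.2 with h2 | ⟨⟨m, hm⟩, h2⟩
    · rw [← htb]; exact h2.1
    · exact (h2 m hm).elim
  · exact hB _ x h1 (by simp) htb


/-! ### White moves his king back and forth -/

/-- The position with the black king on the root and everything else in place. -/
def start (N R : Square → Bool) (o : Square) : Position := ⟨climb N R (0, 0) o o, .black⟩

section strategies
variable {N R : Square → Bool} {o : Square} (T : Tree N R o)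

theorem Position.eta (p : Position) {c : Color} (h : p.turn = c) : p = ⟨p.board, c⟩ := by
  cases p; cases h; rfl

include T in
theorem start_proper : (start N R o).Proper := by
  have hr : Roam N R (0, 0) (start N R o).board o := climb_roam T.node_root
  refine ⟨fun c => ?_, hr.not_inCheck_white T rfl⟩
  cases c with
  | white =>
    refine ⟨(0, 0), ?_, fun s hs => hr.whiteKing T hs⟩
    show (start N R o).board (0, 0) = _
    rw [hr.chamber T le_rfl]; rfl
  | black => exact ⟨o, hr.king, fun s hs => hr.arena.only s _ hs⟩

include T in
/-- While white shuffles, the black king roams through the tree, and it is never mated: it moves to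
squares that are not attacked, and the white king attacks nothing near them. -/
theorem shuffle_invariant (hch : ∃ d ∈ dirs, d.2 = 1 ∧ N (o + d) = true) (h : List Move)
    (ha : Arises (start N R o) .white shuffle h) :
    ∃ x, Roam N R (kingAt (h.length / 2)) (after (start N R o) h).board x ∧
      (Checkmate (after (start N R o) h) → False) := by
  have key : ∃ x, Roam N R (kingAt (h.length / 2)) (after (start N R o) h).board x ∧
      (h = [] ∨ ¬ WhiteAttacks (after (start N R o) h).board x) := by
    induction h using List.reverseRecOn with
    | nil => exact ⟨o, climb_roam T.node_root, .inl rfl⟩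
    | append_singleton h m ih =>
      obtain ⟨ha, hl, hf⟩ := arises_concat.1 ha
      obtain ⟨x, hx, hx2⟩ := ih ha
      have ht := turn_eq_black (p := start N R o) rfl h
      rw [after_concat]
      by_cases hm : h.length % 2 = 0
      · rw [if_pos hm] at ht
        rw [Position.eta _ ht] at hl ⊢
        obtain ⟨d, hd, -, -, hb, hr, hna⟩ := hx.step T (kingAt_snd _) hl
        have e : (h ++ [m]).length / 2 = h.length / 2 := by simp; omega
        rw [hb, e]
        exact ⟨_, hr, .inr hna⟩
      · rw [if_neg hm] at ht
        obtain rfl := hf ht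
        rw [Position.eta _ ht]
        have e : (h ++ [shuffle h]).length / 2 = h.length / 2 + 1 := by simp; omega
        rw [e]
        obtain ⟨-, -, h1, h2⟩ := hx.shuffle_legal T
        refine ⟨x, h1, .inr (h2 (hx2.resolve_left ?_))⟩
        rintro rfl; simp at hm
  obtain ⟨x, hx, hx2⟩ := key
  refine ⟨x, hx, fun hc => ?_⟩
  have ht := turn_eq_black (p := start N R o) rfl h
  by_cases hm : h.length % 2 = 0
  · rw [if_pos hm] at ht
    rcases hx2 with rfl | hx2
    · obtain ⟨d, hd, hd2, hd3⟩ := hch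
      exact hc.2 _ (climb_step_safe T (w := (0, 0)) rfl T.node_root hd hd2 hd3)
    · have := hc.1
      rw [ht] at this
      exact hx2 (hx.arena.inCheck_iff.1 this)
  · rw [if_neg hm] at ht
    have := hc.1
    rw [ht] at this
    exact hx.not_inCheck_white T (kingAt_snd _) this

include T in
theorem shuffle_draws (hch : ∃ d ∈ dirs, d.2 = 1 ∧ N (o + d) = true) :
    IsDrawingStrategy (start N R o) .white shuffle := by
  refine ⟨fun h ha ht _ => ?_, fun h ha => (shuffle_invariant T hch h ha).choose_spec.2⟩
  obtain ⟨x, hx, -⟩ := shuffle_invariant T hch h ha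
  rw [Position.eta _ ht]
  exact (hx.shuffle_legal T).1

/-! ### White hunts the king when it strays -/

theorem pick_eq_none {b : Board} {x : Square} (h : ¬ ∃ j, j < 4 ∧ ∃ mv, GoodMove j b x mv) :
    pick (window b x) = none := by
  rw [pick, dif_neg]
  rintro ⟨j, hj, mv, f, hs, hf, hL⟩
  exact h ⟨j, hj, mv, f, hs, (realizes_window hs (by omega)).1 hf, hL⟩

theorem eatenK_supp (t : Square) : Supp (eatenK N R t) 10 := by
  intro q hq
  by_contra hcon
  apply hq
  unfold eatenK
  rw [if_pos]
  rw [← near_iff] at hcon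
  simp [hcon]

theorem goodMove_of_mate {b : Board} {x t : Square} {j : ℕ} (hj : j < 4)
    (hr : Realizes b x (eatenK (fun q => N (x + q)) (fun q => R (x + q)) t))
    (hm : LMate (j + 1) (eatenK (fun q => N (x + q)) (fun q => R (x + q)) t)) :
    ∃ mv, GoodMove j b x mv := by
  obtain ⟨mv, hmv⟩ := lmate_succ hm
  refine ⟨mv, _, fun q hq => ?_, hr, hmv⟩
  have := eatenK_supp t q hq
  omega

include T in
theorem climb_shuffle {k : ℕ} {t x : Square} (hx : N x = true) :
    (Position.play ⟨climb N R (kingAt k) t x, .white⟩ (kingAt k, kingAt (k + 1))).board =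
      climb N R (kingAt (k + 1)) t x := by
  have hne : kingAt k ≠ kingAt (k + 1) := by
    rcases kingAt_cases k with h | h <;> rw [h.1, h.2] <;> decide
  have hlow : ∀ k, kingAt k ≠ x ∧ ¬ eaten N t (kingAt k) = true := by
    intro k
    have h0 := kingAt_snd k
    have hhi := T.high
    refine ⟨?_, fun h => ?_⟩
    · have := T.le _ hx
      rintro rfl; omega
    · have := T.le _ (Tree.eaten_le h).1
      omega
  funext q
  simp only [Position.play]
  by_cases h1 : q = kingAt (k + 1)
  · rw [h1, Function.update_self, climb, if_neg (hlow k).1, if_neg (hlow k).2, climb,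
      if_neg (hlow _).1, if_neg (hlow _).2, sea, if_pos rfl, sea, if_pos rfl]
  rw [Function.update_of_ne h1]
  by_cases h2 : q = kingAt k
  · rw [h2, Function.update_self, climb, if_neg (hlow k).1, if_neg (hlow k).2, sea, if_neg hne,
      if_pos]
    rcases kingAt_cases k with h | h <;> rw [h.1] <;> simp
  · rw [Function.update_of_ne h2]
    simp only [climb, sea, if_neg h1, if_neg h2]

/-- After the moves `h`, white has only shuffled, and the black king has climbed to `x`, from where
it can climb further. -/
def Climbed (N R : Square → Bool) (o : Square) (h : List Move) (x : Square) : Prop :=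
  N x = true ∧ (after (start N R o) h).board = climb N R (kingAt (h.length / 2)) x x ∧
    ∃ d ∈ dirs, d.2 = 1 ∧ N (x + d) = true

include T in
theorem matesWithin_of_good {h : List Move} {m : Move} {t : Square} {w : Square} (hw : w.2 = 0)
    (hm : N m.2 = true) (ht : N t = true)
    (hturn : (after (start N R o) (h ++ [m])).turn = .white)
    (hb : (after (start N R o) (h ++ [m])).board = climb N R w t m.2)
    (hg : ∃ j, j < 4 ∧ ∃ mv, GoodMove j (climb N R w t m.2) m.2 mv) :
    MatesWithin (start N R o) (hunter (start N R o) shuffle) 4 (h ++ [m]) := by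
  obtain ⟨j, hj, hg⟩ := hg
  have hr : Roam N R w (climb N R w t m.2) m.2 := climb_roam hm
  have h1 := T.le _ hm
  have h2 := T.high
  obtain ⟨i, hi, hmate⟩ := matesWithin_hunter (start N R o) shuffle j (h ++ [m]) m (by simp) hturn
    (by rw [hb]; exact hr.arena) hj (fun s hs => by
      rw [hb] at hs
      rw [hr.whiteKing T hs]; omega)
    (by rw [hb]; exact climb_rayOK T hw ht (by omega) hm) (by rw [hb]; exact hg)
  exact hmate.mono (by omega)

include T in
/-- Any move of a king that has climbed to `x` either climbs further, or allows a mate. -/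
theorem hunter_next {h : List Move} {x : Square} {m : Move} (hB : Climbed N R o h x)
    (ht : (after (start N R o) h).turn = .black) (hl : Legal (after (start N R o) h) m) :
    MatesWithin (start N R o) (hunter (start N R o) shuffle) 4 (h ++ [m]) ∨
      (N m.2 = true ∧ par N m.2 = x ∧
        hunter (start N R o) shuffle (h ++ [m]) = shuffle (h ++ [m]) ∧
        Legal (after (start N R o) (h ++ [m])) (shuffle (h ++ [m])) ∧
        (after (start N R o) (h ++ [m])).board (shuffle (h ++ [m])).1 = some (.white, .king) ∧
        Climbed N R o (h ++ [m] ++ [shuffle (h ++ [m])]) m.2) := by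
  obtain ⟨hx, hb, -⟩ := hB
  have hlen : h.length % 2 = 0 := by
    by_contra hc
    rw [turn_eq_black rfl, if_neg hc] at ht
    simp at ht
  have ht1 : (after (start N R o) (h ++ [m])).turn = .white := by rw [turn_concat, ht]; rfl
  have e : (h ++ [m]).length / 2 = h.length / 2 := by simp; omega
  set k := h.length / 2 with hk
  have hw := kingAt_snd k
  rw [Position.eta _ ht, hb] at hl
  obtain ⟨d, hd, rfl, hN, hpb, -, -⟩ := (climb_roam (R := R) hx).step T hw hl
  have hb1 : (after (start N R o) (h ++ [(x, x + d)])).board =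
      kplay (climb N R (kingAt k) x x) x (x + d) := by
    rw [after_concat, Position.eta _ ht, hb, hpb]
  have hback : x ≠ o → x + d = par N x →
      MatesWithin (start N R o) (hunter (start N R o) shuffle) 4 (h ++ [(x, x + d)]) := by
    intro hxo hpar
    rw [hpar, climb_back hx, ← hpar] at hb1
    refine matesWithin_of_good T hw hN hx ht1 hb1 ⟨3, by omega, ?_⟩
    have hd' : -d ∈ dirs := by
      rw [mem_dirs] at hd ⊢
      simp only [ne_eq, neg_eq_zero, Prod.fst_neg, Prod.snd_neg]
      exact ⟨hd.1, by omega, by omega⟩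
    have e1 : x + d + -d = x := by abel
    have h2 := congrArg Prod.snd hpar
    rw [par_snd, Prod.snd_add] at h2
    refine goodMove_of_mate (t := -d) (by omega) ?_
      (T.mate_back hN hd' (by rw [Prod.snd_neg]; omega) (by rw [e1]; exact hx))
    have := climb_realizes (R := R) (d := -d) T hw hN
    rwa [e1] at this
  rcases T.node_step hx hN hd with ⟨hd2, hpar⟩ | ⟨h1, h2⟩
  swap
  · exact .inl (hback h1 h2)
  rw [climb_up T hx hd hd2 hN] at hb1
  by_cases hg : ∃ j, j < 4 ∧ ∃ mv, GoodMove j (climb N R (kingAt k) (x + d) (x + d)) (x + d) mv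
  · exact .inl (matesWithin_of_good T hw hN hN ht1 hb1 hg)
  right
  have hτ : hunter (start N R o) shuffle (h ++ [(x, x + d)]) = shuffle (h ++ [(x, x + d)]) := by
    have hl : (h ++ [(x, x + d)]).getLast? = some (x, x + d) := by simp
    simp only [hunter, hl, hb1, pick_eq_none hg]
  have hsh : shuffle (h ++ [(x, x + d)]) = (kingAt k, kingAt (k + 1)) := by rw [shuffle, e]
  obtain ⟨hleg, hking, -, -⟩ := (climb_roam (R := R) (t := x + d) (w := kingAt k) hN).shuffle_legal T
  refine ⟨hN, hpar, hτ, ?_, ?_, hN, ?_, ?_⟩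
  · rw [hsh, Position.eta _ ht1, hb1]; exact hleg
  · rw [hsh, hb1]; exact hking
  · rw [after_concat, Position.eta _ ht1, hb1, hsh, climb_shuffle T hN]
    congr 2
    simp only [List.length_append, List.length_singleton] at e ⊢
    omega
  · by_contra hcon
    push Not at hcon
    refine hg ⟨0, by omega, goodMove_of_mate (t := 0) (by omega) ?_
      (T.mate_leaf hN fun d' hd' hc => ?_)⟩
    · have := climb_realizes (R := R) (d := 0) T hw hN
      rwa [add_zero] at this
    · exact hcon d' hd' hc.1 hc.2

include T in
theorem hunter_guide (hch : ∃ d ∈ dirs, d.2 = 1 ∧ N (o + d) = true) :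
    Guide N o (start N R o) (hunter (start N R o) shuffle) 4 (Climbed N R o) where
  turn := rfl
  init := ⟨T.node_root, rfl, hch⟩
  live h x hB ht := by
    obtain ⟨hx, hb, d, hd, hd2, hd3⟩ := hB
    rw [Position.eta _ ht, hb]
    exact ⟨_, climb_step_safe T (kingAt_snd _) hx hd hd2 hd3⟩
  next h x m hB ht hl := by
    rcases hunter_next T hB ht hl with h1 | ⟨h1, h2, h3, h4, -, h5⟩
    · exact .inl h1
    · rw [h3]; exact .inr ⟨h1, h2, h4, h5⟩

include T in
theorem hunter_shuffles (hch : ∃ d ∈ dirs, d.2 = 1 ∧ N (o + d) = true) :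
    ShufflesUntilMateIn (start N R o) (hunter (start N R o) shuffle) 4 := by
  refine (hunter_guide T hch).shufflesUntilMate (a := (0, 0)) (b := (1, 0))
    fun h x hB ht m hl => ?_
  rcases hunter_next T hB ht hl with h1 | ⟨-, -, h3, -, h4, -⟩
  · exact .inl h1
  · rw [h3]
    refine .inr ⟨?_, h4⟩
    rw [shuffle]
    rcases kingAt_cases ((h ++ [m]).length / 2) with h | h <;> rw [h.1, h.2] <;> simp

/-! ### White gives check with every move -/

/-- White pushes the pawn below the square that the black king has just left. -/
def push : Strategy := fun h =>
  match h.getLast? with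
  | none => ((0, 0), (0, 0))
  | some m => (m.1 - (0, 1), m.1)

/-- The board when the black king has climbed to `x` and white has answered each step with `push`. -/
def plug (N R : Square → Bool) (w x : Square) : Board := fun q =>
  if q = x then some (.black, .king)
  else if eaten N x q then some (.white, .pawn)
  else if q + (0, 1) ≠ x ∧ eaten N x (q + (0, 1)) = true then none
  else sea N R w q

theorem plug_arena (w x : Square) : Arena (plug N R w x) x where
  king := by simp [plug]
  only s k hs := by
    by_contra hsx
    unfold plug at hs
    rw [if_neg hsx] at hs
    split_ifs at hs
    · simp at hs
    · simpa using sea_white hs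

include T in
theorem plug_whiteKing {w x s : Square} (h : plug N R w x s = some (.white, .king)) : s = w := by
  unfold plug at h
  split_ifs at h
  · simp at h
  · simp at h
  · exact sea_king T h

include T in
theorem plug_realizes {w x : Square} (hw : w.2 = 0) (hx : N x = true) :
    Realizes (plug N R w x) x (pluggedK (fun q => N (x + q)) (fun q => R (x + q))) := by
  intro q c hq
  unfold pluggedK at hq
  have h0 : ∀ q : Square, eaten (fun q => N (x + q)) 0 q = eaten N x (x + q) := fun q => by
    rw [eaten_shift, add_zero]
  simp only [h0] at hq
  have hne : ∀ q : Square, x + q = x ↔ q = 0 := fun q => add_eq_left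
  split_ifs at hq with h1 h2 h3
  all_goals simp only [Bool.or_eq_true, beq_iff_eq, not_or, Bool.not_eq_true',
    Bool.not_eq_false] at h1
  · simp only [Option.some.injEq] at hq; subst hq
    rw [plug, if_neg (by rw [hne]; exact h1.1), if_pos h2]; rfl
  · simp only [Option.some.injEq] at hq; subst hq
    simp only [bne_iff_ne, ne_eq, Bool.and_eq_true] at h3
    rw [plug, if_neg (by rw [hne]; exact h1.1), if_neg h2, if_pos]
    · rfl
    · rw [add_assoc]; exact ⟨by rw [ne_eq, hne]; exact h3.1, h3.2⟩
  · simp only [bne_iff_ne, ne_eq, Bool.and_eq_true] at h3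
    have h4 := near_iff.1 h1.2
    have := T.le _ hx
    have := T.high
    rw [cellOf_shift, Option.some.injEq] at hq
    rw [plug, if_neg (by rw [hne]; exact h1.1), if_neg h2, if_neg,
      sea_high hw (by simp only [Prod.snd_add]; omega), hq]
    rw [add_assoc, ne_eq, hne]; exact h3

include T in
theorem plug_root (w : Square) : plug N R w o = climb N R w o o := by
  funext q
  unfold plug climb
  by_cases h1 : q = o
  · rw [if_pos h1, if_pos h1]
  · rw [if_neg h1, if_neg h1, if_neg (fun h => h1 (T.eaten_root h)), if_neg,
      if_neg (fun h => h1 (T.eaten_root h))]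
    rintro ⟨h2, h3⟩
    exact h2 (T.eaten_root h3)

include T in
/-- The plugged way leaves only steps up to the king. -/
theorem plug_step {w x : Square} (hw : w.2 = 0) (hx : N x = true) {m : Move}
    (hl : Legal ⟨plug N R w x, .black⟩ m) :
    ∃ d ∈ dirs, d.2 = 1 ∧ m = (x, x + d) ∧ N (x + d) = true ∧ par N (x + d) = x := by
  have hd : ∃ d ∈ dirs, d.2 = 1 ∧ m = (x, x + d) ∧ N (x + d) = true := by
    by_cases hxo : x = o
    · subst hxo
      rw [plug_root T] at hl
      obtain ⟨d, hd, rfl, hN, -⟩ := (climb_roam hx).step T hw hl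
      refine ⟨d, hd, ?_, rfl, hN⟩
      rcases T.node_step hx hN hd with h | h
      · exact h.1
      · exact absurd rfl h.1
    · obtain ⟨d, hd, rfl, hna⟩ := (plug_arena w x).legal_black hl
      by_contra hcon
      have hcon' : ¬ (d.2 = 1 ∧ N (x + d) = true) := fun h => hcon ⟨d, hd, h.1, rfl, h.2⟩
      refine hna (attacked_sound (x := x) ?_ (T.plugged_facts hx hxo hd hcon'))
      have h1 := (plug_realizes (R := R) T hw hx).upd 0 none
      rw [add_zero] at h1
      exact h1.upd_none d (some (.black, .king))
  obtain ⟨d, hd, hd2, rfl, hN⟩ := hd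
  exact ⟨d, hd, hd2, rfl, hN, T.par_eq hx hN hd hd2⟩

include T in
/-- After a step of the king, the next push is legal and plugs the square that the king has left. -/
theorem plug_push {w x d : Square} (hw : w.2 = 0) (hx : N x = true) (hd : d ∈ dirs) (hd2 : d.2 = 1)
    (hN : N (x + d) = true) :
    Legal ⟨kplay (plug N R w x) x (x + d), .white⟩ (x - (0, 1), x) ∧
      (Position.play ⟨kplay (plug N R w x) x (x + d), .white⟩ (x - (0, 1), x)).board =
        plug N R w (x + d) := by
  have hpar := T.par_eq hx hN hd hd2
  have hx1 := T.le _ hx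
  have hhi := T.high
  have hnd : x ≠ x + d := by
    intro e; have := congrArg Prod.snd e; rw [Prod.snd_add] at this; omega
  have hn1 : x - (0, 1) ≠ x := by
    intro e; have := congrArg Prod.snd e; simp at this
  have hn2 : x - (0, 1) ≠ x + d := by
    intro e; have := congrArg Prod.snd e; simp at this; omega
  have hsub : x - (0, 1) = x + (0, -1) := by ext <;> simp; ring
  have hcan : x - (0, 1) + (0, 1) = x := sub_add_cancel _ _
  have hnode : N (x - (0, 1)) = false := by rw [hsub]; exact (T.pred_facts hx).2.2.2.2.1
  have hlow : ∀ y, ¬ eaten N y (x - (0, 1)) = true := by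
    intro y h; rw [(Tree.eaten_le h).1] at hnode; simp at hnode
  have hpawn : kplay (plug N R w x) x (x + d) (x - (0, 1)) = some (.white, .pawn) := by
    rw [kplay, Function.update_of_ne hn2, Function.update_of_ne hn1, plug, if_neg hn1,
      if_neg (hlow _), if_neg (by rw [hcan]; simp), sea_high hw, hsub, T.below_pawn hx]
    · rfl
    · simp; omega
  have hempty : kplay (plug N R w x) x (x + d) x = none := by
    rw [kplay, Function.update_of_ne hnd, Function.update_self]
  have hboard : (Position.play ⟨kplay (plug N R w x) x (x + d), .white⟩ (x - (0, 1), x)).board =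
        plug N R w (x + d) := by
    funext q
    simp only [Position.play, hpawn]
    by_cases h1 : q = x
    · rw [h1, Function.update_self, plug, if_neg hnd, if_pos]
      rw [Tree.eaten_iff hN, hpar]; exact .inr (Tree.eaten_self hx)
    rw [Function.update_of_ne h1]
    by_cases h2 : q = x - (0, 1)
    · rw [h2, Function.update_self, plug, if_neg hn2, if_neg (hlow _), if_pos]
      rw [hcan, Tree.eaten_iff hN, hpar]
      exact ⟨hnd, .inr (Tree.eaten_self hx)⟩
    rw [Function.update_of_ne h2, kplay]
    by_cases h3 : q = x + d
    · rw [h3, Function.update_self, plug, if_pos rfl]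
    rw [Function.update_of_ne h3, Function.update_of_ne h1, plug, plug, if_neg h1, if_neg h3]
    have e1 : eaten N (x + d) q = eaten N x q := by
      rw [Bool.eq_iff_iff, Tree.eaten_iff hN, hpar]
      tauto
    have e2 : (q + (0, 1) ≠ x + d ∧ eaten N (x + d) (q + (0, 1)) = true) ↔
        (q + (0, 1) ≠ x ∧ eaten N x (q + (0, 1)) = true) := by
      rw [Tree.eaten_iff hN, hpar]
      have h4 : q + (0, 1) ≠ x := fun e => h2 (eq_sub_of_add_eq e)
      have h5 : eaten N x (q + (0, 1)) = true → q + (0, 1) ≠ x + d := by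
        intro h e
        have := (Tree.eaten_le h).2
        rw [e, Prod.snd_add] at this; omega
      tauto
    rw [e1]
    simp only [e2]
  refine ⟨⟨⟨.pawn, hpawn, fun k' => by simp [hempty], ?_⟩, ?_⟩, hboard⟩
  · rw [if_pos rfl]
    exact .inl ⟨(sub_add_cancel _ _).symm, hempty⟩
  · rw [hboard]
    refine (plug_arena w (x + d)).not_inCheck_white fun s hs => ?_
    rw [plug_whiteKing T hs, Prod.snd_add]; omega

include T in
theorem plug_check {w x d : Square} (hx : N x = true) (hd : d ∈ dirs) (hd2 : d.2 = 1)
    (hN : N (x + d) = true) : InCheck (plug N R w (x + d)) .black := by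
  have hnd : x ≠ x + d := by
    intro e; have := congrArg Prod.snd e; rw [Prod.snd_add] at this; omega
  have hd1 : d.1 ≠ 0 := by
    intro h0
    have : d = (0, 1) := Prod.ext h0 hd2
    rw [this, (T.pred_facts hx).2.2.2.1] at hN; simp at hN
  have hp : plug N R w (x + d) x = some (.white, .pawn) := by
    rw [plug, if_neg hnd, if_pos]
    rw [Tree.eaten_iff hN, T.par_eq hx hN hd hd2]; exact .inr (Tree.eaten_self hx)
  refine (plug_arena w _).inCheck_iff.2 ⟨x, .pawn, hp, ?_⟩
  rw [mem_dirs] at hd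
  unfold Attacks
  rw [hp]
  simp only [Prod.fst_add, Prod.snd_add, Color.forward, add_sub_cancel_left]
  omega

/-- After the moves `h`, white has only pushed pawns, the black king has been driven to `x`, and it
is in check unless it has not moved yet; it can move. -/
def Driven (N R : Square → Bool) (o : Square) (h : List Move) (x : Square) : Prop :=
  N x = true ∧ (after (start N R o) h).board = plug N R (0, 0) x ∧
    (h ≠ [] → InCheck (plug N R (0, 0) x) .black) ∧ ∃ m, Legal ⟨plug N R (0, 0) x, .black⟩ m

include T in
theorem push_guide (hch : ∃ d ∈ dirs, d.2 = 1 ∧ N (o + d) = true) :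
    Guide N o (start N R o) push 1 (Driven N R o) where
  turn := rfl
  init := by
    refine ⟨T.node_root, (plug_root T _).symm, fun h => absurd rfl h, ?_⟩
    obtain ⟨d, hd, hd2, hd3⟩ := hch
    rw [plug_root T]
    exact ⟨_, climb_step_safe T rfl T.node_root hd hd2 hd3⟩
  live h x hB ht := by
    rw [Position.eta _ ht, hB.2.1]; exact hB.2.2.2
  next h x m hB ht hl := by
    obtain ⟨hx, hb, -, -⟩ := hB
    rw [Position.eta _ ht, hb] at hl
    obtain ⟨d, hd, hd2, rfl, hN, hpar⟩ := plug_step T rfl hx hl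
    have ht1 : (after (start N R o) (h ++ [(x, x + d)])).turn = .white := by
      rw [turn_concat, ht]; rfl
    have hb1 : (after (start N R o) (h ++ [(x, x + d)])).board =
        kplay (plug N R (0, 0) x) x (x + d) := by
      rw [after_concat, Position.eta _ ht, hb, (plug_arena _ _).play_eq]
    have hτ : push (h ++ [(x, x + d)]) = (x - (0, 1), x) := by
      simp [push]
    obtain ⟨hleg, hboard⟩ := plug_push (R := R) (w := (0, 0)) T rfl hx hd hd2 hN
    have hleg' : Legal (after (start N R o) (h ++ [(x, x + d)])) (push (h ++ [(x, x + d)])) := by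
      rw [Position.eta _ ht1, hb1, hτ]; exact hleg
    have hb2 : (after (start N R o) (h ++ [(x, x + d)] ++ [push (h ++ [(x, x + d)])])).board =
        plug N R (0, 0) (x + d) := by
      rw [after_concat, Position.eta _ ht1, hb1, hτ, hboard]
    have ht2 : (after (start N R o) (h ++ [(x, x + d)] ++ [push (h ++ [(x, x + d)])])).turn =
        .black := by rw [turn_concat, ht1]; rfl
    have hchk := plug_check (R := R) (w := (0, 0)) T hx hd hd2 hN
    by_cases hex : ∃ m, Legal ⟨plug N R (0, 0) (x + d), .black⟩ m
    · exact .inr ⟨hN, hpar, hleg', hN, hb2, fun _ => hchk, hex⟩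
    · left
      refine ⟨hleg', .inl ⟨?_, ?_⟩⟩
      · rw [ht2, hb2]; exact hchk
      · rw [Position.eta _ ht2, hb2]
        push Not at hex
        exact hex

include T in
theorem push_checks (hch : ∃ d ∈ dirs, d.2 = 1 ∧ N (o + d) = true) :
    AlwaysChecks (start N R o) push :=
  alwaysChecks_of_guide (push_guide T hch) fun h x hB hh _ => by
    rw [hB.2.1]; exact hB.2.2.1 hh

end strategies

/-! ### The pieces near the tree lock each other -/

/-- The parent of a node with a knight has no other child. -/
def Place.chkKnight (st : Place) : Bool :=
  st.cell 0 != some .knight || !isVertex st.node (par st.node 0)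

theorem places_chkKnight : (places.all fun st => st.chkKnight) = true := by decide +kernel

namespace Tree
variable {N R : Square → Bool} {o : Square} (T : Tree N R o)
include T

theorem loose_below {p : Square} (hp : N p = true) {d : Square}
    (hd : d = (0, -1) ∨ d = (1, -1) ∨ d = (-1, -1)) (hq : N (p + d) = false) :
    loose N R (p + d) = false := by
  obtain ⟨st, hst, hN, hR⟩ := T.place hp
  have h := (chk_of_mem hst).2.2.2.2.1
  have hn : near 10 d = true := by rcases hd with rfl | rfl | rfl <;> decide
  have hn' : near 15 d = true := by rcases hd with rfl | rfl | rfl <;> decide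
  rw [Place.chkLoose, List.all_eq_true] at h
  have h := h d (by simp only [List.mem_cons, List.not_mem_nil, or_false]; tauto)
  rw [show st.node d = N (p + d) from (hN _ hn').symm, hq, ← loose_congr hN hR hn, loose_shift] at h
  simp only [Bool.false_or, Bool.and_eq_true, Bool.not_eq_true'] at h
  exact h.1

/-- Other pieces than pawns stand near nodes. -/
theorem special {s : Square} {k : PieceKind} (hs : cellOf N R s = some k) (hk : k ≠ .pawn) :
    ∃ p, N p = true ∧ ∃ q ∈ specials, s = p + q := by
  have hR : ∀ q, R q = true → N q = true := fun q hq => by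
    rw [(T.root_iff q).1 hq]; exact T.node_root
  have hv : ∀ q, isVertex N q = true → N q = true := fun q hq => by
    simp only [isVertex, Bool.and_eq_true] at hq; exact hq.1.1
  have key : ∀ d, N (s + d) = true → -d ∈ specials →
      ∃ p, N p = true ∧ ∃ q ∈ specials, s = p + q := fun d h1 h2 => ⟨s + d, h1, -d, h2, by abel⟩
  have key0 : N s = true → ∃ p, N p = true ∧ ∃ q ∈ specials, s = p + q := fun h =>
    ⟨s, h, 0, by decide, by simp⟩
  unfold cellOf at hs
  split_ifs at hs with h1 h2 h3 h4 h5 h6 h7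
  · simp only [Bool.or_eq_true] at h2
    rcases h2 with (h | h) | h
    · exact key _ (hR _ h) (by decide)
    · exact key _ (hR _ h) (by decide)
    · exact key _ (hR _ h) (by decide)
  · simp only [Bool.or_eq_true, Bool.and_eq_true] at h3
    rcases h3 with h | h
    · exact key _ h.1 (by decide)
    · exact key _ h.1 (by decide)
  · exact key _ (hv _ h4) (by decide)
  · exact key _ (hv _ h5) (by decide)
  · simp only [Bool.or_eq_true] at h6
    rcases h6 with h | h
    · exact key _ (hv _ h) (by decide)
    · exact key _ (hv _ h) (by decide)
  · simp only [Bool.or_eq_true, Bool.and_eq_true] at h7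
    rcases h7 with (h | h) | h
    · exact key0 (hv _ h)
    · exact key0 h.1.1.1.1
    · exact key0 h.1.1.1
  · simp at hs; exact absurd hs.symm hk

omit T in
theorem steps_near {k : PieceKind} {d : Square} (hd : d ∈ steps k) : near 2 d = true := by
  rw [near_iff]
  by_cases hk : k = .knight
  · subst hk
    have := mem_kdirs.1 hd; omega
  · have : d ∈ dirs := by
      cases k <;> first | exact absurd rfl hk | exact (List.mem_filter.1 hd).1
    rw [mem_dirs] at this; omega

/-- Other pieces than pawns are locked in by their surroundings. -/
theorem rigid {s : Square} {k : PieceKind} (hs : cellOf N R s = some k) (hk : k ≠ .pawn) :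
    (∀ d ∈ steps k, N (s + d) = false ∧
      ¬ (loose N R (s + d) = true ∧ (d.2 = -1 ∨ loose N R s = false)) ∧
      ((d.2 = -2 ∨ (d.2 = -1 ∧ loose N R s = false)) → cellOf N R (s + d) = some .pawn ∧
        loose N R (s + d + (0, 1)) = false ∧ (N (s + d + (0, 1)) = false ∨
          (N s = true ∧ par N s = s + d + (0, 1))))) ∧
    (loose N R s = true → N (s + (1, 2)) = false ∧ N (s + (-1, 2)) = false) := by
  obtain ⟨p, hp, q, hq, rfl⟩ := T.special hs hk
  obtain ⟨st, hst, hN, hR⟩ := T.place hp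
  have h := (chk_of_mem hst).2.2.2.2.2
  have hq4 : near 4 q = true := (by decide : ∀ q ∈ specials, near 4 q = true) q hq
  rw [Place.chkRigid, List.all_eq_true] at h
  have h := h q hq
  rw [near_iff] at hq4
  have hn : ∀ d : Square, near 3 d = true → near 10 (q + d) = true := fun d hd => by
    rw [near_iff] at hd ⊢; simp only [Prod.fst_add, Prod.snd_add]; omega
  have hnode : ∀ d : Square, near 3 d = true → st.node (q + d) = N (p + q + d) := fun d hd => by
    rw [add_assoc, ← hN]
    have := hn d hd
    rw [near_iff] at this ⊢; omega
  have hcell : ∀ d : Square, near 3 d = true → st.cell (q + d) = cellOf N R (p + q + d) :=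
    fun d hd => by rw [add_assoc, Place.cell, ← cellOf_congr hN hR (hn d hd), cellOf_shift]
  have hloose : ∀ d : Square, near 3 d = true →
      loose st.node st.root (q + d) = loose N R (p + q + d) :=
    fun d hd => by rw [add_assoc, ← loose_congr hN hR (hn d hd), loose_shift]
  have hc0 := hcell 0 (by decide)
  have hl0 := hloose 0 (by decide)
  have hn0 := hnode 0 (by decide)
  simp only [add_zero] at hc0 hl0 hn0
  have hpar : ∀ u, (par st.node q = u) ↔ par N (p + q) = p + u := fun u => by
    rw [← par_shift, ← par_congr hN (by rw [near_iff]; omega), add_right_inj]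
  rw [hc0, hs] at h
  have h' : ((steps k).all (fun d => !st.node (q + d) && !(loose st.node st.root (q + d) &&
        (d.2 == -1 || !loose st.node st.root q)) &&
        (!(d.2 == -2 || (d.2 == -1 && !loose st.node st.root q)) || (st.cell (q + d) == some .pawn &&
          !loose st.node st.root (q + d + (0, 1)) && (!st.node (q + d + (0, 1)) ||
            (st.node q && par st.node q == q + d + (0, 1)))))) &&
      (!loose st.node st.root q || (!st.node (q + (1, 2)) && !st.node (q + (-1, 2))))) = true := by
    cases k <;> first | exact absurd rfl hk | exact h
  clear h
  rw [Bool.and_eq_true, List.all_eq_true] at h'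
  obtain ⟨h1, h2⟩ := h'
  rw [hl0, hnode (1, 2) (by decide), hnode (-1, 2) (by decide)] at h2
  refine ⟨fun d hd => ?_, fun hl => ?_⟩
  · have hd2 := steps_near hd
    have hd3 : near 3 d = true := by rw [near_iff] at hd2 ⊢; omega
    have hd4 : near 3 (d + (0, 1)) = true := by
      rw [near_iff] at hd2 ⊢; simp only [Prod.fst_add, Prod.snd_add]; omega
    have h := h1 d hd
    rw [add_assoc q d, hnode d hd3, hloose d hd3, hcell d hd3, hnode _ hd4, hloose _ hd4, hl0, hn0,
      ← add_assoc (p + q) d] at h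
    simp only [Bool.and_eq_true, Bool.not_eq_true', Bool.or_eq_true, Bool.and_eq_false_iff,
      Bool.or_eq_false_iff, beq_iff_eq, beq_eq_false_iff_ne, hpar,
      Bool.not_eq_false'] at h
    have e : p + (q + (d + (0, 1))) = p + q + d + (0, 1) := by abel
    rw [e] at h
    obtain ⟨⟨h3, h4⟩, h5⟩ := h
    refine ⟨h3, ?_, fun h6 => ?_⟩
    · rintro ⟨h6, h7⟩
      rcases h4 with h4 | ⟨h4, h8⟩
      · rw [h6] at h4; simp at h4
      · rcases h7 with h7 | h7
        · exact h4 h7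
        · rw [h7] at h8; simp at h8
    · rcases h5 with ⟨h5, h7⟩ | h5
      · exfalso
        rcases h6 with h6 | ⟨h6, h8⟩
        · exact h5 h6
        · rcases h7 with h7 | h7
          · exact h7 h6
          · rw [h8] at h7; simp at h7
      · exact ⟨h5.1.1, h5.1.2, h5.2⟩
  · rw [hl] at h2
    simpa using h2

theorem knight_parent {s : Square} (hs : cellOf N R s = some .knight) :
    isVertex N (par N s) = false := by
  have hp := cellOf_knight hs
  obtain ⟨st, hst, hN, hR⟩ := T.place hp
  have h := List.all_eq_true.1 places_chkKnight st hst
  have hc : cellOf N R s = st.cell 0 := by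
    rw [Place.cell, ← cellOf_congr hN hR (by decide), cellOf_shift, add_zero]
  have h1 : near 14 (par st.node 0) = true := by
    have h1 := par_snd st.node 0
    have h2 := par_fst st.node 0
    simp only [Prod.fst_zero, Prod.snd_zero] at h1 h2
    rw [near_iff]; omega
  have h2 : isVertex st.node (par st.node 0) = isVertex N (par N s) := by
    rw [← isVertex_congr hN h1, isVertex_shift, ← par_congr hN (by decide), par_shift, add_zero]
  rw [Place.chkKnight, ← hc, hs, h2] at h
  simpa using h

/-- A node on the way to `t`, other than `t`, is continued by a node on the way to `t`. -/
theorem eaten_child {t q : Square} (h : eaten N t q = true) (hq : q ≠ t) (ht : N t = true) :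
    ∃ c, eaten N t c = true ∧ par N c = q := by
  have key : ∀ (n : ℕ) (t : Square), N t = true → eaten N t q = true → q ≠ t → t.2 < o.2 + n →
      ∃ c, eaten N t c = true ∧ par N c = q := by
    intro n
    induction n with
    | zero => intro t ht _ _ hn; have := T.le t ht; push_cast at hn; omega
    | succ n ih =>
      intro t ht h hq hn
      rcases (Tree.eaten_iff ht).1 h with h1 | h1
      · exact absurd h1 hq
      by_cases hto : t = o
      · rw [hto] at h; exact absurd (T.eaten_root h) (hto ▸ hq)
      by_cases hqp : q = par N t
      · exact ⟨t, Tree.eaten_self ht, hqp.symm⟩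
      · obtain ⟨c, hc, hc2⟩ := ih _ (T.node_par ht hto) h1 hqp (by
          rw [par_snd]; push_cast at hn; omega)
        exact ⟨c, (Tree.eaten_iff ht).2 (.inr hc), hc2⟩
  exact key (t.2 - o.2 + 1).toNat t ht h hq (by have := T.le t ht; omega)

end Tree

/-! ### White cannot follow the king -/

/-- What white cannot change above the rank `l`: the black king has climbed to `x`; the nodes on the
way to it are empty above `l`, except that a knight may have jumped to the lowest of them, and the
one on the rank `l` (if there is one) is plugged by a pawn; the other squares from the rank `l` on
are unchanged, except for the loose ones on the rank `l`; some pawns just below hold these pieces. -/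
structure Sealed (N R : Square → Bool) (o : Square) (b : Board) (x : Square) (l : ℤ) : Prop where
  node : N x = true
  arena : Arena b x
  base : o.2 - 1 ≤ l
  lt : l < x.2
  path : ∀ q, eaten N x q = true → q ≠ x → l + 1 < q.2 → b q = none
  entry : ∀ q, eaten N x q = true → q ≠ x → q.2 = l + 1 → b q = none ∨ b q = some (.white, .knight)
  plug : ∀ q, eaten N x q = true → q.2 = l → b q = some (.white, .pawn)
  rest : ∀ q, eaten N x q = false → l ≤ q.2 → ¬ (q.2 = l ∧ loose N R q = true) →
    b q = (cellOf N R q).map (Prod.mk .white)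
  low : ∀ q, q.2 = l - 1 → eaten N x q = false → cellOf N R q = some .pawn →
    loose N R (q + (0, 1)) = false → eaten N x (q + (0, 1)) = false → b q = some (.white, .pawn)
  whiteKing : ∀ s, b s = some (.white, .king) → s.2 ≤ l

namespace Sealed
variable {N R : Square → Bool} {o x : Square} {b : Board} {l : ℤ} (T : Tree N R o)

theorem cellOf_of_loose {q : Square} (h : loose N R q = true) :
    ∃ k, cellOf N R q = some k ∧ k ≠ .pawn := by
  simp only [loose, Bool.or_eq_true, beq_iff_eq, Bool.and_eq_true] at h
  rcases h with ((h | h) | h) | h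
  · exact ⟨_, h, by simp⟩
  · exact ⟨_, h, by simp⟩
  · exact ⟨_, h, by simp⟩
  · exact ⟨_, h.1, by simp⟩

theorem loose_of_knight {q : Square} (h : cellOf N R q = some .knight) : loose N R q = true := by
  simp [loose, h]

include T in
theorem init : Sealed N R o (start N R o).board o (o.2 - 1) := by
  have hr : Roam N R (0, 0) (start N R o).board o := climb_roam T.node_root
  have hhi := T.high
  have hb : ∀ q : Square, q ≠ o → 0 < q.2 →
      (start N R o).board q = (cellOf N R q).map (Prod.mk .white) := by
    intro q hq h2
    show climb N R (0, 0) o o q = _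
    rw [climb, if_neg hq, if_neg (fun h => hq (T.eaten_root h)), sea_high rfl h2]
  have he : eaten N o o = true := Tree.eaten_self T.node_root
  refine ⟨T.node_root, hr.arena, le_rfl, by omega, fun q h1 h2 _ => absurd (T.eaten_root h1) h2,
    fun q h1 h2 _ => absurd (T.eaten_root h1) h2, fun q h1 h2 => ?_, fun q h1 h2 _ => ?_,
    fun q h1 h2 h3 _ _ => ?_, fun s hs => ?_⟩
  · rw [T.eaten_root h1] at h2; omega
  · exact hb q (by rintro rfl; rw [he] at h1; simp at h1) (by omega)
  · rw [hb q (by rintro rfl; rw [he] at h2; simp at h2) (by omega), h3]; rfl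
  · rw [hr.whiteKing T hs]; simp; omega

include T in
/-- Above the rank `l`, the only empty squares are nodes on the way to the king. -/
theorem empty_eaten (h : Sealed N R o b x l) {q : Square} (hq : l ≤ q.2)
    (hm : ¬ (q.2 = l ∧ loose N R q = true ∧ eaten N x q = false)) (hb : b q = none) :
    eaten N x q = true ∧ q ≠ x ∧ l + 1 ≤ q.2 := by
  have he : eaten N x q = true := by
    by_contra hc
    rw [Bool.not_eq_true] at hc
    have h1 := h.rest q hc hq (fun h2 => hm ⟨h2.1, h2.2, hc⟩)
    have hqo : q ≠ o := by
      rintro rfl; rw [eaten_base T h.node] at hc; simp at hc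
    obtain ⟨k, hk, -⟩ := T.cell_ne_none hqo
    rw [hb, hk] at h1; simp at h1
  refine ⟨he, ?_, ?_⟩
  · rintro rfl; rw [h.arena.king] at hb; simp at hb
  · by_contra hc
    have h1 := h.plug q he (by omega)
    rw [hb] at h1; simp at h1

include T in
/-- The black king can climb on. -/
theorem step (h : Sealed N R o b x l) {d : Square} (hd : d ∈ dirs) (hd2 : d.2 = 1)
    (hc : N (x + d) = true) :
    Legal ⟨b, .black⟩ (x, x + d) ∧ Sealed N R o (kplay b x (x + d)) (x + d) l ∧
      ¬ WhiteAttacks (kplay b x (x + d)) (x + d) := by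
  have hpar := T.par_eq h.node hc hd hd2
  have hx2 : (x + d).2 = x.2 + 1 := by rw [Prod.snd_add, hd2]
  have hnx : x ≠ x + d := by intro e; rw [← e] at hx2; omega
  have hlt := h.lt
  have heat : ∀ q, eaten N (x + d) q = true ↔ q = x + d ∨ eaten N x q = true := fun q => by
    rw [Tree.eaten_iff hc, hpar]
  have hnot : ∀ q, eaten N (x + d) q = false → q ≠ x + d ∧ q ≠ x ∧ eaten N x q = false := by
    intro q hq
    have h1 := heat q
    rw [hq] at h1
    simp only [Bool.false_eq_true, false_iff, not_or, Bool.not_eq_true] at h1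
    refine ⟨h1.1, ?_, h1.2⟩
    rintro rfl; rw [Tree.eaten_self h.node] at h1; simp at h1
  have hbx : kplay b x (x + d) x = none := by
    rw [kplay, Function.update_of_ne hnx, Function.update_self]
  have hbo : ∀ q, q ≠ x → q ≠ x + d → kplay b x (x + d) q = b q := fun q h1 h2 => by
    rw [kplay, Function.update_of_ne h2, Function.update_of_ne h1]
  have S : Sealed N R o (kplay b x (x + d)) (x + d) l := by
    refine ⟨hc, h.arena.kplay, h.base, by omega, fun q h1 h2 h3 => ?_, fun q h1 h2 h3 => ?_,
      fun q h1 h2 => ?_, fun q h1 h2 h3 => ?_, fun q h1 h2 h3 h4 h5 => ?_, fun s hs => ?_⟩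
    · have h1 := ((heat q).1 h1).resolve_left h2
      by_cases hqx : q = x
      · rw [hqx, hbx]
      · rw [hbo q hqx h2]; exact h.path q h1 hqx h3
    · have h1 := ((heat q).1 h1).resolve_left h2
      by_cases hqx : q = x
      · rw [hqx, hbx]; exact .inl rfl
      · rw [hbo q hqx h2]; exact h.entry q h1 hqx h3
    · have h3 : q ≠ x + d := by rintro rfl; omega
      have h4 : q ≠ x := by rintro rfl; omega
      rw [hbo q h4 h3]
      exact h.plug q (((heat q).1 h1).resolve_left h3) h2
    · obtain ⟨h4, h5, h6⟩ := hnot q h1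
      rw [hbo q h5 h4]; exact h.rest q h6 h2 h3
    · obtain ⟨h6, h7, h8⟩ := hnot q h2
      rw [hbo q h7 h6]; exact h.low q h1 h8 h3 h4 (hnot _ h5).2.2
    · by_cases h1 : s = x + d
      · rw [h1, h.arena.kplay.king] at hs; simp at hs
      · by_cases h2 : s = x
        · rw [h2, hbx] at hs; simp at hs
        · rw [hbo s h2 h1] at hs; exact h.whiteKing s hs
  have hd1 : d.1 ≠ 0 := by
    intro h0
    have : d = (0, 1) := Prod.ext h0 hd2
    rw [this, (T.pred_facts h.node).2.2.2.1] at hc; simp at hc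
  have hsafe : ¬ WhiteAttacks (kplay b x (x + d)) (x + d) := by
    refine T.step_safe h.node hd hd2 hc hbx ?_ ?_ ?_ ?_
    · refine shielded_of_nodes T (P := fun q => eaten N (x + d) q = true ∧ q.2 ≤ x.2 ∧
        l + 1 ≤ q.2) ?_ ⟨(heat x).2 (.inr (Tree.eaten_self h.node)), le_rfl, by omega⟩ ?_
        (by simp [hd2]) (by simpa using hd1)
      · rintro q ⟨hq, hqx, hql⟩
        have hN := (Tree.eaten_le hq).1
        refine ⟨hN, fun e he he2 he1 => ?_⟩
        have hrow : (q + e).2 = q.2 - 1 := by rw [Prod.snd_add, he2]; ring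
        have hne : q + e ≠ x + d := by intro e'; rw [e'] at hrow; omega
        by_cases hn : N (q + e) = true
        · rcases T.node_step hN hn he with h1 | h1
          · omega
          have h3 := T.eaten_par hq h1.1
          rw [← h1.2] at h3
          rcases lt_trichotomy (q + e).2 (l + 1) with h4 | h4 | h4
          · exact .inl ⟨.pawn, S.plug _ h3 (by omega), rfl⟩
          · rcases S.entry _ h3 hne h4 with h5 | h5
            · exact .inr ⟨h5, h3, by omega, by omega⟩
            · exact .inl ⟨.knight, h5, rfl⟩
          · exact .inr ⟨S.path _ h3 hne h4, h3, by omega, by omega⟩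
        · rw [Bool.not_eq_true] at hn
          obtain ⟨k, h1, h2, -⟩ := T.step_facts hN he hn
          refine .inl ⟨k, ?_, h2⟩
          rw [S.rest, h1]
          · rfl
          · by_contra hc2
            rw [Bool.not_eq_false] at hc2
            rw [(Tree.eaten_le hc2).1] at hn; simp at hn
          · omega
          · rintro ⟨-, h4⟩
            rw [T.loose_below hN ?_ hn] at h4
            · simp at h4
            · rw [mem_dirs] at he
              have : e = (1, -1) ∨ e = (-1, -1) := by
                obtain ⟨e1, e2⟩ := e
                simp only [Prod.mk.injEq] at *; omega
              tauto
      · rw [mem_dirs] at hd ⊢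
        simp only [ne_eq, neg_eq_zero, Prod.fst_neg, Prod.snd_neg]
        exact ⟨hd.1, by omega, by omega⟩
    · intro e he hne
      have hde := mem_dirs.1 he
      have hrow : (x + d + e).2 = (x + d).2 + e.2 := rfl
      have h2 : eaten N (x + d) (x + d + e) = false := by
        by_contra hcon
        rw [Bool.not_eq_false] at hcon
        rcases T.node_step hc (Tree.eaten_le hcon).1 he with h1 | h1
        · have := (Tree.eaten_le hcon).2; omega
        · rw [hpar] at h1; exact hne h1.2
      exact S.rest _ h2 (by omega) (by omega)
    · intro e he hk
      have hde := mem_kdirs.1 he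
      have hrow : (x + d + e).2 = (x + d).2 + e.2 := rfl
      set z := x + d + e with hz
      have hodd : N z = false := by
        by_contra hcon
        rw [Bool.not_eq_false] at hcon
        have h1 := T.even _ hcon
        have h2 := T.even _ hc
        rw [hz] at h1
        simp only [Prod.fst_add, Prod.snd_add, Int.even_iff] at h1 h2
        omega
      have hze : eaten N (x + d) z = false := by
        by_contra hcon
        rw [Bool.not_eq_false] at hcon
        rw [(Tree.eaten_le hcon).1] at hodd; simp at hodd
      by_cases hl : z.2 = l ∧ loose N R z = true
      · obtain ⟨k, hk1, hk2⟩ := cellOf_of_loose hl.2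
        have h3 := (T.rigid hk1 hk2).2 hl.2
        have h4 : e = (1, -2) ∨ e = (-1, -2) := by
          obtain ⟨e1, e2⟩ := e
          simp only [Prod.mk.injEq] at *; omega
        rcases h4 with rfl | rfl
        · have : z + (-1, 2) = x + d := by rw [hz, add_assoc]; exact add_zero _
          rw [this, hc] at h3; simp at h3
        · have : z + (1, 2) = x + d := by rw [hz, add_assoc]; exact add_zero _
          rw [this, hc] at h3; simp at h3
      · have := S.rest z hze (by omega) hl
        rw [hk, eq_comm, Option.map_eq_some_iff] at this
        obtain ⟨k, hk1, hk2⟩ := this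
        simp at hk2; subst hk2
        rw [Tree.cellOf_knight hk1] at hodd; simp at hodd
    · intro s hs
      have := S.whiteKing s hs; omega
  exact ⟨h.arena.legal_kstep hd hsafe, S, hsafe⟩

theorem steps_eq_filter {k : PieceKind} (hk : k ≠ .knight) : steps k = dirs.filter fun d => hits d k := by
  cases k <;> first | rfl | exact absurd rfl hk

include T in
/-- A piece that slides or steps cannot get from below onto a node on the way to the king. -/
theorem no_slide (h : Sealed N R o b x l) {s t d : Square} (hd : d ∈ dirs) {n : ℕ}
    (ht : t = s + n • d) (hi : ∀ i : ℕ, 0 < i → i < n → b (s + i • d) = none) (hbt : b t = none)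
    (hs : s.2 < l ∨ (s.2 = l ∧ loose N R s = true ∧ eaten N x s = false)) :
    t.2 < l ∨ (t.2 = l ∧ loose N R t = true ∧ eaten N x t = false) := by
  have key : ∀ i : ℕ, i ≤ n → (s + i • d).2 < l ∨
      ((s + i • d).2 = l ∧ loose N R (s + i • d) = true ∧ eaten N x (s + i • d) = false) := by
    intro i
    induction i with
    | zero => intro _; simpa using hs
    | succ i ih =>
      intro hin
      have ih := ih (by omega)
      have hb : b (s + (i + 1) • d) = none := by
        rcases Nat.lt_or_ge (i + 1) n with h1 | h1
        · exact hi _ (by omega) h1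
        · rw [show i + 1 = n by omega, ← ht]; exact hbt
      set u := s + i • d with hu
      have e : s + (i + 1) • d = u + d := by rw [succ_nsmul, hu]; abel
      rw [e] at hb ⊢
      by_contra hcon
      rw [not_or] at hcon
      obtain ⟨h1, h2, h3⟩ := h.empty_eaten T (by omega) hcon.2 hb
      have hN := (Tree.eaten_le h1).1
      have hdd := mem_dirs.1 hd
      have hrow : (u + d).2 = u.2 + d.2 := rfl
      have h4 : u.2 = l ∧ loose N R u = true ∧ eaten N x u = false := by
        rcases ih with ih | ih
        · exfalso
          have := hdd.2.2
          omega
        · exact ih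
      have e2 : u = u + d + -d := by abel
      have hd' : -d ∈ dirs := by
        rw [mem_dirs]; simp only [ne_eq, neg_eq_zero, Prod.fst_neg, Prod.snd_neg]
        exact ⟨hdd.1, by omega, by omega⟩
      by_cases hNu : N u = true
      · have := T.node_step hN (e2 ▸ hNu) hd'
        rcases this with h5 | h5
        · simp only [Prod.snd_neg] at h5; omega
        · have h6 := T.eaten_par h1 h5.1
          rw [← h5.2, ← e2, h4.2.2] at h6; simp at h6
      · rw [Bool.not_eq_true] at hNu
        have h5 := T.loose_below (R := R) hN (d := -d) (by
          have : d.2 = 1 := by omega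
          obtain ⟨d1, d2⟩ := d
          simp only [Prod.neg_mk, Prod.mk.injEq] at *; omega) (by rw [← e2]; exact hNu)
        rw [← e2, h4.2.1] at h5; simp at h5
  have := key n le_rfl
  rwa [← ht] at this

include T in
/-- The pieces that are not pawns cannot move, unless they stand below. -/
theorem locked (h : Sealed N R o b x l) {s d : Square} {k : PieceKind} (hs : cellOf N R s = some k)
    (hk : k ≠ .pawn) (hsl : l ≤ s.2) (hse : eaten N x s = false)
    (hm : ¬ (s.2 = l ∧ loose N R s = true)) (hd : d ∈ steps k) : b (s + d) ≠ none := by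
  intro hb
  have hdr := Tree.steps_near hd
  rw [near_iff] at hdr
  have hrow : (s + d).2 = s.2 + d.2 := rfl
  obtain ⟨h1, h2, h3⟩ := (T.rigid hs hk).1 d hd
  have hue : eaten N x (s + d) = false := by
    by_contra hcon
    rw [Bool.not_eq_false] at hcon
    rw [(Tree.eaten_le hcon).1] at h1; simp at h1
  rcases lt_or_ge (s + d).2 l with hlow | hhigh
  · have h4 : d.2 = -2 ∨ (d.2 = -1 ∧ loose N R s = false) := by
      rcases lt_or_ge d.2 (-1) with h5 | h5
      · left; omega
      · right
        refine ⟨by omega, ?_⟩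
        by_contra hcon
        rw [Bool.not_eq_false] at hcon
        exact hm ⟨by omega, hcon⟩
    obtain ⟨h5, h6, h7⟩ := h3 h4
    have hpawn : (s + d).2 = l - 1 → b (s + d) = some (.white, .pawn) ∨
        eaten N x (s + d + (0, 1)) = true := by
      intro h8
      by_cases h9 : eaten N x (s + d + (0, 1)) = true
      · exact .inr h9
      · exact .inl (h.low _ h8 hue h5 h6 (by simpa using h9))
    have hkn : d.2 = -2 → k = .knight := by
      intro h8
      by_contra hcon
      have : d ∈ dirs := by
        cases k <;> first | exact absurd rfl hcon | exact (List.mem_filter.1 hd).1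
      rw [mem_dirs] at this; omega
    have hrow1 : (s + d).2 = l - 1 := by
      rcases h4 with h8 | h8
      · have : ¬ s.2 = l := fun h9 => hm ⟨h9, loose_of_knight (by rw [hs, hkn h8])⟩
        omega
      · omega
    rcases hpawn hrow1 with h8 | h8
    · rw [hb] at h8; simp at h8
    have h9 := (Tree.eaten_le h8).1
    rcases h7 with h7 | ⟨h7, hpar⟩
    · rw [h9] at h7; simp at h7
    -- the pawn has moved up to plug the way, but then the knight was captured on the way
    have hp2 := par_snd N s
    have hrow3 : (s + d + (0, 1)).2 = (s + d).2 + 1 := rfl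
    rw [hpar] at hp2
    have hd2 : d.2 = -2 := by omega
    have hlt := h.lt
    obtain ⟨c, hc, hcp⟩ := T.eaten_child h8 (by intro e; rw [e] at hrow3; omega) h.node
    have hcs : c ≠ s := by rintro rfl; rw [hse] at hc; simp at hc
    have hv := T.knight_parent (by rw [hs, hkn hd2])
    have hcN := (Tree.eaten_le hc).1
    rw [isVertex, hpar, h9] at hv
    have hchild : ∀ q, N q = true → par N q = s + d + (0, 1) →
        q = s + d + (0, 1) + (1, 1) ∨ q = s + d + (0, 1) + (-1, 1) := by
      intro q hq h10
      have h11 := par_snd N q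
      have h12 := par_fst N q
      rw [h10] at h11 h12
      rw [Prod.ext_iff, Prod.ext_iff]
      simp only [Prod.fst_add, Prod.snd_add] at *
      omega
    rcases hchild c hcN hcp with e1 | e1 <;> rcases hchild s h7 hpar with e2 | e2
    · exact hcs (e1.trans e2.symm)
    · rw [← e1, ← e2, hcN, h7] at hv; simp at hv
    · rw [← e1, ← e2, hcN, h7] at hv; simp at hv
    · exact hcs (e1.trans e2.symm)
  · by_cases hm2 : (s + d).2 = l ∧ loose N R (s + d) = true ∧ eaten N x (s + d) = false
    · have h4 : ¬ (d.2 = -1 ∨ loose N R s = false) := fun h5 => h2 ⟨hm2.2.1, h5⟩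
      rw [not_or, Bool.not_eq_false] at h4
      have h5 : s.2 ≠ l := fun h6 => hm ⟨h6, h4.2⟩
      have h6 := (h3 (.inl (by omega))).1
      obtain ⟨k', h7, h8⟩ := cellOf_of_loose hm2.2.1
      rw [h6] at h7; simp at h7; exact h8 h7.symm
    · have h4 := h.empty_eaten T hhigh hm2 hb
      rw [hue] at h4; simp at h4

set_option maxHeartbeats 1600000 in
include T in
/-- White cannot break the seal. -/
theorem white (h : Sealed N R o b x l) (hl : l + 1 < x.2) (hna : ¬ WhiteAttacks b x) {m : Move}
    (hm : Legal ⟨b, .white⟩ m) :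
    ∃ l', Sealed N R o (Position.play ⟨b, .white⟩ m).board x l' := by
  obtain ⟨s, t⟩ := m
  obtain ⟨⟨k, hk, ht, hp⟩, -⟩ := hm
  simp only at hk ht hp
  have hatt : Attacks b s t → t ≠ x := by rintro ha rfl; exact hna ⟨s, k, hk, ha⟩
  have htn : b t = none := by
    have h1 : t ≠ x := by
      rintro rfl
      by_cases hkp : k = .pawn
      · rw [if_pos hkp] at hp
        rcases hp with hp | hp
        · rw [h.arena.king] at hp; simp at hp
        · exact hatt hp.1 rfl
      · rw [if_neg hkp] at hp; exact hatt hp rfl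
    by_contra hcon
    obtain ⟨⟨c, k'⟩, hc⟩ := Option.ne_none_iff_exists'.1 hcon
    cases c with
    | white => exact ht k' hc
    | black => exact h1 (h.arena.only t k' hc)
  have hpawn : k = .pawn → t = s + (0, 1) := by
    intro hkp
    rw [if_pos hkp] at hp
    rcases hp with hp | hp
    · exact hp.1
    · exact absurd htn hp.2
  have hst : s ≠ t := by rintro rfl; rw [hk] at htn; simp at htn
  have hsx : s ≠ x := by rintro rfl; rw [h.arena.king] at hk; simp at hk
  have hb' : (Position.play ⟨b, .white⟩ (s, t)).board =
      Function.update (Function.update b s none) t (b s) := rfl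
  have harena : Arena (Position.play ⟨b, .white⟩ (s, t)).board x := by
    rw [hb']; exact h.arena.playWhite hk htn
  have hbt : (Position.play ⟨b, .white⟩ (s, t)).board t = some (.white, k) := by
    rw [hb', Function.update_self, hk]
  have hbs : (Position.play ⟨b, .white⟩ (s, t)).board s = none := by
    rw [hb', Function.update_of_ne hst, Function.update_self]
  have hbo : ∀ q, q ≠ s → q ≠ t → (Position.play ⟨b, .white⟩ (s, t)).board q = b q := by
    intro q h1 h2
    rw [hb', Function.update_of_ne h2, Function.update_of_ne h1]
  generalize (Position.play ⟨b, .white⟩ (s, t)).board = b' at harena hbt hbs hbo ⊢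
  clear hb'
  have hmove : k ≠ .pawn → ∃ (d : Square) (n : ℕ), d ∈ (if k = .king then dirs else steps k) ∧ 0 < n ∧
      t = s + n • d ∧ (∀ i : ℕ, 0 < i → i < n → b (s + i • d) = none) ∧
      (k = .king ∨ k = .knight → n = 1) := by
    intro hkp
    rw [if_neg hkp] at hp
    unfold Attacks at hp
    rw [hk] at hp
    have hline : ∀ d, IsOrthogonal d ∨ IsDiagonal d → d ∈ dirs := by
      intro d hd
      have := mem_dirs_of_line (d := -d) (by
        simpa only [IsOrthogonal, IsDiagonal, Prod.fst_neg, Prod.snd_neg, Int.natAbs_neg] using hd)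
      rwa [neg_neg] at this
    have hhit : ∀ d, (IsOrthogonal d → hits d .rook = true) ∧ (IsDiagonal d → hits d .bishop = true) := by
      intro d
      have := hits_of_line (d := -d)
      rw [neg_neg] at this
      simpa only [IsOrthogonal, IsDiagonal, Prod.fst_neg, Prod.snd_neg, Int.natAbs_neg] using this
    cases k with
    | pawn => exact absurd rfl hkp
    | king =>
      refine ⟨t - s, 1, ?_, by omega, by rw [one_nsmul]; abel, fun i h1 h2 => by omega, fun _ => rfl⟩
      simp only [if_true]
      simp only at hp
      rw [mem_dirs]; simp only [Prod.fst_sub, Prod.snd_sub, ne_eq, sub_eq_zero]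
      exact ⟨fun e => hp.1 e.symm, hp.2⟩
    | knight =>
      refine ⟨t - s, 1, ?_, by omega, by rw [one_nsmul]; abel, fun i h1 h2 => by omega, fun _ => rfl⟩
      simp only [reduceCtorEq, if_false]
      exact mem_kdirs.2 (by simpa using hp)
    | queen =>
      obtain ⟨d, hd, n, hn, he, hi⟩ := hp
      exact ⟨d, n, by simpa [steps, hits] using hline d hd, hn, he, hi, by simp⟩
    | rook =>
      obtain ⟨d, hd, n, hn, he, hi⟩ := hp
      refine ⟨d, n, ?_, hn, he, hi, by simp⟩
      simp only [reduceCtorEq, if_false]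
      exact List.mem_filter.2 ⟨hline d (.inl hd), (hhit d).1 hd⟩
    | bishop =>
      obtain ⟨d, hd, n, hn, he, hi⟩ := hp
      refine ⟨d, n, ?_, hn, he, hi, by simp⟩
      simp only [reduceCtorEq, if_false]
      exact List.mem_filter.2 ⟨hline d (.inr hd), (hhit d).2 hd⟩
  -- the new position is sealed at the same rank if the move does not touch sealed squares
  have same : (s.2 < l ∨ (s.2 = l ∧ loose N R s = true ∧ eaten N x s = false) ∨
        (eaten N x s = true ∧ s.2 = l + 1)) →
      (t.2 < l ∨ (t.2 = l ∧ loose N R t = true ∧ eaten N x t = false) ∨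
        (eaten N x t = true ∧ t.2 = l + 1 ∧ k = .knight)) →
      Sealed N R o b' x l := by
    intro h1 h2
    have hns : ∀ q, l ≤ q.2 → ¬ (q.2 = l ∧ loose N R q = true ∧ eaten N x q = false) →
        ¬ (eaten N x q = true ∧ q.2 = l + 1) → q ≠ s ∧ q ≠ t := by
      intro q h3 h4 h5
      constructor <;> rintro rfl
      · rcases h1 with h1 | h1 | h1
        · omega
        · exact h4 h1
        · exact h5 h1
      · rcases h2 with h2 | h2 | h2
        · omega
        · exact h4 h2
        · exact h5 ⟨h2.1, h2.2.1⟩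
    refine ⟨h.node, harena, h.base, h.lt, fun q h3 h4 h5 => ?_, fun q h3 h4 h5 => ?_,
      fun q h3 h4 => ?_, fun q h3 h4 h5 => ?_, fun q h3 h4 h5 h6 h7 => ?_, fun q hq => ?_⟩
    · obtain ⟨e1, e2⟩ := hns q (by omega) (by omega) (by omega)
      rw [hbo q e1 e2]; exact h.path q h3 h4 h5
    · by_cases e1 : q = s
      · rw [e1, hbs]; exact .inl rfl
      by_cases e2 : q = t
      · rw [e2, hbt]
        rw [e2] at h5 h3
        rcases h2 with h2 | h2 | h2
        · omega
        · omega
        · rw [h2.2.2]; exact .inr rfl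
      rw [hbo q e1 e2]; exact h.entry q h3 h4 h5
    · obtain ⟨e1, e2⟩ := hns q (by omega) (by rw [h3]; simp) (by omega)
      rw [hbo q e1 e2]; exact h.plug q h3 h4
    · obtain ⟨e1, e2⟩ := hns q h4 (fun e => h5 ⟨e.1, e.2.1⟩) (by rw [h3]; simp)
      rw [hbo q e1 e2]; exact h.rest q h3 h4 h5
    · have hbq := h.low q h3 h4 h5 h6 h7
      have e2 : q ≠ t := by rintro rfl; rw [htn] at hbq; simp at hbq
      have e1 : q ≠ s := by
        rintro rfl
        rw [hk] at hbq
        obtain rfl : k = .pawn := by simpa using hbq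
        have ht' := hpawn rfl
        have hrow : (q + (0, 1)).2 = q.2 + 1 := rfl
        have := h.empty_eaten T (q := q + (0, 1)) (by omega) (by rw [h6]; simp) (by rw [← ht']; exact htn)
        rw [h7] at this; simp at this
      rw [hbo q e1 e2]; exact hbq
    · by_cases e1 : q = s
      · rw [e1, hbs] at hq; simp at hq
      by_cases e2 : q = t
      · rw [e2, hbt] at hq
        rw [e2]
        rcases h2 with h2 | h2 | h2
        · omega
        · omega
        · rw [h2.2.2] at hq; simp at hq
      rw [hbo q e1 e2] at hq; exact h.whiteKing q hq
  by_cases hs1 : s.2 < l ∨ (s.2 = l ∧ loose N R s = true ∧ eaten N x s = false)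
  · refine ⟨l, same (hs1.elim .inl fun e => .inr (.inl e)) ?_⟩
    by_cases htm : t.2 < l ∨ (t.2 = l ∧ loose N R t = true ∧ eaten N x t = false)
    · exact htm.elim .inl fun e => .inr (.inl e)
    rw [not_or] at htm
    obtain ⟨h1, h2, h3⟩ := h.empty_eaten T (by omega) htm.2 htn
    have hN := (Tree.eaten_le h1).1
    by_cases hkp : k = .pawn
    · exfalso
      have ht' := hpawn hkp
      have hrow : t.2 = s.2 + 1 := by rw [ht']; rfl
      have e : s = t + (0, -1) := by rw [ht', add_assoc]; exact (add_zero s).symm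
      have h4 := T.loose_below (R := R) hN (d := (0, -1)) (.inl rfl) (T.pred_facts hN).2.2.2.2.1
      rw [← e] at h4
      have : loose N R s = true := by
        rcases hs1 with h5 | h5
        · omega
        · exact h5.2.1
      rw [this] at h4; simp at h4
    obtain ⟨d, n, hd, hn, he, hi, hn1⟩ := hmove hkp
    by_cases hkn : k = .knight
    · right; right
      refine ⟨h1, ?_, hkn⟩
      subst hkn
      simp only [reduceCtorEq, if_false] at hd
      have hd' := mem_kdirs.1 hd
      rw [hn1 (.inr rfl), one_nsmul] at he
      have hrow : t.2 = s.2 + d.2 := by rw [he]; rfl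
      by_contra hcon
      have h5 : s.2 = l ∧ loose N R s = true ∧ eaten N x s = false := by
        rcases hs1 with h5 | h5
        · exfalso
          have : d.2 ≤ 2 := by omega
          omega
        · exact h5
      obtain ⟨k', hk1, hk2⟩ := cellOf_of_loose h5.2.1
      have h6 := (T.rigid hk1 hk2).2 h5.2.1
      have h7 : d = (1, 2) ∨ d = (-1, 2) := by
        obtain ⟨d1, d2⟩ := d
        simp only [Prod.mk.injEq] at *; omega
      rcases h7 with rfl | rfl
      · rw [← he, hN] at h6; simp at h6
      · rw [← he, hN] at h6; simp at h6
    · have hdd : d ∈ dirs := by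
        by_cases hkk : k = .king
        · rwa [if_pos hkk] at hd
        · rw [if_neg hkk, steps_eq_filter hkn] at hd
          exact (List.mem_filter.1 hd).1
      exact (h.no_slide T hdd he hi htn hs1).elim .inl fun e => .inr (.inl e)
  rw [not_or] at hs1
  by_cases hse : eaten N x s = true
  · have hsN := (Tree.eaten_le hse).1
    rcases lt_trichotomy s.2 (l + 1) with h1 | h1 | h1
    · -- the plug cannot move
      exfalso
      have h2 := h.plug s hse (by omega)
      rw [hk] at h2
      have ht' := hpawn (by simpa using h2)
      have hrow : t.2 = s.2 + 1 := by rw [ht']; rfl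
      have := h.empty_eaten T (q := t) (by omega) (by omega) htn
      have h3 := (Tree.eaten_le this.1).1
      rw [ht', (T.pred_facts hsN).2.2.2.1] at h3; simp at h3
    · refine ⟨l, same (.inr (.inr ⟨hse, h1⟩)) ?_⟩
      have h2 : k = .knight := by
        rcases h.entry s hse hsx h1 with h2 | h2
        · rw [hk] at h2; simp at h2
        · rw [hk] at h2; simpa using h2
      by_cases htm : t.2 < l ∨ (t.2 = l ∧ loose N R t = true ∧ eaten N x t = false)
      · exact htm.elim .inl fun e => .inr (.inl e)
      rw [not_or] at htm
      obtain ⟨h3, -, -⟩ := h.empty_eaten T (by omega) htm.2 htn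
      exfalso
      subst h2
      obtain ⟨d, n, hd, hn, he, hi, hn1⟩ := hmove (by simp)
      simp only [reduceCtorEq, if_false] at hd
      have hd' := mem_kdirs.1 hd
      rw [hn1 (.inr rfl), one_nsmul] at he
      have h4 := T.even _ (Tree.eaten_le h3).1
      have h5 := T.even _ hsN
      rw [he] at h4
      simp only [Prod.fst_add, Prod.snd_add, Int.even_iff] at h4 h5
      omega
    · have := h.path s hse hsx h1
      rw [hk] at this; simp at this
  · rw [Bool.not_eq_true] at hse
    have hsl : l ≤ s.2 := by omega
    have hsm : ¬ (s.2 = l ∧ loose N R s = true) := fun e => hs1.2 ⟨e.1, e.2, hse⟩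
    have h1 := h.rest s hse hsl hsm
    rw [hk, eq_comm, Option.map_eq_some_iff] at h1
    obtain ⟨k', hcell, hk'⟩ := h1
    obtain rfl : k' = k := by simpa using hk'
    have hso : s ≠ o := by
      rintro rfl; rw [eaten_base T h.node] at hse; simp at hse
    by_cases hkp : k' = .pawn
    · -- the pawn plugs the way
      have ht' := hpawn hkp
      have hrow : t.2 = s.2 + 1 := by rw [ht']; rfl
      obtain ⟨h2, h3, -⟩ := h.empty_eaten T (q := t) (by omega) (by omega) htn
      have hlex := (Tree.eaten_le h2).2
      have htx : t.2 < x.2 := by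
        rcases (Tree.eaten_iff h.node).1 h2 with h4 | h4
        · exact absurd h4 h3
        · have := (Tree.eaten_le h4).2
          rw [par_snd] at this; omega
      have huniq : ∀ q, eaten N x q = true → q.2 = t.2 → q = t := by
        intro q h4 h5
        simp only [eaten, Bool.and_eq_true, beq_iff_eq] at h4 h2
        rw [h4.2, h2.2, h5]
      have hother : ∀ q, q.2 ≠ s.2 → q.2 ≠ t.2 → b' q = b q := fun q h4 h5 =>
        hbo q (by rintro rfl; exact h4 rfl) (by rintro rfl; exact h5 rfl)
      refine ⟨t.2, h.node, harena, by have := h.base; omega, htx, fun q h4 h5 h6 => ?_,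
        fun q h4 h5 h6 => ?_, fun q h4 h5 => ?_, fun q h4 h5 h6 => ?_, fun q h4 h5 h6 h7 h8 => ?_,
        fun q hq => ?_⟩
      · rw [hother q (by omega) (by omega)]; exact h.path q h4 h5 (by omega)
      · rw [hother q (by omega) (by omega)]; exact .inl (h.path q h4 h5 (by omega))
      · rw [huniq q h4 h5, hbt, hkp]
      · have e2 : q ≠ t := by rintro rfl; rw [h2] at h4; simp at h4
        have e1 : q ≠ s := by rintro rfl; omega
        rw [hbo q e1 e2]; exact h.rest q h4 (by omega) (by omega)
      · have e2 : q ≠ t := by rintro rfl; omega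
        have e1 : q ≠ s := by rintro rfl; rw [← ht', h2] at h8; simp at h8
        rw [hbo q e1 e2, h.rest q h5 (by omega), h6]
        · rfl
        · rintro ⟨-, h9⟩
          obtain ⟨k2, h10, h11⟩ := cellOf_of_loose h9
          rw [h6] at h10; simp at h10; exact h11 h10.symm
      · by_cases e1 : q = s
        · rw [e1, hbs] at hq; simp at hq
        by_cases e2 : q = t
        · rw [e2]
        rw [hbo q e1 e2] at hq
        have := h.whiteKing q hq; omega
    · exfalso
      have hkk : k' ≠ .king := by
        obtain ⟨k2, h2, h3⟩ := T.cell_ne_none hso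
        rw [hcell] at h2
        simp at h2; rw [h2]; exact h3
      obtain ⟨d, n, hd, hn, he, hi, -⟩ := hmove hkp
      rw [if_neg hkk] at hd
      refine h.locked T hcell hkp hsl hse hsm hd ?_
      rcases Nat.lt_or_ge 1 n with h2 | h2
      · have := hi 1 (by omega) h2
        rwa [one_nsmul] at this
      · obtain rfl : n = 1 := by omega
        rw [one_nsmul] at he
        rw [← he]; exact htn

end Sealed

/-! ### Black walks up an infinite path -/

/-- The black king walks along a sequence of squares. -/
def walk (f : ℕ → Square) : Strategy := fun h => (f (h.length / 2), f (h.length / 2 + 1))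

/-- A king that walks along an infinite path is never mated, and always finds its next move legal. -/
theorem walk_draws {N R : Square → Bool} {o : Square} (T : Tree N R o) {f : ℕ → Square}
    (h0 : f 0 = o) (hf : ∀ n, N (f (n + 1)) = true ∧ par N (f (n + 1)) = f n) :
    IsDrawingStrategy (start N R o) .black (walk f) := by
  have hstep : ∀ n, ∃ d ∈ dirs, d.2 = 1 ∧ f (n + 1) = f n + d := by
    intro n
    have h1 := par_snd N (f (n + 1))
    have h2 := par_fst N (f (n + 1))
    rw [(hf n).2] at h1 h2
    refine ⟨f (n + 1) - f n, ?_, ?_, by abel⟩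
    · rw [mem_dirs]
      simp only [Prod.fst_sub, Prod.snd_sub]
      refine ⟨fun e => ?_, by omega, by omega⟩
      have := congrArg Prod.snd e
      simp at this; omega
    · rw [Prod.snd_sub]; omega
  have key : ∀ h, Arises (start N R o) .black (walk f) h →
      (h.length % 2 = 0 → ∃ l, Sealed N R o (after (start N R o) h).board (f (h.length / 2)) l) ∧
      (h.length % 2 = 1 → ∃ l, Sealed N R o (after (start N R o) h).board (f (h.length / 2 + 1)) l ∧
        l + 1 < (f (h.length / 2 + 1)).2 ∧
        ¬ WhiteAttacks (after (start N R o) h).board (f (h.length / 2 + 1))) := by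
    intro h ha
    induction h using List.reverseRecOn with
    | nil =>
      refine ⟨fun _ => ⟨o.2 - 1, ?_⟩, fun h => by simp at h⟩
      have h1 : f (([] : List Move).length / 2) = o := h0
      rw [h1]
      exact Sealed.init T
    | append_singleton h m ih =>
      obtain ⟨ha, hl, hm⟩ := arises_concat.1 ha
      obtain ⟨ih1, ih2⟩ := ih ha
      have ht := turn_eq_black (p := start N R o) rfl h
      have hlen : (h ++ [m]).length = h.length + 1 := by simp
      rw [hlen, after_concat]
      refine ⟨fun hpar => ?_, fun hpar => ?_⟩
      · rw [if_neg (by omega)] at ht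
        obtain ⟨l, h1, h2, h3⟩ := ih2 (by omega)
        rw [Position.eta _ ht] at hl ⊢
        rw [show (h.length + 1) / 2 = h.length / 2 + 1 by omega]
        exact h1.white T h2 h3 hl
      · rw [if_pos (by omega)] at ht
        obtain ⟨l, h1⟩ := ih1 (by omega)
        obtain rfl := hm ht
        rw [Position.eta _ ht]
        rw [show (h.length + 1) / 2 = h.length / 2 by omega]
        obtain ⟨d, hd, hd2, he⟩ := hstep (h.length / 2)
        obtain ⟨-, h3, h4⟩ := h1.step T hd hd2 (by rw [← he]; exact (hf _).1)
        rw [walk, he, h1.arena.play_eq]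
        refine ⟨l, h3, ?_, h4⟩
        have := h1.lt
        rw [Prod.snd_add]; omega
  have hlegal : ∀ h, Arises (start N R o) .black (walk f) h →
      (after (start N R o) h).turn = .black →
      Legal (after (start N R o) h) (walk f h) := by
    intro h ha ht
    have hlen : h.length % 2 = 0 := by
      by_contra hc
      rw [turn_eq_black rfl, if_neg hc] at ht
      simp at ht
    obtain ⟨l, h1⟩ := (key h ha).1 hlen
    obtain ⟨d, hd, hd2, he⟩ := hstep (h.length / 2)
    rw [Position.eta _ ht, walk, he]
    exact (h1.step T hd hd2 (by rw [← he]; exact (hf _).1)).1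
  refine ⟨fun h ha ht _ => hlegal h ha ht, fun h ha hc => ?_⟩
  rcases ht : (after (start N R o) h).turn with - | -
  · have hlen : h.length % 2 = 1 := by
      by_contra hc
      rw [turn_eq_black rfl, if_pos (by omega)] at ht
      simp at ht
    obtain ⟨l, h1, h2, h3⟩ := (key h ha).2 hlen
    have h4 := hc.1
    rw [ht] at h4
    refine h1.arena.not_inCheck_white (fun s hs => ?_) h4
    have := h1.whiteKing s hs; omega
  · exact hc.2 _ (hlegal h ha ht)


/-! ### Programs with a partial oracle -/

/-- The partial function computed by a program with a partial oracle. -/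
def OracleCode.peval (g : ℕ →. ℕ) : OracleCode → ℕ →. ℕ
  | .zero => fun _ => Part.some 0
  | .succ => fun n => Part.some (n + 1)
  | .left => fun n => Part.some n.unpair.1
  | .right => fun n => Part.some n.unpair.2
  | .oracle => g
  | .pair c d => fun n => Nat.pair <$> c.peval g n <*> d.peval g n
  | .comp c d => fun n => d.peval g n >>= c.peval g
  | .prec c d => fun p =>
      p.unpair.2.rec (c.peval g p.unpair.1) fun y IH =>
        IH >>= fun i => d.peval g (Nat.pair p.unpair.1 (Nat.pair y i))
  | .rfind c => fun a =>
      Nat.rfind fun n => (fun m => decide (m = 0)) <$> c.peval g (Nat.pair a n)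

namespace OracleCode

theorem eval_eq_peval (g : ℕ → ℕ) (c : OracleCode) :
    c.eval g = c.peval fun n => Part.some (g n) := by
  induction c with
  | zero | succ | left | right | oracle => rfl
  | pair c d hc hd => simp only [eval, peval, hc, hd]; rfl
  | comp c d hc hd => simp only [eval, peval, hc, hd]; rfl
  | prec c d hc hd => simp only [eval, peval, hc, hd]; rfl
  | rfind c hc => simp only [eval, peval, hc]; rfl

theorem mem_pair {c d : ℕ →. ℕ} {n x : ℕ} : x ∈ (Nat.pair <$> c n <*> d n : Part ℕ) ↔
    ∃ a ∈ c n, ∃ b ∈ d n, Nat.pair a b = x := by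
  simp [Seq.seq]

/-- A computation that succeeds with the union of an increasing sequence of partial oracles succeeds
with one of them. -/
theorem peval_continuous {g : ℕ →. ℕ} {s : ℕ → ℕ →. ℕ}
    (hs : ∀ k l, k ≤ l → ∀ n x, x ∈ s k n → x ∈ s l n)
    (hg : ∀ n x, x ∈ g n ↔ ∃ k, x ∈ s k n) (c : OracleCode) :
    ∀ n x, (∀ k l, k ≤ l → x ∈ c.peval (s k) n → x ∈ c.peval (s l) n) ∧
      (x ∈ c.peval g n ↔ ∃ k, x ∈ c.peval (s k) n) := by
  induction c with
  | zero | succ | left | right => exact fun n x => ⟨fun _ _ _ h => h, fun h => ⟨0, h⟩, fun ⟨_, h⟩ => h⟩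
  | oracle => exact fun n x => ⟨fun k l hkl => hs k l hkl n x, hg n x⟩
  | pair c d hc hd =>
    intro n x
    simp only [peval, mem_pair]
    refine ⟨?_, ?_, ?_⟩
    · rintro k l hkl ⟨a, ha, b, hb, rfl⟩
      exact ⟨a, (hc n a).1 k l hkl ha, b, (hd n b).1 k l hkl hb, rfl⟩
    · rintro ⟨a, ha, b, hb, rfl⟩
      obtain ⟨k, hk⟩ := (hc n a).2.1 ha
      obtain ⟨l, hl⟩ := (hd n b).2.1 hb
      exact ⟨max k l, a, (hc n a).1 _ _ (le_max_left _ _) hk, b,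
        (hd n b).1 _ _ (le_max_right _ _) hl, rfl⟩
    · rintro ⟨k, a, ha, b, hb, rfl⟩
      exact ⟨a, (hc n a).2.2 ⟨k, ha⟩, b, (hd n b).2.2 ⟨k, hb⟩, rfl⟩
  | comp c d hc hd =>
    intro n x
    have e : ∀ h, x ∈ (comp c d).peval h n ↔ ∃ a ∈ d.peval h n, x ∈ c.peval h a :=
      fun h => Part.mem_bind_iff (f := d.peval h n) (g := c.peval h)
    simp only [e]
    refine ⟨?_, ?_, ?_⟩
    · rintro k l hkl ⟨a, ha, hx⟩
      exact ⟨a, (hd n a).1 k l hkl ha, (hc a x).1 k l hkl hx⟩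
    · rintro ⟨a, ha, hx⟩
      obtain ⟨k, hk⟩ := (hd n a).2.1 ha
      obtain ⟨l, hl⟩ := (hc a x).2.1 hx
      exact ⟨max k l, a, (hd n a).1 _ _ (le_max_left _ _) hk, (hc a x).1 _ _ (le_max_right _ _) hl⟩
    · rintro ⟨k, a, ha, hx⟩
      exact ⟨a, (hd n a).2.2 ⟨k, ha⟩, (hc a x).2.2 ⟨k, hx⟩⟩
  | prec c d hc hd =>
    intro n
    simp only [peval]
    induction n.unpair.2 with
    | zero => exact hc _
    | succ y ih =>
      intro x
      simp only [Part.bind_eq_bind, Part.mem_bind_iff]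
      refine ⟨?_, ?_, ?_⟩
      · rintro k l hkl ⟨a, ha, hx⟩
        exact ⟨a, (ih a).1 k l hkl ha, (hd _ x).1 k l hkl hx⟩
      · rintro ⟨a, ha, hx⟩
        obtain ⟨k, hk⟩ := (ih a).2.1 ha
        obtain ⟨l, hl⟩ := (hd _ x).2.1 hx
        exact ⟨max k l, a, (ih a).1 _ _ (le_max_left _ _) hk, (hd _ x).1 _ _ (le_max_right _ _) hl⟩
      · rintro ⟨k, a, ha, hx⟩
        exact ⟨a, (ih a).2.2 ⟨k, ha⟩, (hd _ x).2.2 ⟨k, hx⟩⟩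
  | rfind c hc =>
    intro n x
    have key : ∀ (h : ℕ →. ℕ), x ∈ (rfind c).peval h n ↔ 0 ∈ c.peval h (Nat.pair n x) ∧
        ∀ j < x, ∃ v, v ≠ 0 ∧ v ∈ c.peval h (Nat.pair n j) := by
      intro h
      have e : x ∈ (rfind c).peval h n ↔ _ := Nat.mem_rfind
      have e2 : ∀ k b, b ∈ (Part.map (fun m => decide (m = 0)) (c.peval h (Nat.pair n k)) : Part Bool)
          ↔ ∃ v ∈ c.peval h (Nat.pair n k), decide (v = 0) = b := fun k b => Part.mem_map_iff _
      refine e.trans (and_congr ((e2 _ _).trans ?_) ⟨fun H j hj => ?_, fun H j hj => ?_⟩)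
      · constructor
        · rintro ⟨v, hv, h3⟩
          obtain rfl : v = 0 := by simpa using h3
          exact hv
        · exact fun h => ⟨0, h, rfl⟩
      · obtain ⟨v, h1, h2⟩ := (e2 _ _).1 (H hj)
        exact ⟨v, by simpa using h2, h1⟩
      · obtain ⟨v, h1, h2⟩ := H j hj
        exact (e2 _ _).2 ⟨v, h2, by simpa using h1⟩
    simp only [key]
    refine ⟨?_, ?_, ?_⟩
    · rintro k l hkl ⟨h1, h2⟩
      refine ⟨(hc _ _).1 k l hkl h1, fun j hj => ?_⟩
      obtain ⟨v, hv, h3⟩ := h2 j hj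
      exact ⟨v, hv, (hc _ _).1 k l hkl h3⟩
    · rintro ⟨h1, h2⟩
      obtain ⟨k, hk⟩ := (hc _ _).2.1 h1
      have : ∀ y ≤ x, ∃ K, ∀ j < y, ∃ v, v ≠ 0 ∧ v ∈ c.peval (s K) (Nat.pair n j) := by
        intro y
        induction y with
        | zero => exact fun _ => ⟨0, fun j hj => by omega⟩
        | succ y ih =>
          intro hy
          obtain ⟨K, hK⟩ := ih (by omega)
          obtain ⟨v, hv, h3⟩ := h2 y (by omega)
          obtain ⟨l, hl⟩ := (hc _ _).2.1 h3
          refine ⟨max K l, fun j hj => ?_⟩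
          rcases Nat.lt_succ_iff_lt_or_eq.1 hj with h4 | rfl
          · obtain ⟨w, hw, h5⟩ := hK j h4
            exact ⟨w, hw, (hc _ _).1 _ _ (le_max_left _ _) h5⟩
          · exact ⟨v, hv, (hc _ _).1 _ _ (le_max_right _ _) hl⟩
      obtain ⟨K, hK⟩ := this x le_rfl
      refine ⟨max k K, (hc _ _).1 _ _ (le_max_left _ _) hk, fun j hj => ?_⟩
      obtain ⟨w, hw, h5⟩ := hK j hj
      exact ⟨w, hw, (hc _ _).1 _ _ (le_max_right _ _) h5⟩
    · rintro ⟨k, h1, h2⟩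
      refine ⟨(hc _ _).2.2 ⟨k, h1⟩, fun j hj => ?_⟩
      obtain ⟨v, hv, h3⟩ := h2 j hj
      exact ⟨v, hv, (hc _ _).2.2 ⟨k, h3⟩⟩

open Nat.Partrec (Code)

/-- The program without oracle that uses the program `O` to answer the oracle queries. -/
def toCode (O : Code) : OracleCode → Code
  | .zero => .zero
  | .succ => .succ
  | .left => .left
  | .right => .right
  | .oracle => O
  | .pair c d => .pair (c.toCode O) (d.toCode O)
  | .comp c d => .comp (c.toCode O) (d.toCode O)
  | .prec c d => .prec (c.toCode O) (d.toCode O)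
  | .rfind c => .comp (.rfind' (c.toCode O)) (.pair Code.id .zero)

theorem eval_toCode (O : Code) (c : OracleCode) : (c.toCode O).eval = c.peval O.eval := by
  induction c with
  | zero | succ | left | right | oracle => rfl
  | pair c d hc hd => simp only [toCode, peval, Code.eval, hc, hd]; rfl
  | comp c d hc hd => simp only [toCode, peval, Code.eval, hc, hd]; rfl
  | prec c d hc hd => simp only [toCode, peval, Code.eval, hc, hd]; rfl
  | rfind c hc =>
    funext n
    have h1 : (Code.pair Code.id Code.zero).eval n = Part.some (Nat.pair n 0) := by
      simp [Code.eval, Seq.seq, pure, PFun.pure]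
    simp only [toCode, peval, Code.eval, hc] at h1 ⊢
    rw [h1]
    simp only [Part.bind_eq_bind, Part.bind_some, Nat.unpaired, Nat.unpair_pair, Nat.add_zero]
    simp [Part.map_id']

theorem primrec_toCode : Primrec₂ fun (O : Code) (n : ℕ) => (OracleCode.ofNat n).toCode O := by
  set m : Code × List Code → ℕ := fun t => (t.2.length - 5) / 4 with hm
  have hlen : Primrec fun t : Code × List Code => t.2.length := Primrec.list_length.comp Primrec.snd
  have hm' : Primrec m := Primrec.nat_div.comp (Primrec.nat_sub.comp hlen (Primrec.const 5))
    (Primrec.const 4)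
  have hr : Primrec fun t : Code × List Code => (t.2.length - 5) % 4 :=
    Primrec.nat_mod.comp (Primrec.nat_sub.comp hlen (Primrec.const 5)) (Primrec.const 4)
  have hu := Primrec.unpair.comp hm'
  have hget : ∀ f : Code × List Code → ℕ, Primrec f →
      Primrec fun t => (t.2[f t]?).getD Code.zero := fun f hf =>
    Primrec.option_getD.comp (Primrec.list_getElem?.comp Primrec.snd hf) (Primrec.const _)
  have h1 := hget _ (Primrec.fst.comp hu)
  have h2 := hget _ (Primrec.snd.comp hu)
  have h3 := hget _ hm'
  have hq : ∀ k, PrimrecPred fun t : Code × List Code => t.2.length = k := fun k =>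
    Primrec.eq.comp hlen (Primrec.const k)
  have hq' : ∀ k, PrimrecPred fun t : Code × List Code => (t.2.length - 5) % 4 = k := fun k =>
    Primrec.eq.comp hr (Primrec.const k)
  have hG : Primrec₂ fun (O : Code) (l : List Code) => some (
      if l.length = 0 then Code.zero
      else if l.length = 1 then .succ
      else if l.length = 2 then .left
      else if l.length = 3 then .right
      else if l.length = 4 then O
      else if (l.length - 5) % 4 = 0 then
        .pair ((l[(m (O, l)).unpair.1]?).getD .zero) ((l[(m (O, l)).unpair.2]?).getD .zero)
      else if (l.length - 5) % 4 = 1 then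
        .comp ((l[(m (O, l)).unpair.1]?).getD .zero) ((l[(m (O, l)).unpair.2]?).getD .zero)
      else if (l.length - 5) % 4 = 2 then
        .prec ((l[(m (O, l)).unpair.1]?).getD .zero) ((l[(m (O, l)).unpair.2]?).getD .zero)
      else .comp (.rfind' ((l[m (O, l)]?).getD .zero)) (.pair Code.id .zero)) := by
    refine Primrec.option_some.comp ?_
    refine Primrec.ite (hq 0) (Primrec.const _) <| Primrec.ite (hq 1) (Primrec.const _) <|
      Primrec.ite (hq 2) (Primrec.const _) <| Primrec.ite (hq 3) (Primrec.const _) <|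
      Primrec.ite (hq 4) Primrec.fst <| Primrec.ite (hq' 0) (Code.primrec₂_pair.comp h1 h2) <|
      Primrec.ite (hq' 1) (Code.primrec₂_comp.comp h1 h2) <|
      Primrec.ite (hq' 2) (Code.primrec₂_prec.comp h1 h2)
      (Code.primrec₂_comp.comp (Code.primrec_rfind'.comp h3) (Primrec.const _))
  refine Primrec.nat_strong_rec _ hG fun O n => ?_
  congr 1
  have hl : ((List.range n).map fun n => (OracleCode.ofNat n).toCode O).length = n := by simp
  simp only [hl, hm]
  have hg : ∀ i < n, (((List.range n).map fun n => (OracleCode.ofNat n).toCode O)[i]?).getD Code.zero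
      = (OracleCode.ofNat i).toCode O := by
    intro i hi
    rw [List.getElem?_map, List.getElem?_range hi]; rfl
  conv_rhs => rw [OracleCode.ofNat]
  have ha := Nat.unpair_left_le ((n - 5) / 4)
  have hb := Nat.unpair_right_le ((n - 5) / 4)
  split_ifs
  all_goals first
    | rfl
    | (rw [hg _ (by omega), hg _ (by omega)]; rfl)
    | (rw [hg _ (by omega)]; rfl)

/-! ### Numbers of programs, and queries to the jump -/

/-- A number of a program. -/
def num : OracleCode → ℕ
  | .zero => 0
  | .succ => 1
  | .left => 2
  | .right => 3
  | .oracle => 4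
  | .pair c d => 4 * Nat.pair c.num d.num + 0 + 5
  | .comp c d => 4 * Nat.pair c.num d.num + 1 + 5
  | .prec c d => 4 * Nat.pair c.num d.num + 2 + 5
  | .rfind c => 4 * c.num + 3 + 5

theorem ofNat_num (c : OracleCode) : OracleCode.ofNat c.num = c := by
  have key : ∀ m r, r < 4 → (4 * m + r + 5 - 5) % 4 = r ∧ (4 * m + r + 5 - 5) / 4 = m := by omega
  induction c with
  | zero | succ | left | right | oracle => rw [num, OracleCode.ofNat]; simp
  | pair c d hc hd =>
    rw [num, OracleCode.ofNat, (key _ 0 (by omega)).1, (key _ 0 (by omega)).2, Nat.unpair_pair, hc, hd]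
    simp
  | comp c d hc hd =>
    rw [num, OracleCode.ofNat, (key _ 1 (by omega)).1, (key _ 1 (by omega)).2, Nat.unpair_pair, hc, hd]
    simp
  | prec c d hc hd =>
    rw [num, OracleCode.ofNat, (key _ 2 (by omega)).1, (key _ 2 (by omega)).2, Nat.unpair_pair, hc, hd]
    simp
  | rfind c hc =>
    rw [num, OracleCode.ofNat, (key _ 3 (by omega)).1, (key _ 3 (by omega)).2, hc]
    simp

theorem exists_of_partrec {f : ℕ →. ℕ} (hf : Nat.Partrec f) :
    ∃ c : OracleCode, ∀ g, c.eval g = f := by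
  induction hf with
  | zero => exact ⟨.zero, fun g => rfl⟩
  | succ => exact ⟨.succ, fun g => rfl⟩
  | left => exact ⟨.left, fun g => rfl⟩
  | right => exact ⟨.right, fun g => rfl⟩
  | pair _ _ hf hg =>
    obtain ⟨c, hc⟩ := hf
    obtain ⟨d, hd⟩ := hg
    exact ⟨.pair c d, fun g => by simp only [eval, hc, hd]; rfl⟩
  | comp _ _ hf hg =>
    obtain ⟨c, hc⟩ := hf
    obtain ⟨d, hd⟩ := hg
    exact ⟨.comp c d, fun g => by simp only [eval, hc, hd]; rfl⟩
  | prec _ _ hf hg =>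
    obtain ⟨c, hc⟩ := hf
    obtain ⟨d, hd⟩ := hg
    exact ⟨.prec c d, fun g => by simp only [eval, hc, hd]; rfl⟩
  | rfind _ hf =>
    obtain ⟨c, hc⟩ := hf
    exact ⟨.rfind c, fun g => by simp only [eval, hc]; rfl⟩

/-- A program that outputs `n`. -/
def constant : ℕ → OracleCode
  | 0 => .zero
  | n + 1 => .comp .succ (constant n)

theorem eval_constant (g : ℕ → ℕ) (x : ℕ) : ∀ n, (constant n).eval g x = Part.some n
  | 0 => rfl
  | n + 1 => by simp [constant, eval, eval_constant g x n]

end OracleCode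

/-- Whether a partial recursive function is defined can be asked from every jump. -/
theorem exists_query {f : ℕ →. ℕ} (hf : Nat.Partrec f) :
    ∃ r : ℕ → ℕ, Computable r ∧ ∀ g n, jump g (r n) = 1 ↔ (f n).Dom := by
  obtain ⟨c, hc⟩ := OracleCode.exists_of_partrec hf
  have hconst : Primrec fun n => (OracleCode.constant n).num := by
    have := Primrec.nat_rec₁ (f := fun _ v => 4 * Nat.pair 1 v + 1 + 5) 0 (by
      exact Primrec.nat_add.comp (Primrec.nat_add.comp (Primrec.nat_mul.comp (Primrec.const 4)
        (Primrec₂.natPair.comp (Primrec.const 1) Primrec.snd)) (Primrec.const 1)) (Primrec.const 5))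
    refine this.of_eq fun n => ?_
    induction n with
    | zero => rfl
    | succ n ih => simp only [ih]; rfl
  refine ⟨fun n => (OracleCode.comp c (.constant n)).num, ?_, fun g n => ?_⟩
  · refine Primrec.to_comp ?_
    exact Primrec.nat_add.comp (Primrec.nat_add.comp (Primrec.nat_mul.comp (Primrec.const 4)
      (Primrec₂.natPair.comp (Primrec.const c.num) hconst)) (Primrec.const 1)) (Primrec.const 5)
  · unfold jump
    rw [OracleCode.ofNat_num]
    have e : ∀ x, (OracleCode.comp c (.constant n)).eval g x = f n := fun x => by
      show ((OracleCode.constant n).eval g x).bind (c.eval g) = _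
      rw [OracleCode.eval_constant, hc]
      exact Part.bind_some _ _
    rw [e]
    split_ifs with h <;> simp [h]

/-! ### Infinite paths in binary trees -/

/-- König's lemma for a binary tree `S` with vertices on all levels; the parent of the vertex `j` is
`j / 2`. -/
theorem exists_path {S : ℕ → ℕ → Prop} (hd : ∀ n j, S (n + 1) j → S n (j / 2))
    (hne : ∀ n, ∃ j < 2 ^ n, S n j) :
    ∃ x : ℕ → ℕ, ∀ n, x n < 2 ^ n ∧ S n (x n) ∧ x (n + 1) / 2 = x n := by
  have hd' : ∀ m n j, S (n + m) j → S n (j / 2 ^ m) := by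
    intro m
    induction m with
    | zero => intro n j h; simpa using h
    | succ m ih =>
      intro n j h
      have := ih n (j / 2) (hd _ _ h)
      rwa [Nat.div_div_eq_div_mul, ← pow_succ'] at this
  -- a vertex is good if it has descendants on all levels
  set good : ℕ → ℕ → Prop := fun n j => ∀ m, ∃ i, S (n + m) i ∧ i / 2 ^ m = j with hgood
  have h0 : good 0 0 := by
    intro m
    obtain ⟨i, h1, h2⟩ := hne m
    exact ⟨i, by rwa [zero_add], Nat.div_eq_of_lt h1⟩
  have hs : ∀ n j, good n j → ∃ b < 2, good (n + 1) (2 * j + b) := by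
    intro n j h
    by_contra hcon
    push Not at hcon
    have h1 := hcon 0 (by omega)
    have h2 := hcon 1 (by omega)
    simp only [hgood, not_forall] at h1 h2
    obtain ⟨m1, h1⟩ := h1
    obtain ⟨m2, h2⟩ := h2
    obtain ⟨i, hi, hij⟩ := h (max m1 m2 + 1)
    have key : ∀ m ≤ max m1 m2, S (n + 1 + m) (i / 2 ^ (max m1 m2 - m)) ∧
        i / 2 ^ (max m1 m2 - m) / 2 ^ m = i / 2 ^ (max m1 m2) := by
      intro m hm
      refine ⟨hd' _ _ _ ?_, ?_⟩
      · convert hi using 1; omega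
      · rw [Nat.div_div_eq_div_mul, ← pow_add]; congr 2; omega
    rw [pow_succ, ← Nat.div_div_eq_div_mul] at hij
    have hc : i / 2 ^ (max m1 m2) = 2 * j ∨ i / 2 ^ (max m1 m2) = 2 * j + 1 := by omega
    rcases hc with hc | hc
    · exact h1 ⟨_, (key m1 (le_max_left _ _)).1, by rw [(key m1 (le_max_left _ _)).2, hc]; rfl⟩
    · exact h2 ⟨_, (key m2 (le_max_right _ _)).1, by rw [(key m2 (le_max_right _ _)).2, hc]⟩
  choose b hb hb2 using hs
  let x : (n : ℕ) → {j // good n j} := fun n =>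
    Nat.rec ⟨0, h0⟩ (fun n j => ⟨2 * j.1 + b n j.1 j.2, hb2 n j.1 j.2⟩) n
  have hx : ∀ n, (x (n + 1)).1 = 2 * (x n).1 + b n (x n).1 (x n).2 := fun n => rfl
  refine ⟨fun n => (x n).1, fun n => ⟨?_, ?_, ?_⟩⟩
  · induction n with
    | zero => exact Nat.one_pos
    | succ n ih =>
      have := hb n _ (x n).2
      simp only [hx, pow_succ] at ih ⊢; omega
  · obtain ⟨i, hi, hij⟩ := (x n).2 0
    simp only [pow_zero, Nat.div_one] at hij
    subst hij; exact hi
  · have := hb n _ (x n).2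
    simp only [hx]; omega

open Nat.Partrec (Code)
open OracleCode

/-! ### The low basis theorem -/

theorem primrecRel_exists_lt {β : Type*} [Primcodable β] {R : ℕ → β → Prop} (h : PrimrecRel R) :
    PrimrecRel fun n y => ∃ x < n, R x y :=
  (h.exists_mem_list.comp (Primrec.list_range.comp Primrec.fst) Primrec.snd).of_eq (by simp)

theorem primrecRel_forall_lt {β : Type*} [Primcodable β] {R : ℕ → β → Prop} (h : PrimrecRel R) :
    PrimrecRel fun n y => ∀ x < n, R x y :=
  (h.forall_mem_list.comp (Primrec.list_range.comp Primrec.fst) Primrec.snd).of_eq (by simp)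

section lowBasis
variable (A : ℕ → ℕ → Bool) (u : ℕ → ℕ) (G : ℕ → ℕ → ℕ)

/-- The part of the oracle `n ↦ G n (x (u n))` that is determined by the initial segment of length
`s.1` of a path `x` with number `s.2`. -/
def segment (s : ℕ × ℕ) : ℕ →. ℕ := fun n =>
  if u n ≤ s.1 then Part.some (G n (s.2 / 2 ^ (s.1 - u n))) else Part.none

/-- Within `k` steps, it is seen that the program `e` halts on input `e` along each path through the
vertex `j` of level `k`; here `O` is a program that computes all partial oracles. -/
def haltsBy (O : Code) (e k j : ℕ) : Prop :=
  ∃ l ≤ k, ((OracleCode.ofNat e).toCode (Code.curry O (Nat.pair l (j / 2 ^ (k - l)))) |>.evaln k e).isSome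
    = true

/-- The vertices of the tree `A` where no program in the list `L` has been seen to halt. -/
def avoid (O : Code) (L : List ℕ) (k j : ℕ) : Prop :=
  A k j = true ∧ ∀ e ∈ L, ¬ haltsBy O e k j

theorem evaln_isSome_mono {c : Code} {k l n : ℕ} (hkl : k ≤ l) (h : (c.evaln k n).isSome = true) :
    (c.evaln l n).isSome = true := by
  rw [Option.isSome_iff_exists] at h ⊢
  obtain ⟨x, hx⟩ := h
  exact ⟨x, Code.evaln_mono hkl hx⟩

theorem haltsBy_mono {O : Code} {e k j : ℕ} (h : haltsBy O e k (j / 2)) : haltsBy O e (k + 1) j := by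
  obtain ⟨l, hl, h⟩ := h
  refine ⟨l, by omega, evaln_isSome_mono (Nat.le_succ k) ?_⟩
  rwa [Nat.div_div_eq_div_mul, ← pow_succ', show k - l + 1 = k + 1 - l by omega] at h

variable {A u G} (hA : Primrec₂ A) (hAd : ∀ k j, A (k + 1) j = true → A k (j / 2) = true)

include hAd in
theorem avoid_down {O : Code} {L : List ℕ} {k j : ℕ} (h : avoid A O L (k + 1) j) :
    avoid A O L k (j / 2) :=
  ⟨hAd k j h.1, fun e he hh => h.2 e he (haltsBy_mono hh)⟩

theorem primrec_two_pow : Primrec fun n : ℕ => 2 ^ n :=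
  (Primrec.nat_rec₁ (f := fun _ v => v * 2) 1
    (Primrec.nat_mul.comp Primrec.snd (Primrec.const 2))).of_eq fun n => by
      induction n with
      | zero => rfl
      | succ n ih => simp only [ih, pow_succ]

theorem primrec_div_pow : Primrec₂ fun (j n : ℕ) => j / 2 ^ n :=
  Primrec.nat_div.comp Primrec.fst (primrec_two_pow.comp Primrec.snd)

theorem haltsBy_primrec (O : Code) :
    PrimrecPred fun t : ℕ × ℕ × ℕ => haltsBy O t.1 t.2.1 t.2.2 := by
  have h : PrimrecRel fun (l : ℕ) (t : ℕ × ℕ × ℕ) =>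
      ((OracleCode.ofNat t.1).toCode (Code.curry O (Nat.pair l (t.2.2 / 2 ^ (t.2.1 - l)))) |>.evaln
        t.2.1 t.1).isSome = true := by
    have he : Primrec fun q : ℕ × ℕ × ℕ × ℕ => q.2.1 := Primrec.fst.comp Primrec.snd
    have hk : Primrec fun q : ℕ × ℕ × ℕ × ℕ => q.2.2.1 :=
      Primrec.fst.comp (Primrec.snd.comp Primrec.snd)
    have hj : Primrec fun q : ℕ × ℕ × ℕ × ℕ => q.2.2.2 :=
      Primrec.snd.comp (Primrec.snd.comp Primrec.snd)
    have hO : Primrec fun q : ℕ × ℕ × ℕ × ℕ =>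
        Code.curry O (Nat.pair q.1 (q.2.2.2 / 2 ^ (q.2.2.1 - q.1))) :=
      Code.primrec₂_curry.comp (Primrec.const O) (Primrec₂.natPair.comp Primrec.fst
        (primrec_div_pow.comp hj (Primrec.nat_sub.comp hk Primrec.fst)))
    have hc := primrec_toCode.comp hO he
    have hev := Code.primrec_evaln.comp (Primrec.pair (Primrec.pair hk hc) he)
    exact Primrec.eq.comp (Primrec.option_isSome.comp hev) (Primrec.const true)
  have h2 := primrecRel_exists_lt h
  have h3 : Primrec fun t : ℕ × ℕ × ℕ => t.2.1 + 1 :=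
    Primrec.succ.comp (Primrec.fst.comp Primrec.snd)
  have h4 : Primrec fun t : ℕ × ℕ × ℕ => t := Primrec.id
  refine (PrimrecRel.comp h2 h3 h4).of_eq fun t => ?_
  simp only [haltsBy, Nat.lt_succ_iff]

include hA in
theorem avoid_primrec (O : Code) : PrimrecPred fun t : List ℕ × ℕ × ℕ => avoid A O t.1 t.2.1 t.2.2 := by
  have h1 : PrimrecPred fun t : List ℕ × ℕ × ℕ => A t.2.1 t.2.2 = true :=
    Primrec.eq.comp (hA.comp (Primrec.fst.comp Primrec.snd) (Primrec.snd.comp Primrec.snd))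
      (Primrec.const true)
  have h2 : PrimrecRel fun (e : ℕ) (t : ℕ × ℕ) => ¬ haltsBy O e t.1 t.2 := (haltsBy_primrec O).not
  exact h1.and ((PrimrecRel.forall_mem_list h2).comp Primrec.fst Primrec.snd)

/-- The tree `avoid A O L` has no vertex on the level `k`. -/
def emptyAt (A : ℕ → ℕ → Bool) (O : Code) (L : List ℕ) (k : ℕ) : Prop := ∀ j < 2 ^ k, ¬ avoid A O L k j

include hA in
theorem emptyAt_primrec (O : Code) : PrimrecRel fun (L : List ℕ) (k : ℕ) => emptyAt A O L k := by
  have h : PrimrecRel fun (j : ℕ) (t : List ℕ × ℕ) => ¬ avoid A O t.1 t.2 j :=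
    ((avoid_primrec hA O).comp (Primrec.pair (Primrec.fst.comp Primrec.snd)
      (Primrec.pair (Primrec.snd.comp Primrec.snd) Primrec.fst))).not
  have h2 := primrecRel_forall_lt h
  have h3 : Primrec fun t : List ℕ × ℕ => 2 ^ t.2 := primrec_two_pow.comp Primrec.snd
  have h4 : Primrec fun t : List ℕ × ℕ => t := Primrec.id
  change PrimrecPred fun t : List ℕ × ℕ => ∀ j < 2 ^ t.2, ¬ avoid A O t.1 t.2 j
  exact PrimrecRel.comp h2 h3 h4

include hA in
/-- Whether `avoid A O L` is finite can be asked from every jump. -/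
theorem exists_query_empty (O : Code) : ∃ r : ℕ → ℕ, Computable r ∧ ∀ g (L : List ℕ),
    jump g (r (Encodable.encode L)) = 1 ↔ ∃ k, emptyAt A O L k := by
  classical
  have h := emptyAt_primrec hA O
  have h1 : Partrec fun n : ℕ => Nat.rfind fun k =>
      (Part.some (decide (emptyAt A O (Denumerable.ofNat (List ℕ) n) k)) : Part Bool) := by
    refine Partrec.rfind ?_
    have h2 : PrimrecRel fun (n k : ℕ) => emptyAt A O (Denumerable.ofNat (List ℕ) n) k :=
      h.comp ((Primrec.ofNat _).comp Primrec.fst) Primrec.snd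
    exact (h2.decide.to_comp : Computable _).partrec
  obtain ⟨r, hr, hr2⟩ := exists_query (Partrec.nat_iff.1 h1)
  refine ⟨r, hr, fun g L => ((hr2 g _).trans Nat.rfind_dom).trans ?_⟩
  constructor
  · rintro ⟨k, hk, -⟩
    have := Part.mem_some_iff.1 hk
    rw [Denumerable.ofNat_encode] at this
    exact ⟨k, by simpa using this.symm⟩
  · rintro ⟨k, hk⟩
    refine ⟨k, Part.mem_some_iff.2 ?_, fun _ => trivial⟩
    rw [Denumerable.ofNat_encode]
    simpa using hk

open Classical in
/-- The list of the programs below `n` that can be kept from halting, decided one after the other. -/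
noncomputable def forced (A : ℕ → ℕ → Bool) (O : Code) : ℕ → List ℕ
  | 0 => []
  | n + 1 => if ∃ k, emptyAt A O (n :: forced A O n) k then forced A O n else n :: forced A O n

/-- Keeping all programs in the list from halting leaves an infinite tree. -/
theorem forced_infinite (hA0 : ∀ k, ∃ j < 2 ^ k, A k j = true) (O : Code) :
    ∀ n k, ¬ emptyAt A O (forced A O n) k
  | 0, k, h => by
    obtain ⟨j, hj, h2⟩ := hA0 k
    exact h j hj ⟨h2, fun e he => by simp [forced] at he⟩
  | n + 1, k, h => by
    unfold forced at h
    split_ifs at h with hc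
    · exact forced_infinite hA0 O n k h
    · exact hc ⟨k, h⟩

theorem forced_subset (O : Code) {n m : ℕ} (h : n ≤ m) : forced A O n ⊆ forced A O m := by
  induction m, h using Nat.le_induction with
  | base => exact List.Subset.refl _
  | succ m _ ih =>
    rw [forced]
    split_ifs
    · exact ih
    · exact List.Subset.trans ih (List.subset_cons_self _ _)

/-- The low basis theorem, for functions that are computed from a path with known use. -/
theorem low_basis (hA : Primrec₂ A) (hAd : ∀ k j, A (k + 1) j = true → A k (j / 2) = true)
    (hA0 : ∀ k, ∃ j < 2 ^ k, A k j = true) (hu : Computable u) (hG : Computable₂ G) :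
    ∃ x : ℕ → ℕ, (∀ n, x n < 2 ^ n ∧ A n (x n) = true ∧ x (n + 1) / 2 = x n) ∧
      IsLow fun n => G n (x (u n)) := by
  classical
  obtain ⟨O, hO⟩ : ∃ O : Code, ∀ l j, (Code.curry O (Nat.pair l j)).eval = segment u G (l, j) := by
    have h1 : Partrec fun t : ℕ => (segment u G t.unpair.1.unpair t.unpair.2 : Part ℕ) := by
      have hs : Computable fun t : ℕ => t.unpair.1.unpair :=
        (Primrec.unpair.comp (Primrec.fst.comp Primrec.unpair)).to_comp
      have hn : Computable fun t : ℕ => t.unpair.2 := (Primrec.snd.comp Primrec.unpair).to_comp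
      have hun := hu.comp hn
      have hc : Computable fun t : ℕ => decide (u t.unpair.2 ≤ t.unpair.1.unpair.1) :=
        (Primrec.nat_le.decide.to_comp : Computable₂ fun a b : ℕ => decide (a ≤ b)).comp hun
          (Computable.fst.comp hs)
      have hv : Computable fun t : ℕ => G t.unpair.2 (t.unpair.1.unpair.2 /
          2 ^ (t.unpair.1.unpair.1 - u t.unpair.2)) :=
        hG.comp hn (primrec_div_pow.to_comp.comp (Computable.snd.comp hs)
          (Primrec.nat_sub.to_comp.comp (Computable.fst.comp hs) hun))
      refine (Partrec.cond hc hv.partrec Partrec.none).of_eq fun t => ?_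
      by_cases h : u t.unpair.2 ≤ t.unpair.1.unpair.1 <;> simp [h, segment]
    obtain ⟨O, hO⟩ := Code.exists_code.1 (Partrec.nat_iff.1 h1)
    refine ⟨O, fun l j => funext fun n => ?_⟩
    rw [Code.eval_curry, hO]
    simp
  obtain ⟨x, hx⟩ := exists_path (S := fun n j => avoid A O (forced A O n) n j)
    (fun n j h => by
      have h2 := avoid_down hAd h
      exact ⟨h2.1, fun e he => h2.2 e (forced_subset O (Nat.le_succ n) he)⟩)
    (fun n => by
      have := forced_infinite hA0 O n n
      unfold emptyAt at this
      push Not at this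
      exact this)
  refine ⟨x, fun n => ⟨(hx n).1, (hx n).2.1.1, (hx n).2.2⟩, ?_⟩
  set g : ℕ → ℕ := fun n => G n (x (u n)) with hg
  have hxd : ∀ k m, x (k + m) / 2 ^ m = x k := by
    intro k m
    induction m with
    | zero => simp
    | succ m ih => rw [pow_succ', ← Nat.div_div_eq_div_mul, ← add_assoc, (hx _).2.2, ih]
  have hseg : ∀ k n v, v ∈ segment u G (k, x k) n ↔ u n ≤ k ∧ v = g n := by
    intro k n v
    unfold segment
    split_ifs with h
    · have := hxd (u n) (k - u n)
      rw [Nat.add_sub_cancel' h] at this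
      simp [h, this, hg]
    · simp [h]
  -- a program halts with the oracle `g` if and only if this is seen at some vertex of the path
  have hhalt : ∀ e, ((OracleCode.ofNat e).eval g e).Dom ↔ ∃ k, haltsBy O e k (x k) := by
    intro e
    rw [eval_eq_peval]
    have hcont := fun v => peval_continuous (g := fun n => Part.some (g n))
      (s := fun k => segment u G (k, x k))
      (fun k l hkl n v hv => by rw [hseg] at hv ⊢; exact ⟨hv.1.trans hkl, hv.2⟩)
      (fun n v => by
        simp only [hseg, Part.mem_some_iff]
        exact ⟨fun h => ⟨u n, le_rfl, h⟩, fun ⟨_, _, h⟩ => h⟩) (OracleCode.ofNat e) e v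
    have hcode : ∀ l, (OracleCode.ofNat e).peval (segment u G (l, x l)) =
        ((OracleCode.ofNat e).toCode (Code.curry O (Nat.pair l (x l)))).eval := fun l => by
      rw [eval_toCode, hO]
    constructor
    · intro h
      obtain ⟨l, hl⟩ := (hcont _).2.1 (Part.get_mem h)
      rw [hcode] at hl
      obtain ⟨m, hm⟩ := Code.evaln_complete.1 hl
      refine ⟨l + m, l, by omega, ?_⟩
      rw [Nat.add_sub_cancel_left, hxd]
      exact evaln_isSome_mono (Nat.le_add_left m l) (Option.isSome_iff_exists.2 ⟨_, hm⟩)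
    · rintro ⟨k, l, hlk, h⟩
      have h1 := hxd l (k - l)
      rw [Nat.add_sub_cancel' hlk] at h1
      rw [h1] at h
      obtain ⟨v, hv⟩ := Option.isSome_iff_exists.1 h
      have h2 := Code.evaln_sound hv
      rw [← hcode] at h2
      exact Part.dom_iff_mem.2 ⟨v, (hcont v).2.2 ⟨l, h2⟩⟩
  have hav : ∀ n k, avoid A O (forced A O n) k (x k) := by
    intro n k
    rcases le_total n k with h | h
    · exact ⟨(hx k).2.1.1, fun e he => (hx k).2.1.2 e (forced_subset O h he)⟩
    · have h1 := (hx n).2.1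
      have key : ∀ m, avoid A O (forced A O n) (k + m) (x (k + m)) →
          avoid A O (forced A O n) k (x k) := by
        intro m
        induction m with
        | zero => exact fun h => h
        | succ m ih =>
          intro h
          have := avoid_down hAd (k := k + m) h
          change avoid A O _ (k + m) (x (k + m + 1) / 2) at this
          rw [(hx (k + m)).2.2] at this
          exact ih this
      refine key (n - k) ?_
      rwa [Nat.add_sub_cancel' h]
  have hjump : ∀ e, jump g e = 1 ↔ ∃ k, emptyAt A O (e :: forced A O e) k := by
    intro e
    have h1 : jump g e = 1 ↔ ((OracleCode.ofNat e).eval g e).Dom := by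
      unfold jump; split_ifs with h <;> simp [h]
    rw [h1, hhalt]
    constructor
    · rintro ⟨k, hk⟩
      by_contra hcon
      have h2 := hav (e + 1) k
      rw [forced, if_neg hcon] at h2
      exact h2.2 e (by simp) hk
    · rintro ⟨k, hk⟩
      have h2 := hk (x k) (hx k).1
      by_contra hcon
      refine h2 ⟨(hav e k).1, fun e' he' => ?_⟩
      rcases List.mem_cons.1 he' with rfl | h3
      · exact fun h => hcon ⟨k, h⟩
      · exact (hav e k).2 e' h3
  obtain ⟨r, hr, hr2⟩ := exists_query_empty hA O
  have h01 : ∀ g e, jump g e = 0 ∨ jump g e = 1 := by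
    intro g e; unfold jump; split_ifs <;> simp
  set Z : Set (ℕ →. ℕ) := {fun n => Part.some (jump (fun _ => 0) n)} with hZ
  have hq : Nat.RecursiveIn Z fun n => Part.some (jump (fun _ => 0) (r n)) := by
    have := Nat.RecursiveIn.comp (Nat.RecursiveIn.oracle (O := Z) _ rfl)
      (Nat.Partrec.recursiveIn (Partrec.nat_iff.1 hr.partrec))
    exact this.of_eq fun n => by
      exact Part.bind_some _ _
  -- the number of the list `e :: L`, given `e` and the number of `L`
  set cons : ℕ → ℕ → ℕ := fun e v =>
    Encodable.encode (e :: Denumerable.ofNat (List ℕ) v) with hcons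
  have hconsP : Primrec₂ cons := Primrec.encode.comp (Primrec.list_cons.comp Primrec.fst
    ((Primrec.ofNat _).comp Primrec.snd))
  have hqc : Nat.RecursiveIn Z fun z => Part.some (jump (fun _ => 0)
      (r (cons z.unpair.2.unpair.1 z.unpair.2.unpair.2))) := by
    have h1 : Primrec fun z : ℕ => cons z.unpair.2.unpair.1 z.unpair.2.unpair.2 :=
      hconsP.comp (Primrec.fst.comp (Primrec.unpair.comp (Primrec.snd.comp Primrec.unpair)))
        (Primrec.snd.comp (Primrec.unpair.comp (Primrec.snd.comp Primrec.unpair)))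
    have := Nat.RecursiveIn.comp hq (Nat.Partrec.recursiveIn (Partrec.nat_iff.1 h1.to_comp.partrec))
    exact this.of_eq fun n => by exact Part.bind_some _ _
  set next : ℕ → ℕ → ℕ := fun z q =>
    if q = 1 then z.unpair.2.unpair.2 else cons z.unpair.2.unpair.1 z.unpair.2.unpair.2 with hnext
  have hnextR : Nat.RecursiveIn Z fun z => Part.some (next z (jump (fun _ => 0)
      (r (cons z.unpair.2.unpair.1 z.unpair.2.unpair.2)))) := by
    have h1 : Primrec fun t : ℕ => next t.unpair.1 t.unpair.2 := by
      have hz : Primrec fun t : ℕ => t.unpair.1.unpair.2.unpair :=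
        Primrec.unpair.comp (Primrec.snd.comp (Primrec.unpair.comp
          (Primrec.fst.comp Primrec.unpair)))
      exact Primrec.ite (Primrec.eq.comp (Primrec.snd.comp Primrec.unpair) (Primrec.const 1))
        (Primrec.snd.comp hz) (hconsP.comp (Primrec.fst.comp hz) (Primrec.snd.comp hz))
    have h2 := Nat.RecursiveIn.comp
      (Nat.Partrec.recursiveIn (Partrec.nat_iff.1 h1.to_comp.partrec))
      (Nat.RecursiveIn.pair (Nat.Partrec.recursiveIn (Partrec.nat_iff.1
        (Computable.id (α := ℕ)).partrec)) hqc)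
    refine h2.of_eq fun n => ?_
    have e : (Nat.pair <$> (Part.some n) <*> Part.some (jump (fun _ => 0)
        (r (cons n.unpair.2.unpair.1 n.unpair.2.unpair.2))) : Part ℕ) =
        Part.some (Nat.pair n (jump (fun _ => 0)
          (r (cons n.unpair.2.unpair.1 n.unpair.2.unpair.2)))) := by simp [Seq.seq]
    refine (congrArg (fun p : Part ℕ => p.bind _) e).trans ((Part.bind_some _ _).trans ?_)
    simp
  have hforced : Nat.RecursiveIn Z fun n => Part.some (Encodable.encode (forced A O n)) := by
    have h0 : Nat.RecursiveIn Z fun _ : ℕ => Part.some (Encodable.encode ([] : List ℕ)) :=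
      Nat.Partrec.recursiveIn (Partrec.nat_iff.1
        (Computable.const (Encodable.encode ([] : List ℕ)) (α := ℕ)).partrec)
    have h1 := Nat.RecursiveIn.prec h0 hnextR
    have h2 : Nat.RecursiveIn Z fun n : ℕ => Part.some (Nat.pair 0 n) :=
      Nat.Partrec.recursiveIn (Partrec.nat_iff.1
        (Primrec₂.natPair.comp (Primrec.const 0) Primrec.id).to_comp.partrec)
    refine (Nat.RecursiveIn.comp h1 h2).of_eq fun n => ?_
    refine (Part.bind_some _ _).trans ?_
    simp only [Nat.unpair_pair]
    induction n with
    | zero => rfl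
    | succ n ih =>
      simp only
      refine (congrArg (fun p : Part ℕ => p.bind _) ih).trans ?_
      refine (Part.bind_some _ _).trans ?_
      congr 1
      simp only [Nat.unpair_pair, hnext, hcons, Denumerable.ofNat_encode]
      rw [forced]
      have := hr2 (fun _ => 0) (n :: forced A O n)
      split_ifs <;> simp_all
  constructor
  · -- the jump of `g` is computable from the halting problem
    show RecursiveIn Z _
    refine RecursiveIn.iff_nat.2 ?_
    have h1 : Primrec fun t : ℕ => cons t.unpair.1 t.unpair.2 :=
      hconsP.comp (Primrec.fst.comp Primrec.unpair) (Primrec.snd.comp Primrec.unpair)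
    have h2 := Nat.RecursiveIn.comp hq (Nat.RecursiveIn.comp
      (Nat.Partrec.recursiveIn (Partrec.nat_iff.1 h1.to_comp.partrec))
      (Nat.RecursiveIn.pair (Nat.Partrec.recursiveIn (Partrec.nat_iff.1
        (Computable.id (α := ℕ)).partrec)) hforced))
    refine h2.of_eq fun n => ?_
    have h3 : jump g n = jump (fun _ => 0) (r (cons n (Encodable.encode (forced A O n)))) := by
      have e1 := hjump n
      have e2 := hr2 (fun _ => 0) (n :: forced A O n)
      have e3 : cons n (Encodable.encode (forced A O n)) = Encodable.encode (n :: forced A O n) := by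
        simp only [hcons, Denumerable.ofNat_encode]
      rw [e3]
      rcases h01 g n with h | h <;>
        rcases h01 (fun _ => 0) (r (Encodable.encode (n :: forced A O n))) with h' | h'
      · rw [h, h']
      · rw [h'] at e2; rw [h] at e1; exact absurd (e1.2 (e2.1 rfl)) (by simp)
      · rw [h'] at e2; rw [h] at e1; exact absurd (e2.2 (e1.1 rfl)) (by simp)
      · rw [h, h']
    rw [h3]
    have e : (Nat.pair <$> (Part.some n) <*> Part.some (Encodable.encode (forced A O n)) : Part ℕ) =
        Part.some (Nat.pair n (Encodable.encode (forced A O n))) := by simp [Seq.seq]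
    have e2 : ((Nat.pair <$> (Part.some n) <*> Part.some (Encodable.encode (forced A O n)) :
        Part ℕ).bind fun t => Part.some (cons t.unpair.1 t.unpair.2)) =
        Part.some (cons n (Encodable.encode (forced A O n))) := by
      rw [e, Part.bind_some, Nat.unpair_pair]
    exact (congrArg (fun p : Part ℕ => p.bind _) e2).trans (Part.bind_some _ _)
  · -- the halting problem is computable from every jump
    have hp : Nat.Partrec fun n => (OracleCode.ofNat n).eval (fun _ => 0) n := by
      have h1 : Primrec fun n : ℕ => (OracleCode.ofNat n).toCode Code.zero :=
        primrec_toCode.comp (Primrec.const _) Primrec.id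
      have h2 : Partrec fun n : ℕ => ((OracleCode.ofNat n).toCode Code.zero).eval n :=
        Code.eval_part.comp h1.to_comp Computable.id
      refine Partrec.nat_iff.1 (h2.of_eq fun n => ?_)
      rw [eval_toCode, eval_eq_peval]; rfl
    obtain ⟨r', hr', hr2'⟩ := exists_query hp
    show RecursiveIn {fun n => Part.some (jump g n)} _
    refine RecursiveIn.iff_nat.2 ?_
    have := Nat.RecursiveIn.comp (Nat.RecursiveIn.oracle
      (O := {fun n => Part.some (jump g n)}) _ rfl)
      (Nat.Partrec.recursiveIn (Partrec.nat_iff.1 hr'.partrec))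
    refine this.of_eq fun n => ?_
    refine (Part.bind_some _ _).trans ?_
    congr 1
    have e1 := hr2' g n
    have e2 : jump (fun _ => 0) n = 1 ↔ ((OracleCode.ofNat n).eval (fun _ => 0) n).Dom := by
      unfold jump; split_ifs with h <;> simp [h]
    rcases h01 g (r' n) with h | h <;> rcases h01 (fun _ => 0) n with h' | h'
    · rw [h, h']
    · rw [h'] at e2; rw [h] at e1; exact absurd (e1.2 (e2.1 rfl)) (by simp)
    · rw [h'] at e2; rw [h] at e1; exact absurd (e2.2 (e1.1 rfl)) (by simp)
    · rw [h, h']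

end lowBasis

/-! ### A computable tree without computable paths -/

/-- The bit with index `i` of the number `j` of a vertex of level `k`. -/
def bit (k j i : ℕ) : ℕ := j / 2 ^ (k - 1 - i) % 2

/-- The number `j` describes a sequence of `k` bits such that no program is seen within `k` steps to
output on its own number the bit with this index. -/
def alive (k j : ℕ) : Bool :=
  decide (∀ i < k, (Denumerable.ofNat Code i).evaln k i ≠ some (bit k j i))

theorem alive_primrec : Primrec₂ alive := by
  have h : PrimrecRel fun (i : ℕ) (t : ℕ × ℕ) =>
      (Denumerable.ofNat Code i).evaln t.1 i ≠ some (bit t.1 t.2 i) := by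
    refine PrimrecPred.not (Primrec.eq.comp
      (Code.primrec_evaln.comp (Primrec.pair (Primrec.pair (Primrec.fst.comp Primrec.snd)
        ((Primrec.ofNat Code).comp Primrec.fst)) Primrec.fst)) (Primrec.option_some.comp ?_))
    exact Primrec.nat_mod.comp (primrec_div_pow.comp (Primrec.snd.comp Primrec.snd)
      (Primrec.nat_sub.comp (Primrec.nat_sub.comp (Primrec.fst.comp Primrec.snd) (Primrec.const 1))
        Primrec.fst)) (Primrec.const 2)
  have h2 := primrecRel_forall_lt h
  have h4 : Primrec fun t : ℕ × ℕ => t := Primrec.id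
  exact (PrimrecRel.comp h2 Primrec.fst h4).decide.of_eq fun t => by simp only [alive]

theorem alive_down (k j : ℕ) (h : alive (k + 1) j = true) : alive k (j / 2) = true := by
  simp only [alive, decide_eq_true_eq] at h ⊢
  intro i hi hc
  refine h i (by omega) (Code.evaln_mono (Nat.le_succ k) ?_)
  rw [Option.mem_def, hc, bit, bit, Nat.div_div_eq_div_mul, ← pow_succ']
  congr 5
  omega

theorem alive_zero : alive 0 0 = true := by simp [alive]

/-- There are vertices on all levels, since one of the two values differs from a given output. -/
theorem exists_alive (k : ℕ) : ∃ j < 2 ^ k, alive k j = true := by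
  set b : ℕ → ℕ := fun i => if (Denumerable.ofNat Code i).evaln k i = some 0 then 1 else 0 with hb
  have key : ∀ n, ∃ j < 2 ^ n, ∀ i < n, bit n j i = b i := by
    intro n
    induction n with
    | zero => exact ⟨0, by simp, fun i hi => by omega⟩
    | succ n ih =>
      obtain ⟨j, hj, h⟩ := ih
      have hb2 : b n < 2 := by simp only [hb]; split_ifs <;> omega
      refine ⟨2 * j + b n, by rw [pow_succ]; omega, fun i hi => ?_⟩
      rcases Nat.lt_succ_iff_lt_or_eq.1 hi with h1 | rfl
      · rw [← h i h1, bit, bit, show n + 1 - 1 - i = n - 1 - i + 1 by omega, pow_succ',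
          ← Nat.div_div_eq_div_mul]
        congr 2; omega
      · rw [bit, show i + 1 - 1 - i = 0 by omega, pow_zero, Nat.div_one]; omega
  obtain ⟨j, hj, h⟩ := key k
  refine ⟨j, hj, ?_⟩
  simp only [alive, decide_eq_true_eq]
  intro i hi
  rw [h i hi]
  simp only [hb]
  split_ifs with h1
  · rw [h1]; simp
  · exact h1

/-- A program for the last bits of a computable path would output on its own number the bit that is
forbidden there. -/
theorem no_computable_path : ¬ ∃ x : ℕ → ℕ, Computable x ∧ ∀ n, alive n (x n) = true ∧
    x (n + 1) / 2 = x n := by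
  rintro ⟨x, hx, h⟩
  have h1 : Computable fun n => x (n + 1) % 2 :=
    Primrec.nat_mod.to_comp.comp (hx.comp Computable.succ) (Computable.const 2)
  obtain ⟨c, hc⟩ := Code.exists_code.1 (Partrec.nat_iff.1 h1.partrec)
  set i := Encodable.encode c with hi
  have h2 : x (i + 1) % 2 ∈ c.eval i := by rw [hc]; exact Part.mem_some _
  obtain ⟨k, hk⟩ := Code.evaln_complete.1 h2
  have h3 := (h (i + 1 + k)).1
  simp only [alive, decide_eq_true_eq] at h3
  refine h3 i (by omega) ?_
  rw [hi, Denumerable.ofNat_encode, ← hi]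
  refine (Code.evaln_mono (by omega) hk).trans ?_
  congr 1
  have hxd : ∀ k m, x (k + m) / 2 ^ m = x k := by
    intro k m
    induction m with
    | zero => simp
    | succ m ih => rw [pow_succ', ← Nat.div_div_eq_div_mul, ← add_assoc, (h _).2, ih]
  rw [bit, show i + 1 + k - 1 - i = k by omega, hxd]


/-! ### Computable functions on integers -/

theorem primrec_int_toNat : Primrec Int.toNat := by
  have h : Primrec fun z : ℤ => if Encodable.encode z % 2 = 0 then Encodable.encode z / 2 else 0 :=
    Primrec.ite (Primrec.eq.comp (Primrec.nat_mod.comp Primrec.encode (Primrec.const 2))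
      (Primrec.const 0)) (Primrec.nat_div.comp Primrec.encode (Primrec.const 2)) (Primrec.const 0)
  refine h.of_eq fun z => ?_
  rcases z with n | n
  · have : Encodable.encode (Int.ofNat n) = 2 * n := rfl
    rw [this]; simp
  · have : Encodable.encode (Int.negSucc n) = 2 * n + 1 := rfl
    rw [this]; simp [Nat.add_mod]

theorem primrec_int_negToNat : Primrec fun z : ℤ => (-z).toNat := by
  have h : Primrec fun z : ℤ => if Encodable.encode z % 2 = 0 then 0 else Encodable.encode z / 2 + 1 :=
    Primrec.ite (Primrec.eq.comp (Primrec.nat_mod.comp Primrec.encode (Primrec.const 2))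
      (Primrec.const 0)) (Primrec.const 0)
      (Primrec.succ.comp (Primrec.nat_div.comp Primrec.encode (Primrec.const 2)))
  refine h.of_eq fun z => ?_
  rcases z with n | n
  · have : Encodable.encode (Int.ofNat n) = 2 * n := rfl
    rw [this]; simp
  · have : Encodable.encode (Int.negSucc n) = 2 * n + 1 := rfl
    rw [this, if_neg (by omega)]
    simp only [Int.neg_negSucc]
    omega

theorem primrec_int_sub_nat : Primrec₂ fun m n : ℕ => (m : ℤ) - n := by
  have h : Primrec₂ fun m n : ℕ => if n ≤ m then Denumerable.ofNat ℤ (2 * (m - n))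
      else Denumerable.ofNat ℤ (2 * (n - m - 1) + 1) := by
    refine Primrec.ite (Primrec.nat_le.comp Primrec.snd Primrec.fst)
      ((Primrec.ofNat ℤ).comp (Primrec.nat_mul.comp (Primrec.const 2)
        (Primrec.nat_sub.comp Primrec.fst Primrec.snd)))
      ((Primrec.ofNat ℤ).comp (Primrec.succ.comp (Primrec.nat_mul.comp (Primrec.const 2)
        (Primrec.nat_sub.comp (Primrec.nat_sub.comp Primrec.snd Primrec.fst) (Primrec.const 1)))))
  refine h.of_eq fun m n => ?_
  have h1 : ∀ k : ℕ, Denumerable.ofNat ℤ (2 * k) = (k : ℤ) := fun k =>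
    Denumerable.ofNat_of_decode (Encodable.encodek (Int.ofNat k))
  have h2 : ∀ k : ℕ, Denumerable.ofNat ℤ (2 * k + 1) = Int.negSucc k := fun k =>
    Denumerable.ofNat_of_decode (Encodable.encodek (Int.negSucc k))
  split_ifs with h
  · rw [h1]; omega
  · rw [h2]; omega

theorem primrec_int_add : Primrec₂ fun a b : ℤ => a + b := by
  have h : Primrec₂ fun a b : ℤ => ((a.toNat + b.toNat : ℕ) : ℤ) - ((-a).toNat + (-b).toNat : ℕ) :=
    primrec_int_sub_nat.comp
      (Primrec.nat_add.comp (primrec_int_toNat.comp Primrec.fst) (primrec_int_toNat.comp Primrec.snd))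
      (Primrec.nat_add.comp (primrec_int_negToNat.comp Primrec.fst)
        (primrec_int_negToNat.comp Primrec.snd))
  exact h.of_eq fun a b => by omega

theorem primrec_int_sub : Primrec₂ fun a b : ℤ => a - b := by
  have h : Primrec₂ fun a b : ℤ => ((a.toNat + (-b).toNat : ℕ) : ℤ) - ((-a).toNat + b.toNat : ℕ) :=
    primrec_int_sub_nat.comp
      (Primrec.nat_add.comp (primrec_int_toNat.comp Primrec.fst)
        (primrec_int_negToNat.comp Primrec.snd))
      (Primrec.nat_add.comp (primrec_int_negToNat.comp Primrec.fst)
        (primrec_int_toNat.comp Primrec.snd))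
  exact h.of_eq fun a b => by omega

theorem primrec_int_natCast : Primrec fun n : ℕ => (n : ℤ) := by
  have h : Primrec fun n : ℕ => (n : ℤ) - (0 : ℕ) :=
    primrec_int_sub_nat.comp Primrec.id (Primrec.const 0)
  exact h.of_eq fun n => by simp

theorem primrec_int_le : PrimrecRel fun a b : ℤ => a ≤ b := by
  have h : PrimrecRel fun a b : ℤ => a.toNat + (-b).toNat ≤ (-a).toNat + b.toNat :=
    Primrec.nat_le.comp
      (Primrec.nat_add.comp (primrec_int_toNat.comp Primrec.fst)
        (primrec_int_negToNat.comp Primrec.snd))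
      (Primrec.nat_add.comp (primrec_int_negToNat.comp Primrec.fst)
        (primrec_int_toNat.comp Primrec.snd))
  exact h.of_eq fun a b => by omega

theorem primrec_square_add : Primrec₂ fun s t : Square => s + t :=
  (Primrec.pair (primrec_int_add.comp (Primrec.fst.comp Primrec.fst) (Primrec.fst.comp Primrec.snd))
    (primrec_int_add.comp (Primrec.snd.comp Primrec.fst) (Primrec.snd.comp Primrec.snd)))

theorem primrec_square_sub : Primrec₂ fun s t : Square => s - t :=
  (Primrec.pair (primrec_int_sub.comp (Primrec.fst.comp Primrec.fst) (Primrec.fst.comp Primrec.snd))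
    (primrec_int_sub.comp (Primrec.snd.comp Primrec.fst) (Primrec.snd.comp Primrec.snd)))

/-! ### Computability of the position after a sequence of moves -/

/-- The square that the piece on `q` came from, if the moves `h` have been made. -/
def source (h : List Move) (q : Square) : Option Square :=
  h.foldr (fun m s => s.bind fun s => if s = m.2 then some m.1 else if s = m.1 then none else some s)
    (some q)

/-- The board after a play is read off from the initial board, by following the piece back to the
square from which it came. -/
theorem after_board_eq (p : Position) (h : List Move) (q : Square) :
    (after p h).board q = (source h q).bind p.board := by
  have hnone : ∀ h : List Move, h.foldr (fun m s => s.bind fun s =>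
      if s = m.2 then some m.1 else if s = m.1 then none else some s) none = none := by
    intro h
    induction h with
    | nil => rfl
    | cons m h ih => rw [List.foldr_cons, ih]; rfl
  induction h using List.reverseRecOn generalizing q with
  | nil => rfl
  | append_singleton h m ih =>
    have e : after p (h ++ [m]) = (after p h).play m := by simp [after]
    rw [e]
    simp only [Position.play, source, List.foldr_append, List.foldr_cons, List.foldr_nil,
      Option.bind_some]
    by_cases h1 : q = m.2
    · rw [if_pos h1, h1, Function.update_self, ih]; rfl
    · rw [if_neg h1, Function.update_of_ne h1]
      by_cases h2 : q = m.1
      · rw [if_pos h2, h2, Function.update_self, hnone]; rfl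
      · rw [if_neg h2, Function.update_of_ne h2, ih]; rfl

theorem computable_after_board {p : Position} (hp : Computable p.board) :
    Computable₂ fun (h : List Move) (q : Square) => (after p h).board q := by
  have h1 : Primrec₂ source := by
    have hd : Primrec₂ fun (t : (List Move × Square) × Move × Option Square) (s : Square) =>
        if s = t.2.1.2 then some t.2.1.1 else if s = t.2.1.1 then none else some s := by
      have hm : Primrec fun (t : ((List Move × Square) × Move × Option Square) × Square) =>
        t.1.2.1 := Primrec.fst.comp (Primrec.snd.comp Primrec.fst)
      exact Primrec.ite (Primrec.eq.comp Primrec.snd (Primrec.snd.comp hm))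
        (Primrec.option_some.comp (Primrec.fst.comp hm))
        (Primrec.ite (Primrec.eq.comp Primrec.snd (Primrec.fst.comp hm)) (Primrec.const none)
          (Primrec.option_some.comp Primrec.snd))
    exact Primrec.list_foldr (f := fun t : List Move × Square => t.1)
      (g := fun t => some t.2) (h := fun _ u => u.2.bind fun s =>
        if s = u.1.2 then some u.1.1 else if s = u.1.1 then none else some s)
      Primrec.fst (Primrec.option_some.comp Primrec.snd)
      (Primrec.option_bind (Primrec.snd.comp Primrec.snd) hd)
  exact (Computable.option_bind h1.to_comp (hp.comp Computable.snd).to₂).of_eq fun t =>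
    (after_board_eq p t.1 t.2).symm

/-- Functions that depend on finitely many computable values of a finite type are computable. -/
theorem computable_of_finite_window {α β γ : Type*} [Primcodable α] [Primcodable β] [Primcodable γ]
    [Finite β] {n : ℕ} {f : Fin n → α → β} (hf : ∀ i, Computable (f i)) (g : (Fin n → β) → γ) :
    Computable fun a => g fun i => f i a := by
  have h1 : Computable fun a => List.Vector.ofFn fun i => f i a := Computable.vector_ofFn hf
  have : Finite (List.Vector β n) := inferInstance
  have h2 : Primrec fun v : List.Vector β n => g v.get := Primrec.dom_finite _
  refine (h2.to_comp.comp h1).of_eq fun a => ?_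
  congr 1
  funext i
  simp


/-! ### A binary tree on the board -/

/-- The nodes of one stage: from the square `(64 j, 256 M)` the tree goes up to the right, makes one
step to the left, and branches. One branch goes up to the left; the other one first goes up to the
right for 32 more steps, so that the two branches reach the rank `512 M` on the squares
`(64 (2 j + b), 512 M)` for `b = 0, 1`. -/
def Stage (M j : ℤ) (q : Square) : Prop :=
  (256 * M ≤ q.2 ∧ q.2 + 1 ≤ 32 * j + 384 * M ∧ q.1 + 256 * M = q.2 + 64 * j) ∨
  (q.2 = 32 * j + 384 * M ∧ q.1 + 2 = 96 * j + 128 * M) ∨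
  (32 * j + 384 * M + 1 ≤ q.2 ∧ q.2 ≤ 32 * j + 384 * M + 33 ∧ q.1 + 256 * M + 2 = q.2 + 64 * j) ∨
  (32 * j + 384 * M + 1 ≤ q.2 ∧ q.2 ≤ 512 * M ∧ q.1 + q.2 = 512 * M + 128 * j) ∨
  (32 * j + 384 * M + 33 ≤ q.2 ∧ q.2 ≤ 512 * M ∧ q.1 + q.2 = 512 * M + 128 * j + 64)

instance (M j : ℤ) (q : Square) : Decidable (Stage M j q) := by unfold Stage; infer_instance

theorem Stage.row {M j : ℤ} {q : Square} (h0 : 0 ≤ j) (hj : j < M) (h : Stage M j q) :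
    256 * M ≤ q.2 ∧ q.2 ≤ 512 * M := by
  rcases h with h | h | h | h | h <;> omega

/-- Different branches of one stage are far from each other. -/
theorem Stage.unique {M j j' : ℤ} {p q : Square} (h : Stage M j p) (h' : Stage M j' q) (h1 : -15 ≤ p.1 - q.1 ∧ p.1 - q.1 ≤ 15)
    (h2 : -15 ≤ p.2 - q.2 ∧ p.2 - q.2 ≤ 15) : j' = j := by
  obtain ⟨x, y⟩ := p
  obtain ⟨x', y'⟩ := q
  simp only [Stage] at h h'
  simp only at h1 h2
  rcases lt_trichotomy j' j with h3 | h3 | h3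
  · exfalso
    rcases h with h | h | h | h | h <;> rcases h' with h' | h' | h' | h' | h' <;> omega
  · exact h3
  · exfalso
    rcases h with h | h | h | h | h <;> rcases h' with h' | h' | h' | h' | h' <;> omega

section binary
variable (A : ℕ → ℕ → Bool)

/-- The nodes of the tree of squares for the binary tree `A`, where `A e j` says whether the `j`-th
vertex at height `e` belongs to the binary tree. -/
def nodes (q : Square) : Bool :=
  decide (∃ e < q.2.toNat, ∃ j < 2 ^ e, A e j = true ∧ Stage ((2 ^ e : ℕ) : ℤ) j q)

/-- The square of the root. -/
def base : Square := (0, 256)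

/-- The root of the tree of squares. -/
def isBase (q : Square) : Bool := decide (q = base)

variable {A}

theorem nodes_iff {q : Square} : nodes A q = true ↔
    ∃ e j : ℕ, j < 2 ^ e ∧ A e j = true ∧ Stage ((2 ^ e : ℕ) : ℤ) j q := by
  rw [nodes, decide_eq_true_iff]
  constructor
  · rintro ⟨e, -, j, h⟩
    exact ⟨e, j, h⟩
  · rintro ⟨e, j, h1, h2, h3⟩
    have h4 := h3.row (by omega) (by exact_mod_cast h1)
    have h5 : e < 2 ^ e := Nat.lt_two_pow_self
    exact ⟨e, by omega, j, h1, h2, h3⟩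

theorem two_mul_two_pow_le {e e' : ℕ} (h : e < e') : 2 * 2 ^ e ≤ 2 ^ e' := by
  rw [← pow_succ']; exact Nat.pow_le_pow_right (by omega) h

/-- Strictly inside the ranks of a stage there are only nodes of this stage. -/
theorem nodes_inner {e : ℕ} {q : Square} (h1 : 256 * ((2 ^ e : ℕ) : ℤ) < q.2)
    (h2 : q.2 < 512 * ((2 ^ e : ℕ) : ℤ)) :
    nodes A q = true ↔ ∃ j < 2 ^ e, A e j = true ∧ Stage ((2 ^ e : ℕ) : ℤ) j q := by
  rw [nodes_iff]
  refine ⟨?_, fun ⟨j, h⟩ => ⟨e, j, h⟩⟩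
  rintro ⟨e', j, h3, h4, h5⟩
  have h6 := h5.row (by omega) (by exact_mod_cast h3)
  rcases lt_trichotomy e e' with h7 | rfl | h7
  · have := two_mul_two_pow_le h7; omega
  · exact ⟨j, h3, h4, h5⟩
  · have := two_mul_two_pow_le h7; omega

/-- Near a node of a stage there are only nodes of the same branch. -/
theorem nodes_near {e j : ℕ} (hj : j < 2 ^ e) (hA : A e j = true) {p q : Square}
    (hp : Stage ((2 ^ e : ℕ) : ℤ) j p) (h1 : 256 * ((2 ^ e : ℕ) : ℤ) < q.2)
    (h2 : q.2 < 512 * ((2 ^ e : ℕ) : ℤ)) (h3 : -15 ≤ p.1 - q.1 ∧ p.1 - q.1 ≤ 15)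
    (h4 : -15 ≤ p.2 - q.2 ∧ p.2 - q.2 ≤ 15) :
    nodes A q = true ↔ Stage ((2 ^ e : ℕ) : ℤ) j q := by
  rw [nodes_inner h1 h2]
  refine ⟨?_, fun h => ⟨j, hj, hA, h⟩⟩
  rintro ⟨j', h5, -, h6⟩
  have := hp.unique h6 h3 h4
  rwa [← this]

/-- The nodes near the top of a stage. -/
theorem nodes_top {e k : ℕ}
    (hk : k < 2 ^ (e + 1)) (hA : A e (k / 2) = true) {q : Square}
    (h1 : -31 ≤ q.1 - 64 * k ∧ q.1 - 64 * k ≤ 31)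
    (h2 : -31 ≤ q.2 - 512 * ((2 ^ e : ℕ) : ℤ) ∧ q.2 - 512 * ((2 ^ e : ℕ) : ℤ) ≤ 31) :
    nodes A q = true ↔ (q.2 ≤ 512 * ((2 ^ e : ℕ) : ℤ) ∧ q.1 + q.2 = 512 * ((2 ^ e : ℕ) : ℤ) + 64 * k) ∨
      (A (e + 1) k = true ∧ 512 * ((2 ^ e : ℕ) : ℤ) ≤ q.2 ∧
        q.1 + 512 * ((2 ^ e : ℕ) : ℤ) = q.2 + 64 * k) := by
  rw [nodes_iff]
  have hpos : 0 < 2 ^ e := by positivity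
  have hsucc : 2 ^ (e + 1) = 2 * 2 ^ e := pow_succ' 2 e
  constructor
  · rintro ⟨e', j, h3, h4, h5⟩
    have h6 := h5.row (by omega) (by exact_mod_cast h3)
    rcases lt_trichotomy e e' with h7 | rfl | h7
    · rcases Nat.lt_or_ge (e + 1) e' with h8 | h8
      · have := two_mul_two_pow_le h8; omega
      · obtain rfl : e' = e + 1 := by omega
        rw [hsucc] at h3 h5 h6 hk
        generalize 2 ^ e = M at *
        push_cast at *
        have : j = k := by
          rcases h5 with h5 | h5 | h5 | h5 | h5 <;> omega
        subst this
        refine .inr ⟨h4, ?_⟩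
        rcases h5 with h5 | h5 | h5 | h5 | h5 <;> omega
    · rw [hsucc] at hk
      generalize 2 ^ e = M at *
      left
      rcases h5 with h5 | h5 | h5 | h5 | h5 <;> omega
    · have := two_mul_two_pow_le h7; omega
  · rintro (h | ⟨h, h3⟩)
    · refine ⟨e, k / 2, by omega, hA, ?_⟩
      rw [hsucc] at hk
      generalize 2 ^ e = M at *
      rcases Nat.mod_two_eq_zero_or_one k with h4 | h4
      · right; right; right; left; omega
      · right; right; right; right; omega
    · refine ⟨e + 1, k, hk, h, ?_⟩
      rw [hsucc] at hk ⊢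
      generalize 2 ^ e = M at *
      left
      push_cast
      omega

theorem mem_places {n : ℤ} {st : Place} (h0 : 0 ≤ n) (h16 : n ≤ 16)
    (h : st = (.root, (n, n)) ∨ st = (.sz, (n, n)) ∨ st = (.sz, (n, -n)) ∨ st = (.leaf, (n, -n)) ∨
      st = (.branch, (n, n)) ∨ st = (.branch, (-n, n)) ∨
      st = (.branch, if n ≤ 1 then (-n, -n) else (2 - n, -n)) ∨ st = (.zs, (-n, n)) ∨
      st = (.zs, (-n, -n))) : st ∈ places := by
  refine List.mem_append_right _ (List.mem_flatMap.2 ⟨n.toNat, List.mem_range.2 (by omega), ?_⟩)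
  rw [Int.toNat_of_nonneg h0]
  simpa [placesAt] using h

/-- Near each node the drawing of the tree is one of the pictures. There are three cases: near the upper
end of a stage, near its lower end, and in between, where only one branch of one stage is in sight. -/
theorem exists_place (hd : ∀ e k, A (e + 1) k = true → A e (k / 2) = true) (hA0 : A 0 0 = true)
    {p : Square} (hp : nodes A p = true) : ∃ st ∈ places, ∀ q, near 15 q = true →
      nodes A (p + q) = st.node q ∧ isBase (p + q) = st.root q := by
  obtain ⟨e, j, hj, hA, hS⟩ := nodes_iff.1 hp
  have hrow := hS.row (by omega) (by exact_mod_cast hj)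
  have hpos : 0 < 2 ^ e := by positivity
  -- it suffices to compare the two pictures as sets
  suffices h : ∃ st ∈ places, ∀ q : Square, (-15 ≤ q.1 ∧ q.1 ≤ 15) → (-15 ≤ q.2 ∧ q.2 ≤ 15) →
      (nodes A (p + q) = true ↔ pic st.1 (st.2 + q) = true) ∧
      (p + q = base ↔ st.1 = .root ∧ st.2 + q = 0) by
    obtain ⟨st, hst, h⟩ := h
    refine ⟨st, hst, fun q hq => ?_⟩
    rw [near_iff] at hq
    obtain ⟨h1, h2⟩ := h q (by omega) (by omega)
    refine ⟨Bool.eq_iff_iff.2 h1, Bool.eq_iff_iff.2 ?_⟩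
    rw [isBase, decide_eq_true_iff, h2]
    simp [Place.root]
  obtain ⟨x, y⟩ := p
  have hS' := hS
  simp only [Stage] at hS hrow
  have hbase : ∀ q : Square, ((x, y) + q = base ↔ x + q.1 = 0 ∧ y + q.2 = 256) := fun q => by
    rw [Prod.ext_iff]; rfl
  by_cases htop : 512 * ((2 ^ e : ℕ) : ℤ) ≤ y + 16
  · obtain ⟨k, hk, hxy⟩ : ∃ k : ℕ, k / 2 = j ∧ x + y = 512 * ((2 ^ e : ℕ) : ℤ) + 64 * k := by
      generalize 2 ^ e = M at *
      rcases hS with h | h | h | h | h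
      · omega
      · omega
      · omega
      · exact ⟨2 * j, by omega, by omega⟩
      · exact ⟨2 * j + 1, by omega, by omega⟩
    have hk2 : k < 2 ^ (e + 1) := by rw [pow_succ']; omega
    have key : ∀ q : Square, (-15 ≤ q.1 ∧ q.1 ≤ 15) → (-15 ≤ q.2 ∧ q.2 ≤ 15) → _ := fun q h1 h2 =>
      nodes_top (A := A) hk2 (by rw [hk]; exact hA) (q := (x, y) + q) (by
        simp only [Prod.fst_add]; omega) (by simp only [Prod.snd_add]; omega)
    simp only [Prod.fst_add, Prod.snd_add] at key
    by_cases hAk : A (e + 1) k = true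
    · refine ⟨(.sz, (512 * ((2 ^ e : ℕ) : ℤ) - y, -(512 * ((2 ^ e : ℕ) : ℤ) - y))),
        mem_places (n := 512 * ((2 ^ e : ℕ) : ℤ) - y) (by omega) (by omega) (by simp), fun q h1 h2 => ⟨?_, ?_⟩⟩
      · rw [key q h1 h2]
        simp only [hAk, true_and, pic, Prod.fst_add, Prod.snd_add, Bool.or_eq_true,
          Bool.and_eq_true, beq_iff_eq, decide_eq_true_eq]
        omega
      · rw [hbase]; simp only [reduceCtorEq, false_and, iff_false]; omega
    · refine ⟨(.leaf, (512 * ((2 ^ e : ℕ) : ℤ) - y, -(512 * ((2 ^ e : ℕ) : ℤ) - y))),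
        mem_places (n := 512 * ((2 ^ e : ℕ) : ℤ) - y) (by omega) (by omega) (by simp), fun q h1 h2 => ⟨?_, ?_⟩⟩
      · rw [key q h1 h2]
        simp only [hAk, false_and, or_false, pic, Prod.fst_add, Prod.snd_add, Bool.false_eq_true,
          Bool.and_eq_true, beq_iff_eq, decide_eq_true_eq]
        omega
      · rw [hbase]; simp only [reduceCtorEq, false_and, iff_false]; omega
  by_cases hbot : y ≤ 256 * ((2 ^ e : ℕ) : ℤ) + 16
  · have hx : x + 256 * ((2 ^ e : ℕ) : ℤ) = y + 64 * j := by
      generalize 2 ^ e = M at *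
      omega
    obtain _ | e := e
    · obtain rfl : j = 0 := by simpa using hj
      simp only [pow_zero, Nat.cast_one, mul_one, Nat.cast_zero, mul_zero, add_zero] at *
      refine ⟨(.root, (y - 256, y - 256)),
        mem_places (n := y - 256) (by omega) (by omega) (by simp), fun q h1 h2 => ⟨?_, ?_⟩⟩
      · simp only [pic, Prod.fst_add, Prod.snd_add, Bool.and_eq_true, beq_iff_eq,
          decide_eq_true_eq]
        rw [nodes_iff]
        constructor
        · rintro ⟨e', j', h3, -, h5⟩
          have h6 := h5.row (by omega) (by exact_mod_cast h3)
          simp only [Prod.snd_add] at h6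
          obtain _ | e' := e'
          · obtain rfl : j' = 0 := by simpa using h3
            simp only [Stage, pow_zero, Nat.cast_one, mul_one, Nat.cast_zero, mul_zero, add_zero,
              Prod.fst_add, Prod.snd_add] at h5
            omega
          · have : 2 * 2 ^ 0 ≤ 2 ^ (e' + 1) := two_mul_two_pow_le (by omega)
            omega
        · intro h3
          refine ⟨0, 0, by simp, hA0, ?_⟩
          left
          simp only [pow_zero, Nat.cast_one, mul_one, Nat.cast_zero, mul_zero, add_zero,
              Prod.fst_add, Prod.snd_add]
          omega
      · rw [hbase, Prod.ext_iff]
        simp only [true_and, Prod.fst_add, Prod.snd_add, Prod.fst_zero, Prod.snd_zero]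
        omega
    · have hsucc : 2 ^ (e + 1) = 2 * 2 ^ e := pow_succ' 2 e
      have hpos' : 0 < 2 ^ e := by positivity
      have hMM : ((2 ^ (e + 1) : ℕ) : ℤ) = 2 * ((2 ^ e : ℕ) : ℤ) := by rw [hsucc]; push_cast; ring
      refine ⟨(.sz, (y - 256 * ((2 ^ (e + 1) : ℕ) : ℤ), y - 256 * ((2 ^ (e + 1) : ℕ) : ℤ))),
        mem_places (n := y - 256 * ((2 ^ (e + 1) : ℕ) : ℤ)) (by omega) (by omega) (by simp), fun q h1 h2 => ⟨?_, ?_⟩⟩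
      · rw [nodes_top hj (hd _ _ hA) (by simp only [Prod.fst_add]; omega)
          (by simp only [Prod.snd_add]; omega)]
        simp only [hA, true_and, pic, Prod.fst_add, Prod.snd_add, Bool.or_eq_true,
          Bool.and_eq_true, beq_iff_eq, decide_eq_true_eq]
        omega
      · rw [hbase]; simp only [reduceCtorEq, false_and, iff_false]; omega
  -- in the interior of a stage
  have key : ∀ q : Square, (-15 ≤ q.1 ∧ q.1 ≤ 15) → (-15 ≤ q.2 ∧ q.2 ≤ 15) → _ := fun q h1 h2 =>
    nodes_near hj hA hS' (q := (x, y) + q) (by simp only [Prod.snd_add]; omega)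
      (by simp only [Prod.snd_add]; omega) (by simp only [Prod.fst_add]; omega)
      (by simp only [Prod.snd_add]; omega)
  simp only [Stage, Prod.fst_add, Prod.snd_add] at key
  have hb : ∀ q : Square, (-15 ≤ q.2 ∧ q.2 ≤ 15) → ¬ ((x, y) + q = base) := fun q h => by
    rw [hbase]; omega
  generalize 2 ^ e = M at *
  clear hd hA0 hbase hA hp hS'
  have fin : ∀ st : Place, st ∈ places → st.1 ≠ .root →
      (∀ q : Square, (-15 ≤ q.1 ∧ q.1 ≤ 15) → (-15 ≤ q.2 ∧ q.2 ≤ 15) →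
        (nodes A ((x, y) + q) = true ↔ pic st.1 (st.2 + q) = true)) →
      ∃ st ∈ places, ∀ q : Square, (-15 ≤ q.1 ∧ q.1 ≤ 15) → (-15 ≤ q.2 ∧ q.2 ≤ 15) →
        (nodes A ((x, y) + q) = true ↔ pic st.1 (st.2 + q) = true) ∧
        ((x, y) + q = base ↔ st.1 = .root ∧ st.2 + q = 0) := fun st h1 h2 h3 =>
    ⟨st, h1, fun q h4 h5 => ⟨h3 q h4 h5, iff_of_false (hb q h5) fun h => h2 h.1⟩⟩
  have hur : (.ur, (0, 0)) ∈ places := List.mem_append_left _ (by simp)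
  have hul : (.ul, (0, 0)) ∈ places := List.mem_append_left _ (by simp)
  rcases hS with h | h | h | h | h
  · by_cases h3 : 32 * (j : ℤ) + 384 * M + 1 ≤ y + 16
    · refine fin (.branch, (2 - (32 * (j : ℤ) + 384 * M + 1 - y), -(32 * (j : ℤ) + 384 * M + 1 - y)))
        (mem_places (n := 32 * (j : ℤ) + 384 * M + 1 - y) (by omega) (by omega)
          (by rw [if_neg (by omega)]; tauto)) (by simp) fun q h1 h2 => ?_
      rw [key q h1 h2]
      simp only [pic, Prod.fst_add, Prod.snd_add, Bool.or_eq_true,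
          Bool.and_eq_true, beq_iff_eq, decide_eq_true_eq]
      omega
    · refine fin _ hur (by simp) fun q h1 h2 => ?_
      rw [key q h1 h2]
      simp only [pic, Prod.fst_add, Prod.snd_add, beq_iff_eq]
      omega
  · refine fin (.branch, (-1, -1)) (mem_places (n := 1) (by omega) (by omega) (by simp))
      (by simp) fun q h1 h2 => ?_
    rw [key q h1 h2]
    simp only [pic, Prod.fst_add, Prod.snd_add, Bool.or_eq_true,
          Bool.and_eq_true, beq_iff_eq, decide_eq_true_eq]
    omega
  · by_cases h3 : y ≤ 32 * (j : ℤ) + 384 * M + 17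
    · refine fin (.branch, (y - (32 * (j : ℤ) + 384 * M + 1), y - (32 * (j : ℤ) + 384 * M + 1)))
        (mem_places (n := y - (32 * (j : ℤ) + 384 * M + 1)) (by omega) (by omega) (by simp)) (by simp) fun q h1 h2 => ?_
      rw [key q h1 h2]
      simp only [pic, Prod.fst_add, Prod.snd_add, Bool.or_eq_true,
          Bool.and_eq_true, beq_iff_eq, decide_eq_true_eq]
      omega
    · refine fin (.zs, (-(32 * (j : ℤ) + 384 * M + 33 - y), -(32 * (j : ℤ) + 384 * M + 33 - y)))
        (mem_places (n := 32 * (j : ℤ) + 384 * M + 33 - y) (by omega) (by omega) (by simp)) (by simp) fun q h1 h2 => ?_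
      rw [key q h1 h2]
      simp only [pic, Prod.fst_add, Prod.snd_add, Bool.or_eq_true,
          Bool.and_eq_true, beq_iff_eq, decide_eq_true_eq]
      omega
  · by_cases h3 : y ≤ 32 * (j : ℤ) + 384 * M + 17
    · refine fin (.branch, (-(y - (32 * (j : ℤ) + 384 * M + 1)), y - (32 * (j : ℤ) + 384 * M + 1)))
        (mem_places (n := y - (32 * (j : ℤ) + 384 * M + 1)) (by omega) (by omega) (by simp)) (by simp) fun q h1 h2 => ?_
      rw [key q h1 h2]
      simp only [pic, Prod.fst_add, Prod.snd_add, Bool.or_eq_true,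
          Bool.and_eq_true, beq_iff_eq, decide_eq_true_eq]
      omega
    · refine fin _ hul (by simp) fun q h1 h2 => ?_
      rw [key q h1 h2]
      simp only [pic, Prod.fst_add, Prod.snd_add, beq_iff_eq]
      omega
  · by_cases h3 : y ≤ 32 * (j : ℤ) + 384 * M + 49
    · refine fin (.zs, (-(y - (32 * (j : ℤ) + 384 * M + 33)), y - (32 * (j : ℤ) + 384 * M + 33)))
        (mem_places (n := y - (32 * (j : ℤ) + 384 * M + 33)) (by omega) (by omega) (by simp)) (by simp) fun q h1 h2 => ?_
      rw [key q h1 h2]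
      simp only [pic, Prod.fst_add, Prod.snd_add, Bool.or_eq_true,
          Bool.and_eq_true, beq_iff_eq, decide_eq_true_eq]
      omega
    · refine fin _ hul (by simp) fun q h1 h2 => ?_
      rw [key q h1 h2]
      simp only [pic, Prod.fst_add, Prod.snd_add, beq_iff_eq]
      omega

theorem nodes_first (hA0 : A 0 0 = true) {q : Square} (h1 : 256 ≤ q.2) (h2 : q.2 ≤ 300)
    (h3 : q.1 + 256 = q.2) : nodes A q = true := by
  refine nodes_iff.2 ⟨0, 0, by simp, hA0, .inl ?_⟩
  simp only [pow_zero, Nat.cast_one, mul_one, Nat.cast_zero, mul_zero, add_zero]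
  omega

theorem tree_nodes (hd : ∀ e k, A (e + 1) k = true → A e (k / 2) = true) (hA0 : A 0 0 = true) :
    Tree (nodes A) isBase base where
  near_eq _ hp := exists_place hd hA0 hp
  root_iff q := by simp [isBase]
  node_root := nodes_first hA0 (by simp [base]) (by simp [base]) (by simp [base])
  le p hp := by
    obtain ⟨e, j, hj, -, hS⟩ := nodes_iff.1 hp
    have := hS.row (by omega) (by exact_mod_cast hj)
    have hpos : 0 < 2 ^ e := by positivity
    simp only [base]; omega
  high := by simp [base]
  even p hp := by
    obtain ⟨e, j, -, -, hS⟩ := nodes_iff.1 hp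
    rw [Int.even_iff]
    generalize ((2 ^ e : ℕ) : ℤ) = M at hS
    rcases hS with h | h | h | h | h <;> omega

theorem child_base (hA0 : A 0 0 = true) : ∃ d ∈ dirs, d.2 = 1 ∧ nodes A (base + d) = true :=
  ⟨(1, 1), by decide, rfl, nodes_first hA0 (by simp [base]) (by simp [base]) (by simp [base])⟩

end binary


/-! ### Infinite paths in the tree of squares -/

section paths
variable {A : ℕ → ℕ → Bool}

/-- The number of the stage that contains the rank `256 + n`. -/
def level : ℕ → ℕ
  | 0 => 0
  | n + 1 => if 512 * 2 ^ level n ≤ 256 + (n + 1) then level n + 1 else level n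

theorem level_spec (n : ℕ) : 256 * 2 ^ level n ≤ 256 + n ∧ 256 + n < 512 * 2 ^ level n := by
  induction n with
  | zero => simp [level]
  | succ n ih =>
    unfold level
    split_ifs with h
    · rw [pow_succ']; omega
    · omega

theorem level_le (n : ℕ) : level n ≤ n := by
  induction n with
  | zero => rfl
  | succ n ih => unfold level; split_ifs <;> omega

/-- The node with rank `r` on the way from the bottom of a stage to the square `(64 k, 512 M)`. -/
def spot (M k r : ℕ) : Square :=
  if r + 1 ≤ 32 * (k / 2) + 384 * M then
    (((64 * (k / 2) + r : ℕ) : ℤ) - (256 * M : ℕ), r)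
  else if r = 32 * (k / 2) + 384 * M then (((96 * (k / 2) + 128 * M : ℕ) : ℤ) - (2 : ℕ), r)
  else if r ≤ 32 * (k / 2) + 384 * M + 1 + 32 * (k % 2) then
    (((64 * (k / 2) + r : ℕ) : ℤ) - (256 * M + 2 : ℕ), r)
  else (((512 * M + 64 * k : ℕ) : ℤ) - (r : ℕ), r)

theorem spot_snd (M k r : ℕ) : (spot M k r).2 = r := by
  unfold spot; split_ifs <;> rfl

theorem stage_spot {M k r : ℕ} (h1 : 256 * M ≤ r) (h2 : r ≤ 512 * M) :
    Stage (M : ℤ) ((k / 2 : ℕ) : ℤ) (spot M k r) := by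
  unfold spot Stage
  split_ifs with h3 h4 h5 <;> simp only
  · left; omega
  · right; left; omega
  · right; right; left; omega
  · rcases Nat.mod_two_eq_zero_or_one k with h6 | h6
    · right; right; right; left; omega
    · right; right; right; right; omega

theorem spot_step (M k r : ℕ) :
    (spot M k (r + 1)).1 - (spot M k r).1 = 1 ∨ (spot M k (r + 1)).1 - (spot M k r).1 = -1 := by
  unfold spot
  split_ifs <;> simp only <;> omega

/-- The ways through two consecutive stages fit together. -/
theorem spot_glue {M k k' : ℕ} (hk : k < 2 * M) (hk' : k' / 2 = k) :
    spot (2 * M) k' (512 * M) = spot M k (512 * M) := by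
  unfold spot
  rw [if_pos (by omega), if_neg (by omega), if_neg (by omega), if_neg (by omega), Prod.mk.injEq]
  omega

/-- The way of the black king that belongs to an infinite path through the binary tree. -/
def ascent (x : ℕ → ℕ) (n : ℕ) : Square := spot (2 ^ level n) (x (level n + 1)) (256 + n)

theorem ascent_zero {x : ℕ → ℕ} (hx : x 1 / 2 = 0) : ascent x 0 = base := by
  unfold ascent spot level
  rw [if_pos (by simp), hx]
  simp [base]

/-- The way that belongs to an infinite path consists of nodes, and leads from parents to children. -/
theorem ascent_spec (hd : ∀ e k, A (e + 1) k = true → A e (k / 2) = true) (hA0 : A 0 0 = true)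
    {x : ℕ → ℕ} (hx : ∀ n, x n < 2 ^ n ∧ A n (x n) = true ∧ x (n + 1) / 2 = x n) (n : ℕ) :
    nodes A (ascent x (n + 1)) = true ∧ par (nodes A) (ascent x (n + 1)) = ascent x n := by
  have hnode : ∀ n, nodes A (ascent x n) = true := by
    intro n
    have := level_spec n
    refine nodes_iff.2 ⟨level n, x (level n + 1) / 2, ?_, ?_, stage_spot this.1 this.2.le⟩
    · rw [(hx _).2.2]; exact (hx _).1
    · rw [(hx _).2.2]; exact (hx _).2.1
  have hrow : (ascent x (n + 1)).2 = (ascent x n).2 + 1 := by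
    unfold ascent; rw [spot_snd, spot_snd]; push_cast; ring
  have hcol : (ascent x (n + 1)).1 - (ascent x n).1 = 1 ∨ (ascent x (n + 1)).1 - (ascent x n).1 = -1 := by
    have h1 := level_spec n
    have h2 : x (level n + 1) < 2 * 2 ^ level n := by rw [← pow_succ']; exact (hx _).1
    have h3 := spot_step (2 ^ level n) (x (level n + 1)) (256 + n)
    have h4 : ascent x (n + 1) = spot (2 ^ level n) (x (level n + 1)) (256 + n + 1) := by
      unfold ascent
      rw [level]
      split_ifs with h5
      · have h6 : 256 + n + 1 = 512 * 2 ^ level n := by omega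
        have := spot_glue h2 (hx (level n + 1)).2.2
        rw [pow_succ', show 256 + (n + 1) = 512 * 2 ^ level n by omega, h6, this]
      · rfl
    rw [h4]; exact h3
  have h1 := hnode n
  refine ⟨hnode _, ?_⟩
  have hp := ((tree_nodes hd hA0).pred_facts (hnode (n + 1))).1
  unfold par
  rcases hcol with h2 | h2
  · have h3 : ascent x (n + 1) + (-1, -1) = ascent x n := by
      rw [Prod.ext_iff]; simp only [Prod.fst_add, Prod.snd_add]; omega
    rw [h3, if_pos h1]
  · have h3 : ascent x (n + 1) + (1, -1) = ascent x n := by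
      rw [Prod.ext_iff]; simp only [Prod.fst_add, Prod.snd_add]; omega
    rw [h3] at hp ⊢
    rw [if_neg fun h => hp ⟨h, h1⟩]

/-- From a branch of a stage one only gets to the two squares on which it ends. -/
theorem Stage.exit {M j k : ℕ} {p q : Square} (h : Stage M j p) (hj : j < M) (h2 : p.2 = 512 * M - 1)
    (h3 : q.1 - p.1 = 1 ∨ q.1 - p.1 = -1) (hk : q.1 = 64 * (k : ℤ)) : k / 2 = j := by
  rcases h with h | h | h | h | h <;> omega

/-- An infinite path of nodes runs through one branch in each stage. -/
theorem path_stage {f : ℕ → Square} (h0 : f 0 = base)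
    (hf : ∀ n, nodes A (f (n + 1)) = true ∧ par (nodes A) (f (n + 1)) = f n) (hA0 : A 0 0 = true)
    (e : ℕ) : ∃ j < 2 ^ e, A e j = true ∧
      f (256 * 2 ^ e - 256) = (64 * (j : ℤ), ((256 * 2 ^ e : ℕ) : ℤ)) ∧
      ∃ k : ℕ, k / 2 = j ∧ (f (512 * 2 ^ e - 256)).1 = 64 * (k : ℤ) := by
  have hnode : ∀ n, nodes A (f n) = true := by
    rintro (_ | n)
    · rw [h0]; exact nodes_first hA0 (by simp [base]) (by simp [base]) (by simp [base])
    · exact (hf n).1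
  have hrow : ∀ n, (f n).2 = 256 + n := by
    intro n
    induction n with
    | zero => rw [h0]; rfl
    | succ n ih =>
      have := par_snd (nodes A) (f (n + 1))
      rw [(hf n).2] at this; push_cast; omega
  have hcol : ∀ n, (f (n + 1)).1 - (f n).1 = 1 ∨ (f (n + 1)).1 - (f n).1 = -1 := by
    intro n
    have := par_fst (nodes A) (f (n + 1))
    rw [(hf n).2] at this; omega
  have hpos : 0 < 2 ^ e := by positivity
  -- each node in a stage determines a branch, which stays the same
  have hin : ∀ n : ℕ, 256 * 2 ^ e < 256 + n → 256 + n < 512 * 2 ^ e →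
      ∃ j < 2 ^ e, A e j = true ∧ Stage ((2 ^ e : ℕ) : ℤ) j (f n) := fun n h1 h2 =>
    (nodes_inner (by rw [hrow]; omega) (by rw [hrow]; omega)).1 (hnode n)
  obtain ⟨j, hj, hA, hS⟩ := hin (256 * 2 ^ e - 256 + 1) (by omega) (by omega)
  have hall : ∀ i : ℕ, 256 * 2 ^ e - 256 + 1 + i + 256 < 512 * 2 ^ e →
      Stage ((2 ^ e : ℕ) : ℤ) j (f (256 * 2 ^ e - 256 + 1 + i)) := by
    intro i
    induction i with
    | zero => intro _; exact hS
    | succ i ih =>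
      intro hi
      have ih := ih (by omega)
      obtain ⟨j', -, -, h3⟩ := hin (256 * 2 ^ e - 256 + 1 + (i + 1)) (by omega) (by omega)
      have h4 := hcol (256 * 2 ^ e - 256 + 1 + i)
      have h5 := hrow (256 * 2 ^ e - 256 + 1 + i)
      have h6 := hrow (256 * 2 ^ e - 256 + 1 + i + 1)
      rw [show 256 * 2 ^ e - 256 + 1 + (i + 1) = 256 * 2 ^ e - 256 + 1 + i + 1 by omega] at h3 ⊢
      push_cast at h5 h6
      have := ih.unique h3 (by omega) (by omega)
      rwa [← this]
  have hdvd : ∀ e : ℕ, ∃ c : ℕ, (f (256 * 2 ^ e - 256)).1 = 64 * (c : ℤ) := by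
    intro e
    have hpos : 0 < 2 ^ e := by positivity
    obtain ⟨e', j', h1, -, h2⟩ := nodes_iff.1 (hnode (256 * 2 ^ e - 256))
    have h3 := hrow (256 * 2 ^ e - 256)
    have h4 := h2.row (by omega) (by exact_mod_cast h1)
    have hpos : 0 < 2 ^ e' := by positivity
    rcases lt_trichotomy e e' with h7 | rfl | h7
    · have := two_mul_two_pow_le h7; omega
    · generalize 2 ^ e = M at *
      refine ⟨j', ?_⟩
      rcases h2 with h | h | h | h | h <;> omega
    · have := two_mul_two_pow_le h7
      generalize 2 ^ e = M at *
      generalize 2 ^ e' = M' at *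
      rcases h2 with h | h | h | h | h
      · omega
      · omega
      · omega
      · exact ⟨2 * j', by omega⟩
      · exact ⟨2 * j' + 1, by omega⟩
  obtain ⟨c, hc⟩ := hdvd e
  refine ⟨j, hj, hA, ?_, ?_⟩
  · have h1 := hcol (256 * 2 ^ e - 256)
    have h2 := hrow (256 * 2 ^ e - 256)
    have h3 := hrow (256 * 2 ^ e - 256 + 1)
    generalize 2 ^ e = M at *
    rw [Prod.ext_iff]
    rcases hS with h | h | h | h | h <;> constructor <;> simp only <;> omega
  · obtain ⟨k, hk⟩ := hdvd (e + 1)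
    have h4 : 256 * 2 ^ (e + 1) - 256 = 512 * 2 ^ e - 256 := by rw [pow_succ']; omega
    rw [h4] at hk
    refine ⟨k, ?_, hk⟩
    have h1 := hall (256 * 2 ^ e - 2) (by omega)
    have h2 := hrow (256 * 2 ^ e - 256 + 1 + (256 * 2 ^ e - 2))
    have h3 := hcol (256 * 2 ^ e - 256 + 1 + (256 * 2 ^ e - 2))
    rw [show 256 * 2 ^ e - 256 + 1 + (256 * 2 ^ e - 2) + 1 = 512 * 2 ^ e - 256 by omega] at h3
    exact h1.exit hj (by rw [h2]; omega) h3 hk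

/-- A computable path of nodes yields a computable path through the binary tree. -/
theorem computable_path_of_nodes (hA0 : A 0 0 = true) {f : ℕ → Square} (hc : Computable f)
    (h0 : f 0 = base) (hf : ∀ n, nodes A (f (n + 1)) = true ∧ par (nodes A) (f (n + 1)) = f n) :
    ∃ x : ℕ → ℕ, Computable x ∧ ∀ n, A n (x n) = true ∧ x (n + 1) / 2 = x n := by
  have key := path_stage h0 hf hA0
  refine ⟨fun e => (f (256 * 2 ^ e - 256)).1.toNat / 64, ?_, fun e => ?_⟩
  · have h1 : Primrec fun e : ℕ => 256 * 2 ^ e - 256 :=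
      Primrec.nat_sub.comp (Primrec.nat_mul.comp (Primrec.const 256) primrec_two_pow)
        (Primrec.const 256)
    have h2 : Primrec fun z : ℤ => z.toNat / 64 :=
      Primrec.nat_div.comp primrec_int_toNat (Primrec.const 64)
    exact h2.to_comp.comp (Computable.fst.comp (hc.comp h1.to_comp))
  · obtain ⟨j, -, hA, h1, k, hk, h2⟩ := key e
    have h3 : 256 * 2 ^ (e + 1) - 256 = 512 * 2 ^ e - 256 := by rw [pow_succ']; omega
    simp only [h1, h3, h2]
    have h4 : (64 * (j : ℤ)).toNat / 64 = j := by omega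
    have h5 : (64 * (k : ℤ)).toNat / 64 = k := by omega
    rw [h4, h5]; exact ⟨hA, hk⟩

theorem primrec_level : Primrec level :=
  (Primrec.nat_rec₁ (f := fun n v => if 512 * 2 ^ v ≤ 256 + (n + 1) then v + 1 else v) 0
    (Primrec.ite (Primrec.nat_le.comp
      (Primrec.nat_mul.comp (Primrec.const 512) (primrec_two_pow.comp Primrec.snd))
      (Primrec.nat_add.comp (Primrec.const 256) (Primrec.succ.comp Primrec.fst)))
      (Primrec.succ.comp Primrec.snd) Primrec.snd)).of_eq fun n => by
    induction n with
    | zero => rfl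
    | succ n ih => simp only at ih ⊢; rw [ih]; rfl

theorem primrec_spot : Primrec fun t : ℕ × ℕ × ℕ => spot t.1 t.2.1 t.2.2 := by
  have hM : Primrec fun t : ℕ × ℕ × ℕ => t.1 := Primrec.fst
  have hk : Primrec fun t : ℕ × ℕ × ℕ => t.2.1 := Primrec.fst.comp Primrec.snd
  have hr : Primrec fun t : ℕ × ℕ × ℕ => t.2.2 := Primrec.snd.comp Primrec.snd
  have hk2 : Primrec fun t : ℕ × ℕ × ℕ => t.2.1 / 2 := Primrec.nat_div.comp hk (Primrec.const 2)
  have hk3 : Primrec fun t : ℕ × ℕ × ℕ => t.2.1 % 2 := Primrec.nat_mod.comp hk (Primrec.const 2)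
  have mul : ∀ (c : ℕ) {g : ℕ × ℕ × ℕ → ℕ}, Primrec g → Primrec fun t => c * g t := fun c _ hg =>
    Primrec.nat_mul.comp (Primrec.const c) hg
  have add : ∀ {g g' : ℕ × ℕ × ℕ → ℕ}, Primrec g → Primrec g' → Primrec fun t => g t + g' t :=
    fun h h' => Primrec.nat_add.comp h h'
  have out : ∀ {g g' : ℕ × ℕ × ℕ → ℕ}, Primrec g → Primrec g' →
      Primrec fun t : ℕ × ℕ × ℕ => (((g t : ℤ) - (g' t : ℤ), (t.2.2 : ℤ)) : Square) := fun h h' =>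
    Primrec.pair (primrec_int_sub_nat.comp h h') (primrec_int_natCast.comp hr)
  have hrow : Primrec fun t : ℕ × ℕ × ℕ => 32 * (t.2.1 / 2) + 384 * t.1 := add (mul 32 hk2) (mul 384 hM)
  exact Primrec.ite (Primrec.nat_le.comp (Primrec.succ.comp hr) hrow)
    (out (add (mul 64 hk2) hr) (mul 256 hM))
    (Primrec.ite (Primrec.eq.comp hr hrow) (out (add (mul 96 hk2) (mul 128 hM)) (Primrec.const 2))
      (Primrec.ite (Primrec.nat_le.comp hr (add (Primrec.succ.comp hrow) (mul 32 hk3)))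
        (out (add (mul 64 hk2) hr) (add (mul 256 hM) (Primrec.const 2)))
        (out (add (mul 512 hM) (mul 64 hk)) hr)))

/-- There is a way for the black king up the tree such that walking along it is a strategy of low
degree. -/
theorem exists_low_walk (hA : Primrec₂ A) (hd : ∀ e k, A (e + 1) k = true → A e (k / 2) = true)
    (hA0 : ∀ e, ∃ j < 2 ^ e, A e j = true) (hA00 : A 0 0 = true) : ∃ f : ℕ → Square, f 0 = base ∧
      (∀ n, nodes A (f (n + 1)) = true ∧ par (nodes A) (f (n + 1)) = f n) ∧
      IsLow (Strategy.toNat (walk f)) := by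
  -- the place at time `n`, computed from the vertex at height `m` of the path
  let g : ℕ → ℕ → ℕ → Square := fun n m v => spot (2 ^ level n) (v / 2 ^ (m - (level n + 1))) (256 + n)
  let u : ℕ → ℕ := fun n => ((Encodable.decode n : Option (List Move)).map List.length).getD 0 + 2
  let G : ℕ → ℕ → ℕ := fun n v => Encodable.encode ((Encodable.decode n : Option (List Move)).map
    fun h => (g (h.length / 2) (u n) v, g (h.length / 2 + 1) (u n) v))
  have hu : Primrec u := Primrec.nat_add.comp (Primrec.option_getD.comp (Primrec.option_map
    (Primrec.decode (α := List Move)) (Primrec.list_length.comp Primrec.snd).to₂)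
    (Primrec.const 0)) (Primrec.const 2)
  have hg : Primrec fun t : ℕ × ℕ × ℕ => g t.1 t.2.1 t.2.2 := by
    have hl : Primrec fun t : ℕ × ℕ × ℕ => level t.1 := primrec_level.comp Primrec.fst
    exact primrec_spot.comp (Primrec.pair (primrec_two_pow.comp hl) (Primrec.pair
      (Primrec.nat_div.comp (Primrec.snd.comp Primrec.snd) (primrec_two_pow.comp
        (Primrec.nat_sub.comp (Primrec.fst.comp Primrec.snd) (Primrec.succ.comp hl))))
      (Primrec.nat_add.comp (Primrec.const 256) Primrec.fst)))
  have hG : Primrec₂ G := by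
    have hh : Primrec fun t : (ℕ × ℕ) × List Move => t.2.length / 2 :=
      Primrec.nat_div.comp (Primrec.list_length.comp Primrec.snd) (Primrec.const 2)
    have hu' : Primrec fun t : (ℕ × ℕ) × List Move => u t.1.1 :=
      hu.comp (Primrec.fst.comp Primrec.fst)
    have hv : Primrec fun t : (ℕ × ℕ) × List Move => t.1.2 := Primrec.snd.comp Primrec.fst
    have h1 : Primrec₂ fun (t : ℕ × ℕ) (h : List Move) =>
        ((g (h.length / 2) (u t.1) t.2, g (h.length / 2 + 1) (u t.1) t.2) : Move) :=
      Primrec.pair (hg.comp (Primrec.pair hh (Primrec.pair hu' hv)))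
        (hg.comp (Primrec.pair (Primrec.succ.comp hh) (Primrec.pair hu' hv)))
    exact Primrec.encode.comp (Primrec.option_map
      ((Primrec.decode (α := List Move)).comp Primrec.fst) h1)
  obtain ⟨x, hx, hlow⟩ := low_basis hA hd hA0 hu.to_comp hG.to_comp
  have hdiv : ∀ d i, x (i + d) / 2 ^ d = x i := by
    intro d
    induction d with
    | zero => simp
    | succ d ih => intro i; rw [pow_succ', ← Nat.div_div_eq_div_mul, ← Nat.add_assoc, (hx _).2.2, ih]
  have hga : ∀ n m, n + 1 ≤ m → g n m (x m) = ascent x n := by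
    intro n m hm
    have h1 := level_le n
    have h2 := hdiv (m - (level n + 1)) (level n + 1)
    rw [show level n + 1 + (m - (level n + 1)) = m by omega] at h2
    simp only [g, ascent, h2]
  refine ⟨ascent x, ascent_zero ?_, ascent_spec hd hA00 hx, ?_⟩
  · have := hx 0
    rw [this.2.2]; simpa using this.1
  · convert hlow using 1
    funext n
    simp only [Strategy.toNat, G]
    congr 1
    rcases hn : (Encodable.decode n : Option (List Move)) with _ | h
    · rfl
    · have hun : u n = h.length + 2 := by simp only [u]; rw [hn]; rfl
      simp only [Option.map_some, hun, walk]
      rw [hga _ _ (by omega), hga _ _ (by omega)]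

end paths


/-! ### The position and the strategies of white are computable -/

section computability
variable {A : ℕ → ℕ → Bool}

theorem primrec_nodes (hA : Primrec₂ A) : Primrec (nodes A) := by
  have hj : Primrec fun t : ℕ × ℕ × Square => t.1 := Primrec.fst
  have he : Primrec fun t : ℕ × ℕ × Square => t.2.1 := Primrec.fst.comp Primrec.snd
  have hx : Primrec fun t : ℕ × ℕ × Square => t.2.2.1 := Primrec.fst.comp (Primrec.snd.comp Primrec.snd)
  have hy : Primrec fun t : ℕ × ℕ × Square => t.2.2.2 := Primrec.snd.comp (Primrec.snd.comp Primrec.snd)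
  have lin : ∀ a b c : ℕ, Primrec fun t : ℕ × ℕ × Square => ((a * t.1 + b * 2 ^ t.2.1 + c : ℕ) : ℤ) :=
    fun a b c => primrec_int_natCast.comp (Primrec.nat_add.comp (Primrec.nat_add.comp
      (Primrec.nat_mul.comp (Primrec.const a) hj)
      (Primrec.nat_mul.comp (Primrec.const b) (primrec_two_pow.comp he))) (Primrec.const c))
  have add : ∀ {g g' : ℕ × ℕ × Square → ℤ}, Primrec g → Primrec g' → Primrec fun t => g t + g' t :=
    fun h h' => primrec_int_add.comp h h'
  have le : ∀ {g g' : ℕ × ℕ × Square → ℤ}, Primrec g → Primrec g' → PrimrecPred fun t => g t ≤ g' t :=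
    fun h h' => primrec_int_le.comp h h'
  have eq : ∀ {g g' : ℕ × ℕ × Square → ℤ}, Primrec g → Primrec g' → PrimrecPred fun t => g t = g' t :=
    fun h h' => Primrec.eq.comp h h'
  have hS : PrimrecPred fun t : ℕ × ℕ × Square => Stage ((2 ^ t.2.1 : ℕ) : ℤ) t.1 t.2.2 := by
    have h := ((le (lin 0 256 0) hy).and ((le (add hy (lin 0 0 1)) (lin 32 384 0)).and
        (eq (add hx (lin 0 256 0)) (add hy (lin 64 0 0))))).or
      (((eq hy (lin 32 384 0)).and (eq (add hx (lin 0 0 2)) (lin 96 128 0))).or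
      (((le (lin 32 384 1) hy).and ((le hy (lin 32 384 33)).and
        (eq (add hx (lin 0 256 2)) (add hy (lin 64 0 0))))).or
      (((le (lin 32 384 1) hy).and ((le hy (lin 0 512 0)).and
        (eq (add hx hy) (lin 128 512 0)))).or
      ((le (lin 32 384 33) hy).and ((le hy (lin 0 512 0)).and
        (eq (add hx hy) (lin 128 512 64)))))))
    refine h.of_eq fun t => ?_
    obtain ⟨j, e, x, y⟩ := t
    unfold Stage
    simp only
    generalize 2 ^ e = M
    omega
  have h1 : PrimrecRel fun (j : ℕ) (t : ℕ × Square) =>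
      A t.1 j = true ∧ Stage ((2 ^ t.1 : ℕ) : ℤ) j t.2 :=
    PrimrecPred.and (Primrec.eq.comp (hA.comp he hj) (Primrec.const true)) hS
  have h2 : PrimrecRel fun (e : ℕ) (q : Square) =>
      ∃ j < 2 ^ e, A e j = true ∧ Stage ((2 ^ e : ℕ) : ℤ) j q :=
    (primrecRel_exists_lt h1).comp (primrec_two_pow.comp Primrec.fst) Primrec.id
  have h3 : PrimrecPred fun q : Square => ∃ e < q.2.toNat, ∃ j < 2 ^ e, A e j = true ∧
      Stage ((2 ^ e : ℕ) : ℤ) j q :=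
    (primrecRel_exists_lt h2).comp (primrec_int_toNat.comp Primrec.snd) Primrec.id
  exact h3.decide.of_eq fun q => by simp only [nodes]

variable {N R : Square → Bool}

theorem primrec_shift {α : Type*} [Primcodable α] {g : Square → α} (hg : Primrec g) (d : Square) :
    Primrec fun q => g (q + d) :=
  hg.comp (primrec_square_add.comp Primrec.id (Primrec.const d))

theorem primrec_cellOf (hN : Primrec N) (hR : Primrec R) : Primrec (cellOf N R) := by
  have and : ∀ {a b : Square → Bool}, Primrec a → Primrec b → Primrec fun q => a q && b q :=
    fun h h' => Primrec.and.comp h h'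
  have or : ∀ {a b : Square → Bool}, Primrec a → Primrec b → Primrec fun q => a q || b q :=
    fun h h' => Primrec.or.comp h h'
  have hv : Primrec (isVertex N) :=
    and (and hN (primrec_shift hN (1, 1))) (primrec_shift hN (-1, 1))
  have n := fun d => primrec_shift hN d
  have r := fun d => primrec_shift hR d
  have v := fun d => primrec_shift hv d
  have ite : ∀ {c : Square → Bool} {a b : Square → Option PieceKind}, Primrec c → Primrec a →
      Primrec b → Primrec fun q => if c q = true then a q else b q := fun hc ha hb =>
    Primrec.ite (Primrec.eq.comp hc (Primrec.const true)) ha hb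
  exact ite hR (Primrec.const none)
    (ite (or (or (r (-1, 1)) (r (1, 1))) (r (0, 2))) (Primrec.const (some PieceKind.rook))
    (ite (or (and (n (-1, 1)) (n (-2, 0))) (and (n (1, 1)) (n (2, 0)))) (Primrec.const (some PieceKind.rook))
    (ite (v (-2, 2)) (Primrec.const (some PieceKind.bishop))
    (ite (v (3, 1)) (Primrec.const (some PieceKind.queen))
    (ite (or (v (4, 1)) (v (0, -3))) (Primrec.const (some PieceKind.rook))
    (ite (or (or hv (and (and (and (and hN (n (-1, -1))) (n (-2, -2))) (n (-1, -3))) (n (0, -4))))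
      (and (and (and hN (n (1, -1))) (n (2, -2))) (n (1, -3))))
      (Primrec.const (some PieceKind.knight)) (Primrec.const (some PieceKind.pawn))))))))

/-- On the initial position only the root is empty on the way of the king. -/
theorem start_board_eq {o : Square} (T : Tree N R o) (q : Square) : (start N R o).board q =
    if q = o then some (.black, .king) else sea N R (0, 0) q := by
  show climb N R (0, 0) o o q = _
  unfold climb
  split_ifs with h1 h2
  · rfl
  · exact absurd (T.eaten_root h2) h1
  · rfl

theorem primrec_start {o : Square} (T : Tree N R o) (hN : Primrec N) (hR : Primrec R) :
    Primrec (start N R o).board := by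
  have eq : ∀ d : Square, PrimrecPred fun q : Square => q = d := fun d =>
    Primrec.eq.comp Primrec.id (Primrec.const d)
  have hp : Primrec fun k : PieceKind => (((Color.white, k) : Piece)) :=
    Primrec.pair (Primrec.const _) Primrec.id
  have hs : Primrec (sea N R (0, 0)) :=
    Primrec.ite (eq (0, 0)) (Primrec.const _) (Primrec.ite ((eq (0, 0)).or (eq (1, 0)))
      (Primrec.const none) (Primrec.option_map (primrec_cellOf hN hR) (hp.comp Primrec.snd).to₂))
  exact (Primrec.ite (eq o) (Primrec.const _) hs).of_eq fun q => (start_board_eq T q).symm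

theorem primrec_length_half : Primrec fun h : List Move => h.length / 2 :=
  Primrec.nat_div.comp Primrec.list_length (Primrec.const 2)

theorem computable_shuffle : Computable shuffle := by
  have h : Primrec kingAt := Primrec.ite (Primrec.eq.comp
    (Primrec.nat_mod.comp Primrec.id (Primrec.const 2)) (Primrec.const 0))
    (Primrec.const _) (Primrec.const _)
  exact (Primrec.pair (h.comp primrec_length_half)
    (h.comp (Primrec.succ.comp primrec_length_half))).to_comp

theorem primrec_getLast? : Primrec fun h : List Move => h.getLast? :=
  (Primrec.list_head?.comp Primrec.list_reverse).of_eq fun h => by simp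

theorem computable_push : Computable push := by
  have h1 : Primrec₂ fun (_ : List Move) (m : Move) => ((m.1 - (0, 1), m.1) : Move) :=
    Primrec.pair (primrec_square_sub.comp (Primrec.fst.comp Primrec.snd) (Primrec.const _))
      (Primrec.fst.comp Primrec.snd)
  refine (Primrec.option_casesOn primrec_getLast? (Primrec.const ((0, 0), (0, 0))) h1).to_comp.of_eq
    fun h => ?_
  unfold push
  cases h.getLast? <;> rfl

instance : Finite PieceKind := Finite.of_equiv _ PieceKind.equivFin.symm

instance : Finite Color := Finite.of_equiv _ Color.equivBool.symm

/-- The squares of the window, with numbers. -/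
def windowSquare (i : Fin 729) : Square := ((i.1 % 27 : ℕ) - (13 : ℕ), (i.1 / 27 : ℕ) - (13 : ℕ))

/-- What the hunter plays depends only on the window, and there are only finitely many windows; hence no
program for finding mates is needed. -/
theorem computable_pick_window {p : Position} (hp : Computable p.board) :
    Computable₂ fun (h : List Move) (x : Square) => pick (window (after p h).board x) := by
  classical
  let g : (Fin 729 → Option Piece) → Option LMove := fun w => pick fun q =>
    if hq : q.1.natAbs ≤ 13 ∧ q.2.natAbs ≤ 13 then
      w ⟨(q.1 + 13).toNat + 27 * (q.2 + 13).toNat, by omega⟩ else none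
  have h1 : ∀ i, Computable fun t : List Move × Square => (after p t.1).board (t.2 + windowSquare i) :=
    fun i => (computable_after_board hp).comp Computable.fst
      (primrec_square_add.comp Primrec.snd (Primrec.const _)).to_comp
  refine (computable_of_finite_window h1 g).of_eq fun t => ?_
  simp only [g]
  congr 1
  funext q
  unfold window
  split_ifs with hq
  · congr 2
    rw [windowSquare, Prod.ext_iff]
    simp only
    omega
  · rfl

theorem computable_hunter {p : Position} (hp : Computable p.board) {sh : Strategy}
    (hsh : Computable sh) : Computable (hunter p sh) := by
  have h1 : Computable fun t : (List Move × Move) => pick (window (after p t.1).board t.2.2) :=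
    (computable_pick_window hp).comp Computable.fst (Computable.snd.comp Computable.snd)
  have h2 : Primrec₂ fun (t : List Move × Move) (mv : LMove) =>
      ((t.2.2 + mv.1, t.2.2 + mv.tgt) : Move) := by
    have hx : Primrec fun s : (List Move × Move) × LMove => s.1.2.2 :=
      Primrec.snd.comp (Primrec.snd.comp Primrec.fst)
    have hmul : Primrec₂ fun (n : ℕ) (d : Square) => n • d :=
      (Primrec.nat_rec (f := fun _ : Square => (0 : Square)) (g := fun d r => r.2 + d)
        (Primrec.const 0) (primrec_square_add.comp (Primrec.snd.comp Primrec.snd)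
          Primrec.fst)).swap.of_eq fun n d => by
        induction n with
        | zero => simp [Function.swap]
        | succ n ih =>
          simp only [Function.swap] at ih ⊢
          rw [succ_nsmul, ← ih]
    have ht : Primrec fun mv : LMove => mv.tgt :=
      primrec_square_add.comp Primrec.fst (hmul.comp (Primrec.snd.comp Primrec.snd)
        (Primrec.fst.comp Primrec.snd))
    exact Primrec.pair (primrec_square_add.comp hx (Primrec.fst.comp Primrec.snd))
      (primrec_square_add.comp hx (ht.comp Primrec.snd))
  have h3 : Computable₂ fun (h : List Move) (m : Move) => Option.casesOn (motive := fun _ => Move)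
      (pick (window (after p h).board m.2)) (sh h) fun mv => (m.2 + mv.1, m.2 + mv.tgt) :=
    Computable.option_casesOn h1 (hsh.comp Computable.fst) h2.to_comp
  refine (Computable.option_casesOn primrec_getLast?.to_comp hsh h3).of_eq fun h => ?_
  unfold hunter
  cases h.getLast? with
  | none => rfl
  | some m =>
    simp only
    cases pick (window (after p h).board m.2) <;> rfl

end computability

/-! ### Neither player has a winning strategy -/

theorem arises_playSeq {p : Position} {τ σ : Strategy} (n : ℕ) (h : IsPlay p (playSeq p τ σ n)) :
    Arises p .white τ (playSeq p τ σ n) ∧ Arises p .black σ (playSeq p τ σ n) := by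
  induction n with
  | zero =>
    have h0 : ∀ (c : Color) (τ' : Strategy), Arises p c τ' [] := fun c τ' =>
      ⟨fun h' m hp => by simp at hp, fun h' m hp => by simp at hp⟩
    exact ⟨h0 _ _, h0 _ _⟩
  | succ n ih =>
    simp only [playSeq] at h ⊢
    obtain ⟨h1, h2⟩ := isPlay_concat.1 h
    obtain ⟨h3, h4⟩ := ih h1
    rw [arises_concat, arises_concat]
    refine ⟨⟨h3, h2, fun h5 => by rw [if_pos h5]⟩, h4, h2, fun h5 => by rw [if_neg (by rw [h5]; simp)]⟩

theorem not_hasWinningStrategy {p : Position} {τ σ : Strategy} (hτ : IsDrawingStrategy p .white τ)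
    (hσ : IsDrawingStrategy p .black σ) (c : Color) : ¬ HasWinningStrategy p c := by
  cases c with
  | white =>
    rintro ⟨τ', h1, h2⟩
    obtain ⟨n, h3, -, h4⟩ := h2 σ hσ.1
    exact hσ.2 _ (arises_playSeq n h3).2 h4
  | black =>
    rintro ⟨σ', h1, h2⟩
    obtain ⟨n, h3, -, h4⟩ := h2 τ hτ.1
    exact hτ.2 _ (arises_playSeq n h3).1 h4

end InfChess

theorem mainTheorem5 :
    ∃ p : InfChess.Position, p.Proper ∧
      -- the position is computable
      Computable p.board ∧
      -- in computable play it is a win for white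
      (∃ τ : InfChess.Strategy, Computable τ ∧ InfChess.IsStrategy p .white τ ∧
        InfChess.DefeatsAllComputable p τ) ∧
      -- moreover with a strategy in which every move is check
      (∃ τ : InfChess.Strategy, Computable τ ∧ InfChess.IsStrategy p .white τ ∧
        InfChess.DefeatsAllComputable p τ ∧ InfChess.AlwaysChecks p τ) ∧
      -- and with one that only shuffles the king until the last four, mating, moves
      (∃ τ : InfChess.Strategy, Computable τ ∧ InfChess.IsStrategy p .white τ ∧
        InfChess.DefeatsAllComputable p τ ∧ InfChess.ShufflesUntilMateIn p τ 4) ∧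
      -- in arbitrary play it is a draw
      (∀ c : InfChess.Color, ¬ InfChess.HasWinningStrategy p c) ∧
      (∃ τ : InfChess.Strategy, Computable τ ∧ InfChess.Oblivious τ ∧
        InfChess.IsDrawingStrategy p .white τ) ∧
      (∃ σ : InfChess.Strategy, InfChess.IsLow σ.toNat ∧ InfChess.Oblivious σ ∧
        InfChess.IsDrawingStrategy p .black σ) := by
  open InfChess in
  have T := tree_nodes alive_down alive_zero
  have hch := child_base (A := alive) alive_zero
  have hno : ¬ ∃ f : ℕ → Square, Computable f ∧ f 0 = base ∧ ∀ n, nodes alive (f (n + 1)) = true ∧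
      par (nodes alive) (f (n + 1)) = f n := fun ⟨f, h1, h2, h3⟩ =>
    no_computable_path (computable_path_of_nodes alive_zero h1 h2 h3)
  obtain ⟨f, hf0, hf, hlow⟩ := exists_low_walk alive_primrec alive_down exists_alive alive_zero
  have hboard : Computable (start (nodes alive) isBase base).board :=
    (primrec_start T (primrec_nodes alive_primrec)
      (Primrec.eq.comp Primrec.id (Primrec.const base)).decide).to_comp
  have hhunter := computable_hunter hboard computable_shuffle
  have hG := hunter_guide T hch
  have hP := push_guide T hch
  have hw := shuffle_draws T hch
  have hb := walk_draws T hf0 hf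
  exact ⟨start (nodes alive) isBase base, start_proper T, hboard,
    ⟨_, hhunter, hG.isStrategy, hG.defeats hhunter hno⟩,
    ⟨push, computable_push, hP.isStrategy, hP.defeats computable_push hno, push_checks T hch⟩,
    ⟨_, hhunter, hG.isStrategy, hG.defeats hhunter hno, hunter_shuffles T hch⟩,
    not_hasWinningStrategy hw hb,
    ⟨shuffle, computable_shuffle, fun h h' e => by simp only [shuffle, e], hw⟩,
    ⟨walk f, hlow, fun h h' e => by simp only [walk, e], hb⟩⟩
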